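/- **Setting.** Let $n\ge 0$, $\omega,\nu>0$, let $\alpha,\beta:[0,1]\to[0,\infty)$ be $C^1$ with $\alpha+\beta>0$, and let $p_{\rm data}$ be a probability measure on $\mathbb R^n$ with finite second moment. Let $q=\mathcal N(0,\omega^2I)$, $p(\bar x\mid x)=\mathcal N(\bar x;x,\nu^2I)$, $h(x\mid\bar x,t)=\alpha(t)\log q(x)+\beta(t)\log p(\bar x\mid x)$, and for $t\in[0,1]$ $$\rho(x\mid\bar x,t)=\frac{e^{h(x\mid\bar x,t)}}{\int_{\mathbb R^n}e^{h(x'\mid\bar x,t)}\,dx'},\qquad \bar\rho(x,t)=\mathbb E_{\bar x\sim p_{\rm data}}\big[\rho(x\mid\bar x,t)\big],$$ $$\gamma(x,\bar x,t)=\frac{\dot\alpha(t)}{\omega^2}\|x\|^2+\frac{\dot\beta(t)}{\nu^2}\|x-\bar x\|^2,\qquad \bar\gamma(\bar x,t)=\int_{\mathbb R^n}\rho(x\mid\bar x,t)\,\gamma(x,\bar x,t)\,dx .$$ Write $H^1_0(\mathbb R^n,\bar\rho(\cdot,t))$ for the closure of $C_c^\infty(\mathbb R^n)$ in the $H^1$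 norm weighted by $\bar\rho(\cdot,t)$. A $C^2$ function $\varphi$ *solves the density-weighted Poisson equation at time $t$* if on $\mathbb R^n$ $$\nabla\cdot\big(\bar\rho(\cdot,t)\nabla\varphi\big)=\tfrac12\,\mathbb E_{\bar x\sim p_{\rm data}}\big[\rho(\cdot\mid\bar x,t)\,(\gamma(\cdot,\bar x,t)-\bar\gamma(\bar x,t))\big].\tag{P}$$ **(a) First-order optimality of one step.** Let $t\in[0,1)$ and let $\varphi\in C^2\cap H^1_0(\mathbb R^n,\bar\rho(\cdot,t))$ be such that for all sufficiently small $\Delta>0$ the forward Euler map $T_\Delta(x)=x+\Delta\nabla\varphi(x)$ is a bijection of $\mathbb R^n$ with differentiable inverse and $\mathrm{KL}[(T_\Delta)_\#\bar\rho(\cdot,t)\,\|\,\bar\rho(\cdot,t+\Delta)]<\infty$. Then $\varphi$ solves (P) at time $t$ if and only if for every vector field $\eta\in C_c^\infty(\mathbb R^n;\mathbb R^n)$ the first variation $$\delta_\Delta(\eta)=\frac{d}{d\varepsilon}\Big|_{\varepsilon=0}\mathrm{KL}\big[(T_\Delta+\varepsilon\eta)_\#\bar\rho(\cdot,t)\,\big\|\,\bar\rho(\cdot,t+\Delta)\big]$$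 exists for all sufficiently small $\Delta>0$ (the divergence being finite for $\varepsilon$ near $0$), and $\delta_\Delta(\eta)=o(\Delta)$ as $\Delta\downarrow0$. **(b) Minimization along the flow.** A *potential flow* is a pair $(\Phi,X)$ such that $\Phi(\cdot,t)\in C^2\cap H^1_0(\mathbb R^n,\bar\rho(\cdot,t))$ for each $t\in[0,1]$, $\nabla_x\Phi$ and $\nabla_x^2\Phi$ are continuous on $\mathbb R^n\times[0,1]$, and $X(x,0)=x$, $\frac{d}{dt}X(x,t)=\nabla_x\Phi(X(x,t),t)$ for all $x\in\mathbb R^n$ and $t\in[0,1]$. Its flow-driven homotopy $\rho_\Phi(\cdot,t)$ is the law of $X(x,t)$ when $x$ has law $\bar\rho(\cdot,0)$. For every potential flow $(\Phi,X)$: 1. $\Phi(\cdot,t)$ solves (P) at every $t\in[0,1]$ if and only if $\rho_\Phi(\cdot,t)=\bar\rho(\cdot,t)$ for every $t\in[0,1]$; 2. if $\Phi(\cdot,t)$ solves (P) at every $t\in[0,1]$, then for every $t\in[0,1]$ it minimizes $\mathrm{KL}[\rho_\Phi(\cdot,t)\,\|\,\bar\rho(\cdot,t)]$ among all potential flows;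 3. conversely, provided that some potential flow solves (P) at every $t\in[0,1]$, if for every $t\in[0,1]$ $(\Phi,X)$ minimizes $\mathrm{KL}[\rho_\Phi(\cdot,t)\,\|\,\bar\rho(\cdot,t)]$ among all potential flows, then $\Phi(\cdot,t)$ solves (P) at every $t\in[0,1]$. -/

import Mathlib

open MeasureTheory Filter Topology InformationTheory Set
open scoped ENNReal

noncomputable section

namespace VPFB

/-- The sample space `ℝⁿ` with its Euclidean norm. -/
abbrev E (n : ℕ) : Type := EuclideanSpace ℝ (Fin n)

/-- Density at `x` of the isotropic Gaussian `N(m, s² I)` on `ℝⁿ`. -/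
def gaussianDensity {n : ℕ} (m : E n) (s : ℝ) (x : E n) : ℝ :=
  (2 * Real.pi * s ^ 2) ^ (-(n : ℝ) / 2) * Real.exp (-‖x - m‖ ^ 2 / (2 * s ^ 2))

/-- Parameters of the homotopy: the standard deviation `ω` of the prior, the standard deviation
`ν` of the conditional data likelihood, the schedules `α`, `β`, and the data distribution. -/
structure Params (n : ℕ) where
  ω : ℝ
  ν : ℝ
  α : ℝ → ℝ
  β : ℝ → ℝ
  pdata : Measure (E n)

/-- Conditions on the parameters under which the homotopy is defined on the whole of `[0, 1]`. -/
structure Params.Valid {n : ℕ} (P : Params n) : Prop where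
  ω_pos : 0 < P.ω
  ν_pos : 0 < P.ν
  α_smooth : ContDiffOn ℝ 1 P.α (Icc 0 1)
  β_smooth : ContDiffOn ℝ 1 P.β (Icc 0 1)
  α_nonneg : ∀ t ∈ Icc (0 : ℝ) 1, 0 ≤ P.α t
  β_nonneg : ∀ t ∈ Icc (0 : ℝ) 1, 0 ≤ P.β t
  sum_pos : ∀ t ∈ Icc (0 : ℝ) 1, 0 < P.α t + P.β t
  prob : IsProbabilityMeasure P.pdata
  moment : Integrable (fun y => ‖y‖ ^ 2) P.pdata

namespace Params

variable {n : ℕ} (P : Params n)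

/-- `h(x | x̄, t) = α(t) log q(x) + β(t) log p(x̄ | x)`. -/
def logHomotopy (x xbar : E n) (t : ℝ) : ℝ :=
  P.α t * Real.log (gaussianDensity 0 P.ω x) + P.β t * Real.log (gaussianDensity x P.ν xbar)

/-- The conditional homotopy `ρ(x | x̄, t) = exp h(x | x̄, t) / ∫ exp h(x' | x̄, t) dx'`. -/
def condDensity (x xbar : E n) (t : ℝ) : ℝ :=
  Real.exp (P.logHomotopy x xbar t) / ∫ x', Real.exp (P.logHomotopy x' xbar t)

/-- The marginal homotopy `ρ̄(x, t)`. -/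
def marginalDensity (x : E n) (t : ℝ) : ℝ :=
  ∫ xbar, P.condDensity x xbar t ∂P.pdata

/-- The probability law with density `ρ̄(·, t)`. -/
def marginalLaw (t : ℝ) : Measure (E n) :=
  volume.withDensity fun x => ENNReal.ofReal (P.marginalDensity x t)

/-- The innovation `γ(x, x̄, t)`. -/
def innovation (x xbar : E n) (t : ℝ) : ℝ :=
  derivWithin P.α (Icc 0 1) t / P.ω ^ 2 * ‖x‖ ^ 2 +
    derivWithin P.β (Icc 0 1) t / P.ν ^ 2 * ‖x - xbar‖ ^ 2

/-- The expectation `γ̄` of the innovation under `ρ(· | x̄, t)`. -/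
def meanInnovation (xbar : E n) (t : ℝ) : ℝ :=
  ∫ x, P.condDensity x xbar t * P.innovation x xbar t

/-- The right-hand side `½ E_{p_data}[ρ(x | x̄, t) (γ - γ̄)]` of the Poisson equation. -/
def source (x : E n) (t : ℝ) : ℝ :=
  1 / 2 * ∫ xbar, P.condDensity x xbar t *
    (P.innovation x xbar t - P.meanInnovation xbar t) ∂P.pdata

end Params

/-- The divergence of a vector field. -/
def divergence {n : ℕ} (F : E n → E n) (x : E n) : ℝ :=
  LinearMap.trace ℝ (E n) (fderiv ℝ F x : E n →ₗ[ℝ] E n)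

/-- Membership of a differentiable function in the weighted Sobolev space `H¹₀(ℝⁿ, m)`, the
closure of the smooth compactly supported functions in the weighted `H¹` norm. -/
structure MemH10 {n : ℕ} (m : Measure (E n)) (φ : E n → ℝ) : Prop where
  differentiable : Differentiable ℝ φ
  memLp : MemLp φ 2 m
  memLp_gradient : MemLp (gradient φ) 2 m
  approx : ∃ ψ : ℕ → E n → ℝ,
    (∀ k, ContDiff ℝ (⊤ : ℕ∞) (ψ k) ∧ HasCompactSupport (ψ k)) ∧
    Tendsto (fun k => eLpNorm (fun x => φ x - ψ k x) 2 m) atTop (𝓝 0) ∧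
    Tendsto (fun k => eLpNorm (fun x => gradient φ x - gradient (ψ k) x) 2 m) atTop (𝓝 0)

/-- `φ` solves the density-weighted Poisson equation
`∇ · (ρ̄(·, t) ∇φ) = ½ E_{p_data}[ρ(· | x̄, t) (γ - γ̄)]`. -/
def SolvesPoisson {n : ℕ} (P : Params n) (t : ℝ) (φ : E n → ℝ) : Prop :=
  ∀ x, divergence (fun y => P.marginalDensity y t • gradient φ y) x = P.source x t

/-- One forward Euler step of length `Δ` for `dx/dt = ∇φ(x)`. -/
def eulerStep {n : ℕ} (φ : E n → ℝ) (Δ : ℝ) (x : E n) : E n :=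
  x + Δ • gradient φ x

/-- The divergence `KL[(α + ε η)_# ρ̄(·, t) ‖ ρ̄(·, t + Δ)]`, where `α` is the Euler step of length
`Δ` and `η` is a vector field. -/
def stepKL {n : ℕ} (P : Params n) (t : ℝ) (φ : E n → ℝ) (η : E n → E n) (Δ ε : ℝ) : ℝ≥0∞ :=
  klDiv ((P.marginalLaw t).map fun x => eulerStep φ Δ x + ε • η x) (P.marginalLaw (t + Δ))

/-- Potentials for which the one-step problem at time `t` makes sense: for small step lengths the
Euler step is a bijection with differentiable inverse and the divergence is finite. -/
structure StepAdmissible {n : ℕ} (P : Params n) (t : ℝ) (φ : E n → ℝ) : Prop where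
  smooth : ContDiff ℝ 2 φ
  memH10 : MemH10 (P.marginalLaw t) φ
  diffeo : ∀ᶠ Δ in 𝓝[>] (0 : ℝ), ∃ g : E n → E n, Differentiable ℝ g ∧
    Function.LeftInverse g (eulerStep φ Δ) ∧ Function.RightInverse g (eulerStep φ Δ)
  finite : ∀ᶠ Δ in 𝓝[>] (0 : ℝ), stepKL P t φ 0 Δ 0 ≠ ∞

/-- First-order optimality at time `t`: for every trial field `η` the first variation `δ Δ` of the
divergence after one step of length `Δ` exists for small `Δ > 0`, and vanishes to first order
in `Δ`. -/
def FirstOrderOptimal {n : ℕ} (P : Params n) (t : ℝ) (φ : E n → ℝ) : Prop :=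
  ∀ η : E n → E n, ContDiff ℝ (⊤ : ℕ∞) η → HasCompactSupport η →
    ∃ δ : ℝ → ℝ,
      (∀ᶠ Δ in 𝓝[>] (0 : ℝ), (∀ᶠ ε in 𝓝 (0 : ℝ), stepKL P t φ η Δ ε ≠ ∞) ∧
        HasDerivAt (fun ε => (stepKL P t φ η Δ ε).toReal) (δ Δ) 0) ∧
      Tendsto (fun Δ => δ Δ / Δ) (𝓝[>] 0) (𝓝 0)

/-- `X x t` is the position at time `t ∈ [0, 1]` of the particle that starts at `x` and follows
`dx/dt = ∇ₓΦ(x, t)`, where `Φ(·, t) ∈ H¹₀(ℝⁿ, ρ̄(·, t))` is twice continuously differentiable. -/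
structure IsPotentialFlow {n : ℕ} (P : Params n) (Φ : E n → ℝ → ℝ) (X : E n → ℝ → E n) :
    Prop where
  smooth : ∀ t ∈ Icc (0 : ℝ) 1, ContDiff ℝ 2 fun x => Φ x t
  continuous_gradient :
    ContinuousOn (fun z : E n × ℝ => gradient (fun x => Φ x z.2) z.1) (univ ×ˢ Icc 0 1)
  continuous_hessian :
    ContinuousOn (fun z : E n × ℝ => fderiv ℝ (gradient fun x => Φ x z.2) z.1)
      (univ ×ˢ Icc 0 1)
  memH10 : ∀ t ∈ Icc (0 : ℝ) 1, MemH10 (P.marginalLaw t) fun x => Φ x t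
  start : ∀ x, X x 0 = x
  ode : ∀ x, ∀ t ∈ Icc (0 : ℝ) 1,
    HasDerivWithinAt (X x) (gradient (fun y => Φ y t) (X x t)) (Icc 0 1) t

/-- The flow-driven homotopy `ρ_Φ(·, t)`: the law at time `t` of particles that start with law
`ρ̄(·, 0)` and follow the flow `X`. -/
def flowLaw {n : ℕ} (P : Params n) (X : E n → ℝ → E n) (t : ℝ) : Measure (E n) :=
  (P.marginalLaw 0).map fun x => X x t

/-- The flow `X` minimizes `KL[ρ_Φ(·, t) ‖ ρ̄(·, t)]` among all potential flows. -/
def MinimizesKL {n : ℕ} (P : Params n) (X : E n → ℝ → E n) (t : ℝ) : Prop :=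
  ∀ (Ψ : E n → ℝ → ℝ) (Y : E n → ℝ → E n), IsPotentialFlow P Ψ Y →
    klDiv (flowLaw P X t) (P.marginalLaw t) ≤ klDiv (flowLaw P Y t) (P.marginalLaw t)

end VPFB

end

/-!
Write `ρ̄ₜ` for the marginal density. The right-hand side of the Poisson equation is `-∂ₜρ̄ₜ`,
so for a velocity field `w` the equation says that `div w + ∇ log ρ̄ₜ · w + ∂ₜ log ρ̄ₜ`, the
residual, vanishes. Completing the square turns `ρ̄ₜ` into a rescaled Gaussian smoothing of the
data law, which makes `log ρ̄ₜ(x)` as smooth in `(x, t)` as the schedules allow.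

*One step.* The part of the first variation that is linear in the step length `Δ` is the integral
of the residual against `div (ρ̄ₜ η)`. If it vanishes for every trial field `η` then the residual is
constant, and the constant is zero because the integrable field `ρ̄ₜ ∇φ` has no flux at infinity.

*Flow.* The residual is the rate of change of `log ρ̄ₜ(X(x, t)) + log det DX(x, t)` along a
trajectory. It vanishes if and only if the change of variables formula identifies the law of the
flow with `ρ̄ₜ`; the minimal divergence is then zero, and only `ρ̄ₜ` attains it.
-/

noncomputable section

namespace VPFB

/-! ### Differentiation under the integral sign, traces and determinants -/

section DerivUnderIntegral

variable {Y V : Type*} [MeasurableSpace Y]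

theorem hasDerivWithinAt_integral_of_dominated {μ : Measure Y}
    {G : Type*} [NormedAddCommGroup G] [NormedSpace ℝ G]
    {F F' : ℝ → Y → G} {bound : Y → ℝ} {s : Set ℝ} (hs : Convex ℝ s) {t : ℝ} (ht : t ∈ s)
    (hF : ∀ r ∈ s, Integrable (F r) μ)
    (hF' : ∀ᵐ y ∂μ, ∀ r ∈ s, HasDerivWithinAt (fun r => F r y) (F' r y) s r)
    (hb : ∀ᵐ y ∂μ, ∀ r ∈ s, ‖F' r y‖ ≤ bound y) (hbound : Integrable bound μ) :
    HasDerivWithinAt (fun r => ∫ y, F r y ∂μ) (∫ y, F' t y ∂μ) s t := by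
  rw [hasDerivWithinAt_iff_tendsto_slope]
  have hmem : ∀ᶠ r in 𝓝[s \ {t}] t, r ∈ s \ {t} := self_mem_nhdsWithin
  have hslope : Tendsto (fun r => ∫ y, slope (fun r => F r y) t r ∂μ) (𝓝[s \ {t}] t)
      (𝓝 (∫ y, F' t y ∂μ)) := by
    refine tendsto_integral_filter_of_dominated_convergence bound ?_ ?_ hbound ?_
    · filter_upwards [hmem] with r hr
      simp only [slope_def_module]
      exact (((hF r hr.1).sub (hF t ht)).smul (r - t)⁻¹).aestronglyMeasurable
    · filter_upwards [hmem] with r hr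
      filter_upwards [hF', hb] with y hy hyb
      have hpos : 0 < ‖r - t‖ := norm_pos_iff.2 (sub_ne_zero.2 hr.2)
      rw [slope_def_module, norm_smul, norm_inv, inv_mul_le_iff₀ hpos, mul_comm]
      exact hs.norm_image_sub_le_of_norm_hasDerivWithin_le hy hyb ht hr.1
    · filter_upwards [hF'] with y hy
      exact hasDerivWithinAt_iff_tendsto_slope.1 (hy t ht)
  refine hslope.congr' ?_
  filter_upwards [hmem] with r hr
  simp only [slope_def_module]
  rw [integral_smul, integral_sub (hF r hr.1) (hF t ht)]

theorem hasDerivWithinAt_integral_of_isCompact [TopologicalSpace Y] {μ : Measure Y}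
    [IsFiniteMeasure μ] {G : Type*} [NormedAddCommGroup G] [NormedSpace ℝ G] {F F' : ℝ → Y → G}
    {k : Set Y} (hk : IsCompact k) {s : Set ℝ} (hs : Convex ℝ s) (hsc : IsCompact s) {t : ℝ}
    (ht : t ∈ s) (hF : ∀ r ∈ s, Integrable (F r) μ)
    (hF' : ∀ y, ∀ r ∈ s, HasDerivWithinAt (fun r => F r y) (F' r y) s r)
    (hcont : ContinuousOn (fun z : Y × ℝ => F' z.2 z.1) (k ×ˢ s))
    (hzero : ∀ y ∉ k, ∀ r ∈ s, F' r y = 0) :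
    HasDerivWithinAt (fun r => ∫ y, F r y ∂μ) (∫ y, F' t y ∂μ) s t := by
  obtain ⟨C, hC⟩ := (hk.prod hsc).exists_bound_of_continuousOn hcont
  have hbound : ∀ y, ∀ r ∈ s, ‖F' r y‖ ≤ max C 0 := by
    intro y r hr
    by_cases hy : y ∈ k
    · exact (hC (y, r) ⟨hy, hr⟩).trans (le_max_left _ _)
    · simp [hzero y hy r hr]
  exact hasDerivWithinAt_integral_of_dominated hs ht hF (.of_forall hF') (.of_forall hbound)
    (integrable_const _)

variable [NormedAddCommGroup Y] [NormedSpace ℝ Y] [BorelSpace Y] [SecondCountableTopology Y]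
  [NormedAddCommGroup V] [NormedSpace ℝ V]

theorem hasFDerivAt_integral_of_contDiff {μ : Measure Y} {F : Type*}
    [NormedAddCommGroup F] [NormedSpace ℝ F] {h : Y → V → F} {B₀ B₁ : Y → ℝ}
    (hh : ContDiff ℝ 1 (Function.uncurry h)) (hB₀ : Integrable B₀ μ) (hB₁ : Integrable B₁ μ)
    (hb₀ : ∀ y z, ‖h y z‖ ≤ B₀ y) (hb₁ : ∀ y z, ‖fderiv ℝ (h y) z‖ ≤ B₁ y) (z : V) :
    HasFDerivAt (fun z => ∫ y, h y z ∂μ) (∫ y, fderiv ℝ (h y) z ∂μ) z := by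
  have hcont : ∀ z, Continuous fun y => h y z := fun z =>
    hh.continuous.comp (Continuous.prodMk_left z)
  have hdiff : ∀ y, Differentiable ℝ (h y) := fun y =>
    (hh.comp (contDiff_prodMk_right y)).differentiable one_ne_zero
  have hcont' : ContDiff ℝ 0 fun y => fderiv ℝ (h y) z :=
    ContDiff.fderiv (m := 1) hh contDiff_const (by simp)
  refine hasFDerivAt_integral_of_dominated_of_fderiv_le (F' := fun z y => fderiv ℝ (h y) z)
    (bound := B₁) univ_mem ?_ ?_ hcont'.continuous.aestronglyMeasurable ?_ hB₁ ?_
  · exact .of_forall fun z => (hcont z).aestronglyMeasurable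
  · exact hB₀.mono' (hcont z).aestronglyMeasurable (.of_forall fun y => hb₀ y z)
  · exact .of_forall fun y z _ => hb₁ y z
  · exact .of_forall fun y z _ => (hdiff y z).hasFDerivAt

theorem contDiff_integral_of_dominated.{u} {Y : Type*} {V : Type u}
    [NormedAddCommGroup Y] [NormedSpace ℝ Y] [MeasurableSpace Y] [BorelSpace Y]
    [SecondCountableTopology Y] [NormedAddCommGroup V] [NormedSpace ℝ V]
    {μ : Measure Y} (k : ℕ) {F : Type u} [NormedAddCommGroup F] [NormedSpace ℝ F]
    {h : Y → V → F} {B : ℕ → Y → ℝ}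
    (hh : ContDiff ℝ k (Function.uncurry h)) (hB : ∀ i ≤ k, Integrable (B i) μ)
    (hb : ∀ i ≤ k, ∀ y z, ‖iteratedFDeriv ℝ i (h y) z‖ ≤ B i y) :
    ContDiff ℝ k fun z => ∫ y, h y z ∂μ := by
  induction k generalizing F B with
  | zero =>
    rw [Nat.cast_zero, contDiff_zero] at *
    refine MeasureTheory.continuous_of_dominated (bound := B 0) ?_ ?_ (hB 0 le_rfl) ?_
    · exact fun z => (hh.comp (Continuous.prodMk_left z)).aestronglyMeasurable
    · exact fun z => .of_forall fun y => by simpa using hb 0 le_rfl y z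
    · exact .of_forall fun y => hh.comp (Continuous.prodMk_right y)
  | succ k ih =>
    push_cast at hh ⊢
    rw [contDiff_succ_iff_hasFDerivAt]
    refine ⟨fun z => ∫ y, fderiv ℝ (h y) z ∂μ, ?_, fun z => ?_⟩
    · refine ih (B := fun i => B (i + 1)) ?_ (fun i hi => hB _ (by omega)) fun i hi y z => ?_
      · refine ContDiff.fderiv (f := fun p : Y × V => h p.1) (g := fun p : Y × V => p.2)
          (m := k + 1) ?_ contDiff_snd le_rfl
        exact hh.comp ((contDiff_fst.comp contDiff_fst).prodMk contDiff_snd)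
      · rw [norm_iteratedFDeriv_fderiv]
        exact hb _ (by omega) y z
    · refine hasFDerivAt_integral_of_contDiff (hh.of_le (by simp)) (hB 0 (by omega))
        (hB 1 (by omega)) (fun y z => by simpa using hb 0 (by omega) y z) (fun y z => ?_) z
      have hb₁ := hb 1 (by omega) y z
      rwa [← zero_add 1, ← norm_iteratedFDeriv_fderiv, norm_iteratedFDeriv_zero] at hb₁

end DerivUnderIntegral

section TraceDet

variable {V : Type*} [NormedAddCommGroup V] [NormedSpace ℝ V]

theorem det_ne_zero_of_mul_eq_one {A K : V →L[ℝ] V} (hK : A * K = 1) : A.det ≠ 0 := by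
  refine left_ne_zero_of_mul_eq_one (b := K.det) ?_
  calc A.det * K.det = (A * K).det := (map_mul LinearMap.det (A : V →ₗ[ℝ] V) K).symm
    _ = 1 := by rw [hK]; exact map_one LinearMap.det

theorem det_ne_zero_of_isUnit {A : V →L[ℝ] V} (hA : IsUnit A) : A.det ≠ 0 :=
  let ⟨_, hK⟩ := hA.exists_right_inv
  det_ne_zero_of_mul_eq_one hK

variable [FiniteDimensional ℝ V]

theorem clm_mul_eq_one_symm {A K : V →L[ℝ] V} (hK : A * K = 1) : K * A = 1 := by
  have hlin : (A : V →ₗ[ℝ] V) * (K : V →ₗ[ℝ] V) = 1 :=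
    LinearMap.ext fun x => DFunLike.congr_fun hK x
  ext x
  exact LinearMap.congr_fun (mul_eq_one_comm.1 hlin) x

/-- The trace of endomorphisms, as a continuous linear functional. -/
def traceCLM (V : Type*) [NormedAddCommGroup V] [NormedSpace ℝ V] [FiniteDimensional ℝ V] :
    (V →L[ℝ] V) →L[ℝ] ℝ :=
  LinearMap.toContinuousLinearMap ((LinearMap.trace ℝ V).comp (ContinuousLinearMap.coeLM ℝ))

theorem traceCLM_mul_comm (A B : V →L[ℝ] V) : traceCLM V (A * B) = traceCLM V (B * A) :=
  LinearMap.trace_mul_comm ℝ (A : V →ₗ[ℝ] V) (B : V →ₗ[ℝ] V)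

theorem traceCLM_smulRight (l : V →L[ℝ] ℝ) (w : V) : traceCLM V (l.smulRight w) = l w :=
  LinearMap.trace_smulRight (R := ℝ) (M := V) (l : V →ₗ[ℝ] ℝ) w

theorem differentiable_det : Differentiable ℝ fun A : V →L[ℝ] V => A.det := by
  classical
  let b := Module.finBasis ℝ V
  have hleibniz : (fun A : V →L[ℝ] V => A.det) = fun A =>
      ∑ σ : Equiv.Perm (Fin (Module.finrank ℝ V)), Equiv.Perm.sign σ •
        ∏ i, b.repr (A (b i)) (σ i) := by
    ext A
    rw [ContinuousLinearMap.det, ← LinearMap.det_toMatrix b, Matrix.det_apply]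
    simp [LinearMap.toMatrix_apply]
  have hentry : ∀ i j, Differentiable ℝ fun A : V →L[ℝ] V => b.repr (A (b i)) j := fun i j =>
    ((LinearMap.toContinuousLinearMap (b.coord j)).comp
      (ContinuousLinearMap.apply ℝ V (b i))).differentiable
  rw [hleibniz]
  refine Differentiable.fun_sum fun σ _ => Differentiable.const_smul ?_ _
  exact fun A => (HasFDerivAt.finsetProd (u := Finset.univ)
    fun i _ => (hentry i (σ i) A).hasFDerivAt).differentiableAt

theorem hasDerivAt_det_one_add_smul (C : V →L[ℝ] V) :
    HasDerivAt (fun ε : ℝ => (1 + ε • C).det) (traceCLM V C) 0 := by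
  classical
  let b := Module.finBasis ℝ V
  let M := LinearMap.toMatrix b b (C : V →ₗ[ℝ] V)
  let q := (1 + (Polynomial.X : Polynomial ℝ) • M.map Polynomial.C).det
  have hdet : (fun ε : ℝ => (1 + ε • C).det) = fun ε => q.eval ε := by
    ext ε
    have hmatrix : (Polynomial.evalRingHom ε).mapMatrix
        (1 + (Polynomial.X : Polynomial ℝ) • M.map Polynomial.C) = 1 + ε • M := by
      ext i j
      simp [Matrix.one_apply, apply_ite, mul_comm ε (M i j)]
    rw [← Polynomial.coe_evalRingHom, RingHom.map_det, hmatrix, ContinuousLinearMap.det,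
      ← LinearMap.det_toMatrix b]
    simp [M, map_add]
  have htrace : q.derivative.eval 0 = traceCLM V C := by
    rw [Matrix.derivative_det_one_add_X_smul]
    exact (LinearMap.trace_eq_matrix_trace ℝ b _).symm
  rw [hdet, ← htrace]
  exact q.hasDerivAt 0

theorem fderiv_det_apply {A K : V →L[ℝ] V} (hK : A * K = 1) (B : V →L[ℝ] V) :
    fderiv ℝ (fun A : V →L[ℝ] V => A.det) A B = A.det * traceCLM V (B * K) := by
  have hK' : K * A = 1 := clm_mul_eq_one_symm hK
  have hline : HasDerivAt (fun ε : ℝ => (A + ε • B).det)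
      (fderiv ℝ (fun A : V →L[ℝ] V => A.det) A B) 0 := by
    have hsegment : HasDerivAt (fun ε : ℝ => A + ε • B) B 0 := by
      simpa using ((hasDerivAt_id (0 : ℝ)).smul_const B).const_add A
    exact (differentiable_det A).hasFDerivAt.comp_hasDerivAt_of_eq (0 : ℝ) hsegment (by simp)
  have hfactor : (fun ε : ℝ => (A + ε • B).det) = fun ε => (1 + ε • (B * K)).det * A.det := by
    ext ε
    have hmul : A + ε • B = (1 + ε • (B * K)) * A := by
      rw [add_mul, one_mul, smul_mul_assoc, mul_assoc, hK', mul_one]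
    rw [hmul]
    exact map_mul LinearMap.det _ _
  rw [hfactor] at hline
  rw [hline.unique ((hasDerivAt_det_one_add_smul (B * K)).mul_const A.det), mul_comm]

theorem hasDerivWithinAt_log_det {J : ℝ → V →L[ℝ] V} {J' K : V →L[ℝ] V} {s : Set ℝ} {t : ℝ}
    (hJ : HasDerivWithinAt J J' s t) (hK : J t * K = 1) :
    HasDerivWithinAt (fun s => Real.log (J s).det) (traceCLM V (J' * K)) s t := by
  have hdet : HasDerivWithinAt (fun s => (J s).det) ((J t).det * traceCLM V (J' * K)) s t := by
    rw [← fderiv_det_apply hK]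
    exact (differentiable_det (J t)).hasFDerivAt.comp_hasDerivWithinAt t hJ
  have hne := det_ne_zero_of_mul_eq_one hK
  simpa only [mul_div_cancel_left₀ _ hne] using hdet.log hne

end TraceDet

/-! ### Weak derivatives and divergences -/

section WeakDerivative

variable {V : Type*} [NormedAddCommGroup V] [NormedSpace ℝ V] [FiniteDimensional ℝ V]
  [MeasurableSpace V] [BorelSpace V] (μ : Measure V) [μ.IsAddHaarMeasure]

theorem eq_zero_of_integral_mul_eq_zero {r : V → ℝ} (hr : Continuous r)
    (h : ∀ ζ : V → ℝ, ContDiff ℝ (⊤ : ℕ∞) ζ → HasCompactSupport ζ → ∫ x, ζ x * r x ∂μ = 0) :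
    r = 0 :=
  (hr.ae_eq_iff_eq μ continuous_zero).1
    (ae_eq_zero_of_integral_contDiff_smul_eq_zero (hr.locallyIntegrable (μ := μ)) h)

theorem convolution_eq_of_integral_mul_fderiv_eq_zero {r : V → ℝ} (hr : Continuous r)
    (h : ∀ ζ : V → ℝ, ContDiff ℝ (⊤ : ℕ∞) ζ → HasCompactSupport ζ → ∀ e : V,
      ∫ x, r x * fderiv ℝ ζ x e ∂μ = 0)
    {ζ : V → ℝ} (hζ : ContDiff ℝ (⊤ : ℕ∞) ζ) (hζc : HasCompactSupport ζ) (x y : V) :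
    convolution ζ r (ContinuousLinearMap.lsmul ℝ ℝ) μ x =
      convolution ζ r (ContinuousLinearMap.lsmul ℝ ℝ) μ y := by
  have hderiv := hζc.hasFDerivAt_convolution_left (ContinuousLinearMap.lsmul ℝ ℝ)
    (hζ.of_le (by simp)) (hr.locallyIntegrable (μ := μ))
  refine is_const_of_fderiv_eq_zero (𝕜 := ℝ) (fun x => (hderiv x).differentiableAt)
    (fun x => ?_) x y
  rw [(hderiv x).fderiv]
  ext e
  have hexists := (hζc.fderiv ℝ).convolutionExists_left
    ((ContinuousLinearMap.lsmul ℝ ℝ).precompL V) (hζ.continuous_fderiv (by simp))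
    (hr.locallyIntegrable (μ := μ)) x
  rw [convolution, ContinuousLinearMap.integral_apply hexists, ← integral_sub_left_eq_self _ μ x]
  have hreflect : ∀ s, fderiv ℝ (fun s => ζ (x - s)) s e = -fderiv ℝ ζ (x - s) e := by
    intro s
    have hsub : HasFDerivAt (fun s : V => x - s) (-ContinuousLinearMap.id ℝ V) s := by
      simpa using (hasFDerivAt_id s).const_sub x
    have hcomp : HasFDerivAt (fun s => ζ (x - s)) _ s :=
      ((hζ.differentiable (by simp)) (x - s)).hasFDerivAt.comp s hsub
    simp [hcomp.fderiv]
  have hzero := h (fun s => ζ (x - s)) (hζ.comp (contDiff_const.sub contDiff_id))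
    (hζc.comp_homeomorph (Homeomorph.subLeft x)) e
  simpa [hreflect, integral_neg, ContinuousLinearMap.precompL_apply, mul_comm] using hzero

theorem eq_of_integral_mul_fderiv_eq_zero {r : V → ℝ} (hr : Continuous r)
    (h : ∀ ζ : V → ℝ, ContDiff ℝ (⊤ : ℕ∞) ζ → HasCompactSupport ζ → ∀ e : V,
      ∫ x, r x * fderiv ℝ ζ x e ∂μ = 0) (x y : V) : r x = r y := by
  have hcont : ∀ z, Continuous fun s => r (z - s) := fun z => by fun_prop
  have hint : ∀ (ζ : V → ℝ), ContDiff ℝ (⊤ : ℕ∞) ζ → HasCompactSupport ζ → ∀ z,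
      Integrable (fun s => ζ s * r (z - s)) μ := fun ζ hζ hζc z =>
    (hζ.continuous.mul (hcont z)).integrable_of_hasCompactSupport hζc.mul_right
  have hdiff := eq_zero_of_integral_mul_eq_zero μ ((hcont x).sub (hcont y)) fun ζ hζ hζc => by
    simp only [Pi.sub_apply, mul_sub]
    rw [integral_sub (hint ζ hζ hζc x) (hint ζ hζ hζc y), sub_eq_zero]
    exact convolution_eq_of_integral_mul_fderiv_eq_zero μ hr h hζ hζc x y
  simpa [sub_eq_zero] using congrFun hdiff 0

end WeakDerivative

section Divergence

variable {n : ℕ}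

theorem divergence_eq_sum {F : E n → E n} {x : E n} (hF : DifferentiableAt ℝ F x) :
    divergence F x = ∑ i, fderiv ℝ (fun y => F y i) x (EuclideanSpace.single i 1) := by
  rw [divergence, LinearMap.trace_eq_sum_inner _ (EuclideanSpace.basisFun (Fin n) ℝ)]
  refine Finset.sum_congr rfl fun i _ => ?_
  have hcoord : HasFDerivAt (fun y => F y i)
      ((EuclideanSpace.proj i : E n →L[ℝ] ℝ).comp (fderiv ℝ F x)) x :=
    (EuclideanSpace.proj i : E n →L[ℝ] ℝ).hasFDerivAt.comp x hF.hasFDerivAt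
  rw [hcoord.fderiv]
  simp [EuclideanSpace.inner_single_left]

theorem contDiff_divergence {m k : WithTop ℕ∞} {F : E n → E n} (hF : ContDiff ℝ k F)
    (hmk : m + 1 ≤ k) : ContDiff ℝ m (divergence F) :=
  (traceCLM (E n)).contDiff.comp (hF.fderiv_right hmk)

theorem continuous_divergence {F : E n → E n} (hF : ContDiff ℝ 1 F) :
    Continuous (divergence F) :=
  (contDiff_divergence (m := 0) hF (by simp)).continuous

theorem hasCompactSupport_divergence {F : E n → E n} (hF : HasCompactSupport F) :
    HasCompactSupport (divergence F) :=
  (hF.fderiv ℝ).comp_left (g := traceCLM (E n)) (map_zero _)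

theorem integral_divergence_eq_zero {F : E n → E n} (hF : ContDiff ℝ 1 F)
    (hFc : HasCompactSupport F) : ∫ x, divergence F x = 0 := by
  have hcoord : ∀ i, ContDiff ℝ 1 fun y => F y i := fun i =>
    (EuclideanSpace.proj i : E n →L[ℝ] ℝ).contDiff.comp hF
  have hsupp : ∀ i, HasCompactSupport fun y => F y i := fun i =>
    hFc.comp_left (g := fun z : E n => z i) rfl
  have hint : ∀ i, Integrable
      (fun x => fderiv ℝ (fun y => F y i) x (EuclideanSpace.single i 1)) (volume : Measure (E n)) :=
    fun i => (((hcoord i).continuous_fderiv one_ne_zero).clm_apply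
      continuous_const).integrable_of_hasCompactSupport ((hsupp i).fderiv_apply ℝ _)
  simp_rw [divergence_eq_sum (hF.differentiable one_ne_zero _)]
  rw [integral_finsetSum _ fun i _ => hint i]
  refine Finset.sum_eq_zero fun i _ => ?_
  have hparts := integral_mul_fderiv_eq_neg_fderiv_mul_of_integrable
    (μ := (volume : Measure (E n)))
    (f := fun _ : E n => (1 : ℝ)) (g := fun y => F y i) (v := EuclideanSpace.single i 1)
    (by simp) (by simpa using hint i)
    (by simpa using (hcoord i).continuous.integrable_of_hasCompactSupport (hsupp i))
    (fun x _ => differentiableAt_const _)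
    (fun x _ => (hcoord i).differentiable one_ne_zero x)
  simpa using hparts

theorem divergence_smul {f : E n → ℝ} {ξ : E n → E n} {x : E n}
    (hf : DifferentiableAt ℝ f x) (hξ : DifferentiableAt ℝ ξ x) :
    divergence (fun y => f y • ξ y) x = f x * divergence ξ x + fderiv ℝ f x (ξ x) := by
  change traceCLM (E n) _ = _
  rw [fderiv_fun_smul hf hξ, map_add, map_smul, traceCLM_smulRight]
  rfl

theorem integral_mul_divergence_add_eq_zero {f : E n → ℝ} {ξ : E n → E n}
    (hf : ContDiff ℝ 1 f) (hξ : ContDiff ℝ 1 ξ) (hc : HasCompactSupport fun x => f x • ξ x) :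
    ∫ x, (f x * divergence ξ x + fderiv ℝ f x (ξ x)) = 0 := by
  rw [← integral_divergence_eq_zero (hf.smul hξ) hc]
  exact integral_congr_ae (.of_forall fun x => (divergence_smul
    (hf.differentiable one_ne_zero x) (hξ.differentiable one_ne_zero x)).symm)

theorem divergence_fderiv_apply_sub_divergence_smul {w ξ : E n → E n} (hw : ContDiff ℝ 1 w)
    (hξ : ContDiff ℝ 2 ξ) (x : E n) :
    divergence (fun x => fderiv ℝ ξ x (w x) - divergence ξ x • w x) x =
      traceCLM (E n) (fderiv ℝ w x * fderiv ℝ ξ x) - divergence w x * divergence ξ x := by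
  have hwx := hw.differentiable one_ne_zero x
  have hDξx := (hξ.fderiv_right (m := 1) le_rfl).differentiable one_ne_zero x
  have hdivx : HasFDerivAt (divergence ξ)
      ((traceCLM (E n)).comp (fderiv ℝ (fderiv ℝ ξ) x)) x :=
    (traceCLM (E n)).hasFDerivAt.comp x hDξx.hasFDerivAt
  have hsymm : (fderiv ℝ (fderiv ℝ ξ) x).flip (w x) = fderiv ℝ (fderiv ℝ ξ) x (w x) := by
    ext1 v
    exact (hξ.contDiffAt.isSymmSndFDerivAt (by simp)).eq v (w x)
  have hfirst : divergence (fun x => fderiv ℝ ξ x (w x)) x =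
      traceCLM (E n) (fderiv ℝ w x * fderiv ℝ ξ x) +
        traceCLM (E n) (fderiv ℝ (fderiv ℝ ξ) x (w x)) := by
    change traceCLM (E n) _ = _
    rw [fderiv_clm_apply hDξx hwx, map_add, hsymm, traceCLM_mul_comm]
    rfl
  have hsub : divergence (fun x => fderiv ℝ ξ x (w x) - divergence ξ x • w x) x =
      divergence (fun x => fderiv ℝ ξ x (w x)) x -
        divergence (fun x => divergence ξ x • w x) x := by
    change traceCLM (E n) _ = traceCLM (E n) _ - traceCLM (E n) _
    rw [fderiv_fun_sub (hDξx.clm_apply hwx) (hdivx.differentiableAt.fun_smul hwx),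
      map_sub]
  rw [hsub, hfirst, divergence_smul hdivx.differentiableAt hwx, hdivx.fderiv]
  simp only [ContinuousLinearMap.comp_apply]
  ring

theorem integral_trace_fderiv_mul_fderiv {w ξ : E n → E n} (hw : ContDiff ℝ 1 w)
    (hξ : ContDiff ℝ 2 ξ) (hξc : HasCompactSupport ξ) :
    ∫ x, traceCLM (E n) (fderiv ℝ w x * fderiv ℝ ξ x) =
      ∫ x, divergence w x * divergence ξ x := by
  have hdiv : ContDiff ℝ 1 (divergence ξ) := contDiff_divergence hξ le_rfl
  have hdivc := hasCompactSupport_divergence hξc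
  have hfieldc : HasCompactSupport fun x => fderiv ℝ ξ x (w x) - divergence ξ x • w x :=
    HasCompactSupport.sub (f := fun x => fderiv ℝ ξ x (w x))
      ((hξc.fderiv ℝ).mono fun x hx h => hx (by simp [h])) hdivc.smul_right
  have hzero : ∫ x, divergence (fun x => fderiv ℝ ξ x (w x) - divergence ξ x • w x) x = 0 :=
    integral_divergence_eq_zero (((hξ.fderiv_right le_rfl).clm_apply hw).sub (hdiv.smul hw))
      hfieldc
  simp_rw [divergence_fderiv_apply_sub_divergence_smul hw hξ] at hzero
  rw [integral_sub, sub_eq_zero] at hzero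
  · exact hzero
  · exact ((traceCLM (E n)).continuous.comp ((hw.continuous_fderiv one_ne_zero).mul
      (hξ.continuous_fderiv two_ne_zero))).integrable_of_hasCompactSupport
        ((hξc.fderiv ℝ).mul_left.comp_left (map_zero (traceCLM (E n))))
  · exact ((continuous_divergence hw).mul hdiv.continuous).integrable_of_hasCompactSupport
      hdivc.mul_left

theorem integrable_fderiv_apply {f : E n → ℝ} {ξ : E n → E n} (hf : ContDiff ℝ 1 f)
    (hξ : Continuous ξ) (hξc : HasCompactSupport ξ) : Integrable fun x => fderiv ℝ f x (ξ x) :=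
  ((hf.continuous_fderiv one_ne_zero).clm_apply hξ).integrable_of_hasCompactSupport
    (HasCompactSupport.intro hξc fun x hx => by
      rw [image_eq_zero_of_notMem_tsupport hx, map_zero])

theorem integral_fderiv_apply_eq_neg {f : E n → ℝ} {ξ : E n → E n} (hf : ContDiff ℝ 1 f)
    (hξ : ContDiff ℝ 1 ξ) (hξc : HasCompactSupport ξ) :
    ∫ x, fderiv ℝ f x (ξ x) = -∫ x, f x * divergence ξ x := by
  have hfdiv : Integrable fun x => f x * divergence ξ x :=
    (hf.continuous.mul (continuous_divergence hξ)).integrable_of_hasCompactSupport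
      (hasCompactSupport_divergence hξc).mul_left
  rw [eq_neg_iff_add_eq_zero, add_comm,
    ← integral_add hfdiv (integrable_fderiv_apply hf hξ.continuous hξc)]
  exact integral_mul_divergence_add_eq_zero hf hξ (HasCompactSupport.smul_left (f := f) hξc)

theorem integral_fderiv_apply_sub_trace {f : E n → ℝ} {w ξ : E n → E n} (hf : ContDiff ℝ 1 f)
    (hw : ContDiff ℝ 1 w) (hξ : ContDiff ℝ 2 ξ) (hξc : HasCompactSupport ξ) :
    ∫ x, (fderiv ℝ f x (ξ x) - traceCLM (E n) (fderiv ℝ w x * fderiv ℝ ξ x)) =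
      -∫ x, (f x + divergence w x) * divergence ξ x := by
  have hξ1 : ContDiff ℝ 1 ξ := hξ.of_le one_le_two
  have hdivξ := continuous_divergence hξ1
  have hdivc := hasCompactSupport_divergence hξc
  have htrace : Integrable fun x => traceCLM (E n) (fderiv ℝ w x * fderiv ℝ ξ x) :=
    ((traceCLM (E n)).continuous.comp ((hw.continuous_fderiv one_ne_zero).mul
      (hξ1.continuous_fderiv one_ne_zero))).integrable_of_hasCompactSupport
      ((hξc.fderiv ℝ).mul_left.comp_left (map_zero (traceCLM (E n))))
  have hfdiv : Integrable fun x => f x * divergence ξ x :=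
    (hf.continuous.mul hdivξ).integrable_of_hasCompactSupport hdivc.mul_left
  have hdivdiv : Integrable fun x => divergence w x * divergence ξ x :=
    ((continuous_divergence hw).mul hdivξ).integrable_of_hasCompactSupport hdivc.mul_left
  simp_rw [add_mul]
  rw [integral_sub (integrable_fderiv_apply hf hξ.continuous hξc) htrace,
    integral_fderiv_apply_eq_neg hf hξ1 hξc, integral_trace_fderiv_mul_fderiv hw hξ hξc,
    integral_add hfdiv hdivdiv, neg_add]
  rfl

theorem integral_mul_divergence_eq_neg {ψ : E n → ℝ} {ξ : E n → E n} (hψ : ContDiff ℝ 1 ψ)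
    (hc : HasCompactSupport ψ) (hξ : ContDiff ℝ 1 ξ) :
    ∫ x, ψ x * divergence ξ x = -∫ x, fderiv ℝ ψ x (ξ x) := by
  have hdiv : Integrable fun x => ψ x * divergence ξ x :=
    (hψ.continuous.mul (continuous_divergence hξ)).integrable_of_hasCompactSupport hc.mul_right
  have hfderiv : Integrable fun x => fderiv ℝ ψ x (ξ x) :=
    ((hψ.continuous_fderiv one_ne_zero).clm_apply hξ.continuous).integrable_of_hasCompactSupport
      ((hc.fderiv ℝ).mono fun x hx hzero => hx (by simp [hzero]))
  rw [eq_neg_iff_add_eq_zero, ← integral_add hdiv hfderiv]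
  exact integral_mul_divergence_add_eq_zero hψ hξ hc.smul_right

theorem norm_integral_mul_divergence_le {χ : E n → ℝ} {ξ : E n → E n} (hχ : ContDiff ℝ 1 χ)
    (hc : HasCompactSupport χ) {C : ℝ} (hC : ∀ x, ‖fderiv ℝ χ x‖ ≤ C) (hξ : ContDiff ℝ 1 ξ)
    (hξi : Integrable ξ) : ‖∫ x, χ x * divergence ξ x‖ ≤ C * ∫ x, ‖ξ x‖ := by
  rw [integral_mul_divergence_eq_neg hχ hc hξ, norm_neg, ← integral_const_mul]
  exact norm_integral_le_of_norm_le (hξi.norm.const_mul C)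
    (.of_forall fun x => (fderiv ℝ χ x).le_of_opNorm_le (hC x) _)

theorem tendsto_integral_comp_smul_mul {V : Type*} [NormedAddCommGroup V] [NormedSpace ℝ V]
    [MeasurableSpace V] [BorelSpace V] [SecondCountableTopology V] {μ : Measure V} {χ f : V → ℝ}
    (hχ : Continuous χ) {C : ℝ} (hC : ∀ x, ‖χ x‖ ≤ C) (hf : Integrable f μ) :
    Tendsto (fun r : ℝ => ∫ x, χ (r • x) * f x ∂μ) (𝓝 0) (𝓝 (χ 0 * ∫ x, f x ∂μ)) := by
  rw [← integral_const_mul]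
  refine tendsto_integral_filter_of_dominated_convergence (fun x => C * ‖f x‖)
    (.of_forall fun r => ?_) (.of_forall fun r => .of_forall fun x => ?_) (hf.norm.const_mul C)
    (.of_forall fun x => ?_)
  · exact (hχ.comp (continuous_const_smul r)).aestronglyMeasurable.mul hf.aestronglyMeasurable
  · rw [norm_mul]
    exact mul_le_mul_of_nonneg_right (hC _) (norm_nonneg _)
  · exact ((hχ.comp (continuous_id.smul continuous_const)).tendsto' 0 (χ 0) (by simp)).mul_const _

/- Testing against the dilated cutoffs `b (r • x)`, whose derivatives are of size `r`, leaves no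
flux at infinity as `r` tends to zero. -/
theorem integral_divergence_eq_zero_of_integrable {ξ : E n → E n} (hξ : ContDiff ℝ 1 ξ)
    (hξi : Integrable ξ) (hdiv : Integrable (divergence ξ)) : ∫ x, divergence ξ x = 0 := by
  let b : ContDiffBump (0 : E n) := ⟨1, 2, one_pos, one_lt_two⟩
  have hb : ContDiff ℝ 1 (b : E n → ℝ) := b.contDiff
  have hb0 : b (0 : E n) = 1 := b.one_of_mem_closedBall (by simp [b])
  obtain ⟨C, hC⟩ := (hb.continuous_fderiv one_ne_zero).bounded_above_of_compact_support
    (b.hasCompactSupport.fderiv ℝ)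
  have hdilate : ∀ r : ℝ, 0 < r → ∀ x : E n, ‖fderiv ℝ (fun x => b (r • x)) x‖ ≤ r * C := by
    intro r hr x
    rw [fderiv_comp_smul, norm_smul, Real.norm_of_nonneg hr.le]
    exact mul_le_mul_of_nonneg_left (hC _) hr.le
  have hflux : ∀ᶠ r in 𝓝[>] (0 : ℝ),
      ‖∫ x, b (r • x) * divergence ξ x‖ ≤ r * C * ∫ x, ‖ξ x‖ := by
    filter_upwards [self_mem_nhdsWithin] with r hr
    exact norm_integral_mul_divergence_le (hb.comp (contDiff_id.const_smul r))
      (b.hasCompactSupport.comp_smul (ne_of_gt hr)) (hdilate r hr) hξ hξi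
  have hvanish : Tendsto (fun r : ℝ => r * C * ∫ x, ‖ξ x‖) (𝓝[>] 0) (𝓝 0) :=
    (((continuous_id.mul continuous_const).mul continuous_const).tendsto' 0 0
      (by simp)).mono_left nhdsWithin_le_nhds
  have hlim := tendsto_integral_comp_smul_mul b.continuous
    (fun x => (Real.norm_of_nonneg b.nonneg).trans_le b.le_one) hdiv
  rw [hb0, one_mul] at hlim
  exact tendsto_nhds_unique (hlim.mono_left nhdsWithin_le_nhds)
    (squeeze_zero_norm' hflux hvanish)

end Divergence

/-! ### Linear differential equations and flows of `C¹` vector fields -/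

section LinearODE

variable {F : Type*} [NormedAddCommGroup F] [NormedSpace ℝ F]

/-- The radial retraction onto the closed ball of radius `R`, used to truncate linear vector
fields so that Picard-Lindelöf applies on the whole time interval. -/
def radialRetraction (R : ℝ) (x : F) : F := (R / max R ‖x‖) • x

theorem radialRetraction_of_norm_le {R : ℝ} (hR : 0 < R) {x : F} (hx : ‖x‖ ≤ R) :
    radialRetraction R x = x := by
  rw [radialRetraction, max_eq_left hx, div_self hR.ne', one_smul]

theorem norm_radialRetraction_le {R : ℝ} (hR : 0 < R) (x : F) : ‖radialRetraction R x‖ ≤ R := by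
  have hmax : 0 < max R ‖x‖ := lt_max_of_lt_left hR
  rw [radialRetraction, norm_smul, Real.norm_of_nonneg (by positivity), div_mul_eq_mul_div,
    div_le_iff₀ hmax]
  gcongr
  exact le_max_right _ _

theorem norm_radialRetraction_le_norm {R : ℝ} (hR : 0 < R) (x : F) :
    ‖radialRetraction R x‖ ≤ ‖x‖ := by
  have hmax : 0 < max R ‖x‖ := lt_max_of_lt_left hR
  rw [radialRetraction, norm_smul, Real.norm_of_nonneg (by positivity)]
  exact mul_le_of_le_one_left (norm_nonneg _) ((div_le_one hmax).2 (le_max_left _ _))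

theorem norm_radialRetraction_sub_le {R : ℝ} (hR : 0 < R) (x y : F) :
    ‖radialRetraction R x - radialRetraction R y‖ ≤ 2 * ‖x - y‖ := by
  set a := max R ‖x‖ with ha
  set b := max R ‖y‖ with hb
  have ha0 : 0 < a := lt_max_of_lt_left hR
  have hb0 : 0 < b := lt_max_of_lt_left hR
  have hRa : R / a ≤ 1 := (div_le_one ha0).2 (le_max_left _ _)
  have hyb : ‖y‖ / b ≤ 1 := (div_le_one hb0).2 (le_max_right _ _)
  have hab : |b - a| ≤ ‖x - y‖ := by
    refine (abs_max_sub_max_le_max R ‖y‖ R ‖x‖).trans ?_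
    rw [sub_self, abs_zero, max_eq_right (abs_nonneg _), norm_sub_rev]
    exact abs_norm_sub_norm_le y x
  have hsplit : radialRetraction R x - radialRetraction R y =
      (R / a) • (x - y) + (R / a * ((b - a) / b)) • y := by
    have hscalar : R / a * ((b - a) / b) = R / a - R / b := by field_simp
    simp only [radialRetraction, ← ha, ← hb, hscalar]
    module
  have hdirection : ‖(R / a) • (x - y)‖ ≤ ‖x - y‖ := by
    rw [norm_smul, Real.norm_of_nonneg (by positivity)]
    exact mul_le_of_le_one_left (norm_nonneg _) hRa
  have hradius : ‖(R / a * ((b - a) / b)) • y‖ ≤ ‖x - y‖ := by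
    rw [norm_smul, norm_mul, norm_div (b - a), Real.norm_of_nonneg hb0.le,
      Real.norm_of_nonneg (r := R / a) (by positivity), Real.norm_eq_abs]
    calc R / a * (|b - a| / b) * ‖y‖ = (R / a) * |b - a| * (‖y‖ / b) := by ring
      _ ≤ 1 * ‖x - y‖ * 1 := by gcongr
      _ = ‖x - y‖ := by ring
  rw [hsplit]
  refine (norm_add_le _ _).trans ?_
  linarith

theorem hasDerivWithinAt_Ici_of_Icc {f : ℝ → F} {f' : F} {a b t : ℝ} (ht : t ∈ Ico a b)
    (h : HasDerivWithinAt f f' (Icc a b) t) : HasDerivWithinAt f f' (Ici t) t :=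
  h.mono_of_mem_nhdsWithin (Icc_mem_nhdsGE_of_mem ht)

theorem norm_le_mul_exp_of_norm_deriv_le {y y' : ℝ → F} {M : ℝ}
    (hy : ∀ t ∈ Icc (0 : ℝ) 1, HasDerivWithinAt y (y' t) (Icc 0 1) t)
    (hy' : ∀ t ∈ Icc (0 : ℝ) 1, ‖y' t‖ ≤ M * ‖y t‖) {t : ℝ} (ht : t ∈ Icc (0 : ℝ) 1) :
    ‖y t‖ ≤ ‖y 0‖ * Real.exp (M * t) := by
  have hgronwall := norm_le_gronwallBound_of_norm_deriv_right_le (K := M) (ε := 0)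
    (fun t ht => (hy t ht).continuousWithinAt)
    (fun t ht => hasDerivWithinAt_Ici_of_Icc ht (hy t (Ico_subset_Icc_self ht))) le_rfl
    (fun t ht => by simpa using hy' t (Ico_subset_Icc_self ht)) t ht
  rwa [gronwallBound_ε0, sub_zero] at hgronwall

theorem isPicardLindelof_clm_radialRetraction {A : ℝ → F →L[ℝ] F}
    (hA : ContinuousOn A (Icc 0 1)) {M R : NNReal} (hM : ∀ t ∈ Icc (0 : ℝ) 1, ‖A t‖ ≤ M)
    (hR : (0 : ℝ) < R) (y₀ : F) :
    IsPicardLindelof (fun t y => A t (radialRetraction R y))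
      (tmin := 0) (tmax := 1) ⟨0, by simp⟩ y₀ (M * R) 0 (M * R) (M * 2) := by
  refine ⟨fun t ht => ?_, fun y _ => hA.clm_apply continuousOn_const, fun t ht y _ => ?_, by simp⟩
  · refine LipschitzOnWith.of_dist_le_mul fun x _ y _ => ?_
    rw [dist_eq_norm, dist_eq_norm, ← map_sub]
    refine ((A t).le_opNorm _).trans ?_
    push_cast
    rw [mul_assoc]
    exact mul_le_mul (hM t ht) (norm_radialRetraction_sub_le hR x y) (norm_nonneg _) M.2
  · refine ((A t).le_opNorm _).trans ?_
    push_cast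
    exact mul_le_mul (hM t ht) (norm_radialRetraction_le hR y) (norm_nonneg _) M.2

-- By Grönwall the truncated solution never leaves the ball on which the truncation is inactive.
theorem exists_linear_ode [CompleteSpace F] {A : ℝ → F →L[ℝ] F} (hA : ContinuousOn A (Icc 0 1))
    (y₀ : F) : ∃ y : ℝ → F, y 0 = y₀ ∧
      ∀ t ∈ Icc (0 : ℝ) 1, HasDerivWithinAt y (A t (y t)) (Icc 0 1) t := by
  obtain ⟨M₀, hM₀⟩ := isCompact_Icc.exists_bound_of_continuousOn hA
  obtain ⟨M, hM⟩ : ∃ M : NNReal, ∀ t ∈ Icc (0 : ℝ) 1, ‖A t‖ ≤ M :=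
    ⟨M₀.toNNReal, fun t ht => (hM₀ t ht).trans (Real.le_coe_toNNReal _)⟩
  let R : NNReal := ⟨(‖y₀‖ + 1) * Real.exp M, by positivity⟩
  have hR : (0 : ℝ) < R := by change 0 < (‖y₀‖ + 1) * Real.exp M; positivity
  obtain ⟨y, hy0 : y 0 = y₀, hy⟩ := (isPicardLindelof_clm_radialRetraction hA hM hR
    y₀).exists_eq_forall_mem_Icc_hasDerivWithinAt₀
  refine ⟨y, hy0, fun t ht => ?_⟩
  have hgrowth : ∀ t ∈ Icc (0 : ℝ) 1, ‖A t (radialRetraction R (y t))‖ ≤ M * ‖y t‖ := fun t ht =>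
    ((A t).le_opNorm _).trans
      (mul_le_mul (hM t ht) (norm_radialRetraction_le_norm hR _) (norm_nonneg _) M.2)
  have hyR : ‖y t‖ ≤ R := by
    refine (norm_le_mul_exp_of_norm_deriv_le hy hgrowth ht).trans ?_
    rw [hy0]
    change ‖y₀‖ * Real.exp (M * t) ≤ (‖y₀‖ + 1) * Real.exp M
    gcongr
    · linarith
    · exact mul_le_of_le_one_right M.2 ht.2
  simpa only [radialRetraction_of_norm_le hR hyR] using hy t ht

theorem exists_fundamental_solution [FiniteDimensional ℝ F] {A : ℝ → F →L[ℝ] F}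
    (hA : ContinuousOn A (Icc 0 1)) :
    ∃ J K : ℝ → F →L[ℝ] F, J 0 = 1 ∧ ∀ t ∈ Icc (0 : ℝ) 1,
      HasDerivWithinAt J (A t * J t) (Icc 0 1) t ∧ J t * K t = 1 := by
  have : CompleteSpace F := FiniteDimensional.complete ℝ F
  obtain ⟨J, hJ0, hJ⟩ := exists_linear_ode (F := F →L[ℝ] F)
    (A := fun t => ContinuousLinearMap.mul ℝ (F →L[ℝ] F) (A t))
    ((ContinuousLinearMap.continuous _).comp_continuousOn hA) 1
  -- The inverse solves the adjoint equation `K' = -K A`, so that `(K J)' = 0`.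
  obtain ⟨K, hK0, hK⟩ := exists_linear_ode (F := F →L[ℝ] F)
    (A := fun t => (ContinuousLinearMap.mul ℝ (F →L[ℝ] F)).flip (-A t))
    ((ContinuousLinearMap.continuous _).comp_continuousOn hA.neg) 1
  simp only [ContinuousLinearMap.mul_apply', ContinuousLinearMap.flip_apply] at hJ hK
  have hderiv : ∀ t ∈ Icc (0 : ℝ) 1, HasDerivWithinAt (fun s => K s * J s) 0 (Icc 0 1) t :=
    fun t ht => ((hK t ht).mul (hJ t ht)).congr_deriv
      (by rw [mul_neg, neg_mul, mul_assoc, neg_add_cancel])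
  refine ⟨J, K, hJ0, fun t ht => ⟨hJ t ht, clm_mul_eq_one_symm ?_⟩⟩
  have hconst := (convex_Icc (0 : ℝ) 1).norm_image_sub_le_of_norm_hasDerivWithin_le
    (C := 0) hderiv (by simp) (left_mem_Icc.2 zero_le_one) ht
  rw [zero_mul, norm_le_zero_iff, sub_eq_zero] at hconst
  rw [hconst, hJ0, hK0, one_mul]

end LinearODE

section Flow

theorem mem_closedBall_of_dist_lt_one {V : Type*} [NormedAddCommGroup V] {R : ℝ} {x y : V}
    (hx : ‖x‖ ≤ R) (hyx : dist y x < 1) : y ∈ Metric.closedBall (0 : V) (R + 1) := by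
  rw [mem_closedBall_zero_iff]
  rw [dist_eq_norm] at hyx
  linarith [norm_le_norm_add_norm_sub' y x]

variable {V : Type*} [NormedAddCommGroup V] [NormedSpace ℝ V]

/-- `X` is the flow on `[0, 1]` of the time-dependent `C¹` vector field `w` with space
derivative `A`. -/
structure IsC1Flow (w : V → ℝ → V) (A : V → ℝ → V →L[ℝ] V) (X : V → ℝ → V) : Prop where
  hasFDerivAt : ∀ t ∈ Icc (0 : ℝ) 1, ∀ x, HasFDerivAt (fun x => w x t) (A x t) x
  continuousOn_deriv : ContinuousOn (fun z : V × ℝ => A z.1 z.2) (univ ×ˢ Icc 0 1)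
  start : ∀ x, X x 0 = x
  ode : ∀ x, ∀ t ∈ Icc (0 : ℝ) 1, HasDerivWithinAt (X x) (w (X x t) t) (Icc 0 1) t

namespace IsC1Flow

variable {w : V → ℝ → V} {A : V → ℝ → V →L[ℝ] V} {X : V → ℝ → V}

theorem continuousOn (h : IsC1Flow w A X) (x : V) : ContinuousOn (X x) (Icc 0 1) :=
  fun t ht => (h.ode x t ht).continuousWithinAt

theorem continuousOn_deriv_along (h : IsC1Flow w A X) (x : V) :
    ContinuousOn (fun t => A (X x t) t) (Icc 0 1) :=
  h.continuousOn_deriv.comp ((h.continuousOn x).prodMk continuousOn_id) fun _ ht => ⟨trivial, ht⟩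

theorem exists_norm_le (h : IsC1Flow w A X) (x : V) : ∃ R, ∀ t ∈ Icc (0 : ℝ) 1, ‖X x t‖ ≤ R :=
  isCompact_Icc.exists_bound_of_continuousOn (h.continuousOn x)

theorem lipschitzOnWith (h : IsC1Flow w A X) {R : ℝ} {K : NNReal}
    (hK : ∀ t ∈ Icc (0 : ℝ) 1, ∀ x ∈ Metric.closedBall (0 : V) R, ‖A x t‖ ≤ K)
    {t : ℝ} (ht : t ∈ Icc (0 : ℝ) 1) :
    LipschitzOnWith K (fun x => w x t) (Metric.closedBall 0 R) :=
  (convex_closedBall _ _).lipschitzOnWith_of_nnnorm_hasFDerivWithin_le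
    (fun x _ => (h.hasFDerivAt t ht x).hasFDerivWithinAt) fun x hx => hK t ht x hx

theorem dist_le_of_forall_mem_closedBall (h : IsC1Flow w A X) {R : ℝ} {K : NNReal}
    (hK : ∀ t ∈ Icc (0 : ℝ) 1, ∀ x ∈ Metric.closedBall (0 : V) R, ‖A x t‖ ≤ K)
    {x y : V} {b : ℝ} (hb : b ∈ Icc (0 : ℝ) 1)
    (hx : ∀ t ∈ Ico 0 b, X x t ∈ Metric.closedBall 0 R)
    (hy : ∀ t ∈ Ico 0 b, X y t ∈ Metric.closedBall 0 R) :
    dist (X y b) (X x b) ≤ dist y x * Real.exp K := by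
  have hsub : Icc 0 b ⊆ Icc (0 : ℝ) 1 := Icc_subset_Icc_right hb.2
  have hIco : ∀ s ∈ Ico 0 b, s ∈ Icc (0 : ℝ) 1 := fun s hs => hsub (Ico_subset_Icc_self hs)
  have hderiv : ∀ z, ∀ s ∈ Ico 0 b, HasDerivWithinAt (X z) (w (X z s) s) (Ici s) s :=
    fun z s hs => hasDerivWithinAt_Ici_of_Icc ⟨hs.1, hs.2.trans_le hb.2⟩ (h.ode z s (hIco s hs))
  refine (dist_le_of_trajectories_ODE_of_mem (v := fun t x => w x t)
    (s := fun _ => Metric.closedBall (0 : V) R) (δ := dist y x)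
    (fun s hs => h.lipschitzOnWith hK (hIco s hs))
    ((h.continuousOn y).mono hsub) (hderiv y) hy ((h.continuousOn x).mono hsub) (hderiv x) hx
    (by rw [h.start, h.start]) b (right_mem_Icc.2 hb.1)).trans ?_
  rw [sub_zero]
  gcongr
  exact mul_le_of_le_one_right K.2 hb.2

-- At the first time of distance `1` the Grönwall bound would still be valid and less than `1`.
theorem dist_lt_one (h : IsC1Flow w A X) {R : ℝ} {K : NNReal}
    (hK : ∀ t ∈ Icc (0 : ℝ) 1, ∀ x ∈ Metric.closedBall (0 : V) (R + 1), ‖A x t‖ ≤ K)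
    {x y : V} (hR : ∀ t ∈ Icc (0 : ℝ) 1, ‖X x t‖ ≤ R) (hy : dist y x * Real.exp K < 1) :
    ∀ t ∈ Icc (0 : ℝ) 1, dist (X y t) (X x t) < 1 := by
  by_contra! hexit
  obtain ⟨t₀, ht₀, hfar⟩ := hexit
  have hdist : ContinuousOn (fun t => dist (X y t) (X x t)) (Icc 0 1) :=
    continuous_dist.comp_continuousOn ((h.continuousOn y).prodMk (h.continuousOn x))
  have hcompact : IsCompact (Icc (0 : ℝ) 1 ∩ (fun t => dist (X y t) (X x t)) ⁻¹' Ici 1) :=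
    isCompact_Icc.of_isClosed_subset
      (hdist.preimage_isClosed_of_isClosed isClosed_Icc isClosed_Ici) inter_subset_left
  obtain ⟨τ, ⟨hτ, hfarτ⟩, hfirst⟩ := hcompact.exists_isLeast ⟨t₀, ht₀, hfar⟩
  have hmem : ∀ t ∈ Ico 0 τ, t ∈ Icc (0 : ℝ) 1 := fun t ht => ⟨ht.1, ht.2.le.trans hτ.2⟩
  have hnear : ∀ t ∈ Ico 0 τ, dist (X y t) (X x t) < 1 := fun t ht => by
    by_contra! hge
    exact absurd (hfirst ⟨hmem t ht, hge⟩) (not_le.2 ht.2)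
  have hbound := h.dist_le_of_forall_mem_closedBall hK hτ
    (x := x) (y := y) (fun t ht => mem_closedBall_of_dist_lt_one (hR t (hmem t ht)) (by simp))
    (fun t ht => mem_closedBall_of_dist_lt_one (hR t (hmem t ht)) (hnear t ht))
  exact absurd hfarτ (not_le.2 (hbound.trans_lt hy))

theorem dist_le (h : IsC1Flow w A X) {R : ℝ} {K : NNReal}
    (hK : ∀ t ∈ Icc (0 : ℝ) 1, ∀ x ∈ Metric.closedBall (0 : V) (R + 1), ‖A x t‖ ≤ K)
    {x y : V} (hR : ∀ t ∈ Icc (0 : ℝ) 1, ‖X x t‖ ≤ R) (hy : dist y x * Real.exp K < 1)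
    {t : ℝ} (ht : t ∈ Icc (0 : ℝ) 1) : dist (X y t) (X x t) ≤ dist y x * Real.exp K := by
  have hmem : ∀ s ∈ Ico 0 t, s ∈ Icc (0 : ℝ) 1 := fun s hs => ⟨hs.1, hs.2.le.trans ht.2⟩
  exact h.dist_le_of_forall_mem_closedBall hK ht
    (fun s hs => mem_closedBall_of_dist_lt_one (hR s (hmem s hs)) (by simp))
    (fun s hs => mem_closedBall_of_dist_lt_one (hR s (hmem s hs))
      (h.dist_lt_one hK hR hy s (hmem s hs)))

theorem norm_sub_sub_le_of_linearization (h : IsC1Flow w A X) {x y : V} {J : ℝ → V →L[ℝ] V}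
    (hJ0 : J 0 = 1)
    (hJ : ∀ t ∈ Icc (0 : ℝ) 1, HasDerivWithinAt J (A (X x t) t * J t) (Icc 0 1) t)
    {K ε : ℝ} (hK1 : 1 ≤ K) (hK : ∀ t ∈ Icc (0 : ℝ) 1, ‖A (X x t) t‖ ≤ K) (hε : 0 ≤ ε)
    (hlin : ∀ t ∈ Icc (0 : ℝ) 1,
      ‖w (X y t) t - w (X x t) t - A (X x t) t (X y t - X x t)‖ ≤ ε)
    {t : ℝ} (ht : t ∈ Icc (0 : ℝ) 1) :
    ‖X y t - X x t - J t (y - x)‖ ≤ ε * Real.exp K := by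
  have hderiv : ∀ s ∈ Icc (0 : ℝ) 1, HasDerivWithinAt
      (fun s => X y s - X x s - J s (y - x))
      (w (X y s) s - w (X x s) s - (A (X x s) s * J s) (y - x)) (Icc 0 1) s := fun s hs =>
    ((h.ode y s hs).sub (h.ode x s hs)).sub
      (by simpa using (hJ s hs).clm_apply (hasDerivWithinAt_const s _ (y - x)))
  have hbound : ∀ s ∈ Icc (0 : ℝ) 1,
      ‖w (X y s) s - w (X x s) s - (A (X x s) s * J s) (y - x)‖ ≤
        K * ‖X y s - X x s - J s (y - x)‖ + ε := by
    intro s hs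
    have hsplit : w (X y s) s - w (X x s) s - (A (X x s) s * J s) (y - x) =
        A (X x s) s (X y s - X x s - J s (y - x)) +
        (w (X y s) s - w (X x s) s - A (X x s) s (X y s - X x s)) := by
      simp only [map_sub, mul_apply_eq_comp]
      abel
    rw [hsplit]
    exact (norm_add_le _ _).trans
      (add_le_add (ContinuousLinearMap.le_of_opNorm_le _ (hK s hs) _) (hlin s hs))
  have hgronwall := norm_le_gronwallBound_of_norm_deriv_right_le (δ := 0) (K := K) (ε := ε)
    (fun s hs => (hderiv s hs).continuousWithinAt)
    (fun s hs => hasDerivWithinAt_Ici_of_Icc hs (hderiv s (Ico_subset_Icc_self hs)))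
    (by simp [h.start, hJ0]) (fun s hs => hbound s (Ico_subset_Icc_self hs)) t ht
  have hexp : Real.exp (K * t) - 1 ≤ Real.exp K := by
    have hKt : K * t ≤ K := mul_le_of_le_one_right (by positivity) ht.2
    linarith [Real.exp_le_exp.2 hKt]
  rw [gronwallBound_of_K_ne_0 (by positivity)] at hgronwall
  simp only [zero_mul, zero_add, sub_zero] at hgronwall
  refine hgronwall.trans (mul_le_mul (div_le_self hε hK1) hexp ?_ hε)
  linarith [Real.one_le_exp (mul_nonneg (zero_le_one.trans hK1) ht.1)]

variable [FiniteDimensional ℝ V]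

theorem exists_deriv_bound (h : IsC1Flow w A X) (R : ℝ) : ∃ K : NNReal, 1 ≤ K ∧
    ∀ t ∈ Icc (0 : ℝ) 1, ∀ x ∈ Metric.closedBall (0 : V) R, ‖A x t‖ ≤ K := by
  have : ProperSpace V := FiniteDimensional.proper ℝ V
  obtain ⟨K, hK⟩ := ((isCompact_closedBall (0 : V) R).prod
    (isCompact_Icc (a := (0 : ℝ)) (b := 1))).exists_bound_of_continuousOn
    (h.continuousOn_deriv.mono (prod_mono_left (subset_univ _)))
  refine ⟨max 1 K.toNNReal, le_max_left _ _, fun t ht x hx => ?_⟩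
  refine (hK (x, t) ⟨hx, ht⟩).trans ((Real.le_coe_toNNReal K).trans ?_)
  exact_mod_cast le_max_right _ _

theorem exists_linearization_bound (h : IsC1Flow w A X) (R : ℝ) {η : ℝ} (hη : 0 < η) :
    ∃ δ > 0, ∀ t ∈ Icc (0 : ℝ) 1, ∀ x ∈ Metric.closedBall (0 : V) R,
      ∀ y ∈ Metric.closedBall (0 : V) R, dist y x < δ →
        ‖w y t - w x t - A x t (y - x)‖ ≤ η * ‖y - x‖ := by
  have : ProperSpace V := FiniteDimensional.proper ℝ V
  have hunif : UniformContinuousOn (fun z : V × ℝ => A z.1 z.2)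
      (Metric.closedBall 0 R ×ˢ Icc 0 1) :=
    ((isCompact_closedBall (0 : V) R).prod isCompact_Icc).uniformContinuousOn_of_continuous
      (h.continuousOn_deriv.mono (prod_mono_left (subset_univ _)))
  obtain ⟨δ, hδ0, hδ⟩ := Metric.uniformContinuousOn_iff.1 hunif η hη
  refine ⟨δ, hδ0, fun t ht x hx y hy hyx => ?_⟩
  have hconvex : Convex ℝ (Metric.ball x δ ∩ Metric.closedBall 0 R) :=
    (convex_ball _ _).inter (convex_closedBall _ _)
  refine hconvex.norm_image_sub_le_of_norm_hasFDerivWithin_le' (f := fun z => w z t)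
    (f' := fun z => A z t) (fun z _ => (h.hasFDerivAt t ht z).hasFDerivWithinAt)
    (fun z hz => ?_) ⟨Metric.mem_ball_self hδ0, hx⟩ ⟨hyx, hy⟩
  rw [← dist_eq_norm]
  refine (hδ (z, t) ⟨hz.2, ht⟩ (x, t) ⟨hx, ht⟩ ?_).le
  rw [Prod.dist_eq, dist_self, max_eq_left dist_nonneg]
  exact hz.1

theorem injective (h : IsC1Flow w A X) {t : ℝ} (ht : t ∈ Icc (0 : ℝ) 1) :
    Function.Injective fun x => X x t := by
  intro x y hxy
  obtain ⟨Rx, hRx⟩ := h.exists_norm_le x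
  obtain ⟨Ry, hRy⟩ := h.exists_norm_le y
  obtain ⟨K, -, hK⟩ := h.exists_deriv_bound (max Rx Ry)
  have hsub : Icc 0 t ⊆ Icc (0 : ℝ) 1 := Icc_subset_Icc_right ht.2
  have hIoc : ∀ s ∈ Ioc 0 t, s ∈ Icc (0 : ℝ) 1 := fun s hs => hsub (Ioc_subset_Icc_self hs)
  have hderiv : ∀ z, ∀ s ∈ Ioc 0 t, HasDerivWithinAt (X z) (w (X z s) s) (Iic s) s :=
    fun z s hs => (h.ode z s (hIoc s hs)).mono_of_mem_nhdsWithin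
      (Icc_mem_nhdsLE_of_mem ⟨hs.1, hs.2.trans ht.2⟩)
  have hstart := ODE_solution_unique_of_mem_Icc_left (v := fun t x => w x t)
    (s := fun _ => Metric.closedBall (0 : V) (max Rx Ry))
    (fun s hs => h.lipschitzOnWith hK (hIoc s hs))
    ((h.continuousOn x).mono hsub) (hderiv x)
    (fun s hs => mem_closedBall_zero_iff.2 ((hRx s (hIoc s hs)).trans (le_max_left _ _)))
    ((h.continuousOn y).mono hsub) (hderiv y)
    (fun s hs => mem_closedBall_zero_iff.2 ((hRy s (hIoc s hs)).trans (le_max_right _ _)))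
    hxy (left_mem_Icc.2 ht.1)
  simpa [h.start] using hstart

theorem hasFDerivAt_flow (h : IsC1Flow w A X) {x : V} {J : ℝ → V →L[ℝ] V} (hJ0 : J 0 = 1)
    (hJ : ∀ t ∈ Icc (0 : ℝ) 1, HasDerivWithinAt J (A (X x t) t * J t) (Icc 0 1) t)
    {t : ℝ} (ht : t ∈ Icc (0 : ℝ) 1) : HasFDerivAt (fun y => X y t) (J t) x := by
  obtain ⟨R, hR⟩ := h.exists_norm_le x
  obtain ⟨K, hK1, hK⟩ := h.exists_deriv_bound (R + 1)
  have hxR : ∀ s ∈ Icc (0 : ℝ) 1, X x s ∈ Metric.closedBall (0 : V) (R + 1) := fun s hs =>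
    mem_closedBall_of_dist_lt_one (hR s hs) (by simp)
  rw [hasFDerivAt_iff_isLittleO, Asymptotics.isLittleO_iff]
  intro c hc
  set η := c / (Real.exp K * Real.exp K) with hη
  have hη0 : 0 < η := by positivity
  obtain ⟨δ, hδ0, hδ⟩ := h.exists_linearization_bound (R + 1) hη0
  have hnear : ∀ᶠ y in 𝓝 x, dist y x * Real.exp K < min 1 δ := by
    have hlim : Tendsto (fun y => dist y x * Real.exp K) (𝓝 x) (𝓝 (dist x x * Real.exp K)) :=
      ((continuous_id.dist continuous_const).mul continuous_const).tendsto x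
    rw [dist_self, zero_mul] at hlim
    exact hlim.eventually (gt_mem_nhds (lt_min one_pos hδ0))
  filter_upwards [hnear] with y hy
  have hy1 := hy.trans_le (min_le_left _ _)
  have hdist : ∀ s ∈ Icc (0 : ℝ) 1, dist (X y s) (X x s) ≤ dist y x * Real.exp K :=
    fun s hs => h.dist_le hK hR hy1 hs
  have hlin : ∀ s ∈ Icc (0 : ℝ) 1,
      ‖w (X y s) s - w (X x s) s - A (X x s) s (X y s - X x s)‖ ≤
        η * (dist y x * Real.exp K) := fun s hs => by
    refine (hδ s hs _ (hxR s hs) _ ?_ ?_).trans ?_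
    · exact mem_closedBall_of_dist_lt_one (hR s hs) ((hdist s hs).trans_lt hy1)
    · exact (hdist s hs).trans_lt (hy.trans_le (min_le_right _ _))
    · rw [← dist_eq_norm]
      exact mul_le_mul_of_nonneg_left (hdist s hs) hη0.le
  refine (h.norm_sub_sub_le_of_linearization hJ0 hJ (by exact_mod_cast hK1)
    (fun s hs => hK s hs _ (hxR s hs)) (by positivity) hlin ht).trans_eq ?_
  rw [hη, dist_eq_norm]
  field_simp

theorem exists_jacobian_hasDerivWithinAt_log_det (h : IsC1Flow w A X) (x : V) :
    ∃ J : ℝ → V →L[ℝ] V, J 0 = 1 ∧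
      ∀ t ∈ Icc (0 : ℝ) 1, HasFDerivAt (fun y => X y t) (J t) x ∧ (J t).det ≠ 0 ∧
        HasDerivWithinAt (fun s => Real.log (J s).det) (traceCLM V (A (X x t) t)) (Icc 0 1) t := by
  obtain ⟨J, K, hJ0, hJK⟩ := exists_fundamental_solution (h.continuousOn_deriv_along x)
  refine ⟨J, hJ0, fun t ht => ?_⟩
  obtain ⟨hJ, hinv⟩ := hJK t ht
  refine ⟨h.hasFDerivAt_flow hJ0 (fun s hs => (hJK s hs).1) ht,
    det_ne_zero_of_mul_eq_one hinv, ?_⟩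
  simpa only [mul_assoc, hinv, mul_one] using hasDerivWithinAt_log_det hJ hinv

end IsC1Flow

end Flow

/-! ### Densities of image measures -/

section Pushforward

/-- The measure with density `u` with respect to `μ`. -/
abbrev densityLaw {Ω : Type*} [MeasurableSpace Ω] (μ : Measure Ω) (u : Ω → ℝ) : Measure Ω :=
  μ.withDensity fun x => ENNReal.ofReal (u x)

theorem withDensity_eq_withDensity_densityLaw {Ω : Type*} [MeasurableSpace Ω] (μ : Measure Ω)
    {d : Ω → ℝ≥0∞} (hd : Measurable d) {v : Ω → ℝ} (hv : Measurable v) (hv0 : ∀ x, 0 < v x) :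
    μ.withDensity d = (densityLaw μ v).withDensity fun x => d x / ENNReal.ofReal (v x) := by
  have hv' : Measurable fun x => ENNReal.ofReal (v x) := ENNReal.measurable_ofReal.comp hv
  refine Eq.trans ?_ (withDensity_mul μ hv' (hd.div hv'))
  congr 1
  ext x
  simp only [Pi.mul_apply]
  rw [ENNReal.mul_div_cancel (by simpa using hv0 x) ENNReal.ofReal_ne_top]

theorem integral_densityLaw {Ω : Type*} [MeasurableSpace Ω] (μ : Measure Ω) {u : Ω → ℝ}
    (hu : Measurable u) (hu0 : ∀ x, 0 ≤ u x) (f : Ω → ℝ) :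
    ∫ x, f x ∂(densityLaw μ u) = ∫ x, u x * f x ∂μ := by
  rw [integral_withDensity_eq_integral_toReal_smul hu.ennreal_ofReal
    (.of_forall fun x => ENNReal.ofReal_lt_top)]
  simp only [ENNReal.toReal_ofReal (hu0 _), smul_eq_mul]

theorem integrable_densityLaw_iff {Ω : Type*} [MeasurableSpace Ω] (μ : Measure Ω) {u : Ω → ℝ}
    (hu : Measurable u) (hu0 : ∀ x, 0 ≤ u x) (f : Ω → ℝ) :
    Integrable f (densityLaw μ u) ↔ Integrable (fun x => u x * f x) μ := by
  rw [integrable_withDensity_iff_integrable_smul' hu.ennreal_ofReal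
    (.of_forall fun x => ENNReal.ofReal_lt_top)]
  simp only [ENNReal.toReal_ofReal (hu0 _), smul_eq_mul]

variable {V : Type*} [NormedAddCommGroup V] [NormedSpace ℝ V] {f : V → V} {u v : V → ℝ}

/-- The density of the image under an injective map `f` of the law with density `u`; it vanishes
outside the range of `f`. -/
def pushforwardDensity (f : V → V) (u : V → ℝ) : V → ℝ≥0∞ :=
  Function.extend f (fun x => ENNReal.ofReal (u x / |(fderiv ℝ f x).det|)) 0

theorem pushforwardDensity_apply (hinj : Function.Injective f) (x : V) :
    pushforwardDensity f u (f x) = ENNReal.ofReal (u x / |(fderiv ℝ f x).det|) :=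
  hinj.extend_apply _ _ _

theorem support_pushforwardDensity_subset : Function.support (pushforwardDensity f u) ⊆ range f :=
  Function.support_subset_iff'.2 fun _ hy => Function.extend_apply' _ _ _ hy

variable [FiniteDimensional ℝ V] [MeasurableSpace V] [BorelSpace V]

theorem measurable_det_fderiv (f : V → V) : Measurable fun x => (fderiv ℝ f x).det :=
  have : CompleteSpace V := FiniteDimensional.complete ℝ V
  ContinuousLinearMap.continuous_det.measurable.comp (measurable_fderiv ℝ f)

theorem measurableEmbedding_of_differentiable (hf : Differentiable ℝ f)
    (hinj : Function.Injective f) : MeasurableEmbedding f :=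
  have : ProperSpace V := FiniteDimensional.proper ℝ V
  hf.continuous.measurableEmbedding hinj

theorem measurable_pushforwardDensity (hf : Differentiable ℝ f) (hinj : Function.Injective f)
    (hu : Measurable u) : Measurable (pushforwardDensity f u) :=
  (measurableEmbedding_of_differentiable hf hinj).measurable_extend
    (ENNReal.measurable_ofReal.comp (hu.div (measurable_det_fderiv f).abs)) measurable_const

variable (μ : Measure V)

theorem map_densityLaw [μ.IsAddHaarMeasure] (hf : Differentiable ℝ f)
    (hinj : Function.Injective f) (hdet : ∀ x, (fderiv ℝ f x).det ≠ 0) :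
    (densityLaw μ u).map f = μ.withDensity (pushforwardDensity f u) := by
  have hemb := measurableEmbedding_of_differentiable hf hinj
  ext s hs
  have hpre : MeasurableSet (f ⁻¹' s) := hemb.measurable hs
  have hrange : ∫⁻ y in s, pushforwardDensity f u y ∂μ =
      ∫⁻ y in f '' (f ⁻¹' s), pushforwardDensity f u y ∂μ := by
    rw [← lintegral_indicator hs, ← lintegral_indicator (hemb.measurableSet_image.2 hpre),
      image_preimage_eq_inter_range, ← indicator_indicator,
      indicator_eq_self.2 support_pushforwardDensity_subset]
  rw [Measure.map_apply hemb.measurable hs, withDensity_apply _ hpre, withDensity_apply _ hs,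
    hrange, lintegral_image_eq_lintegral_abs_det_fderiv_mul μ hpre
    (fun x _ => (hf x).hasFDerivAt.hasFDerivWithinAt) hinj.injOn]
  refine lintegral_congr fun x => ?_
  rw [pushforwardDensity_apply hinj, ← ENNReal.ofReal_mul (abs_nonneg _),
    mul_div_cancel₀ _ (abs_ne_zero.2 (hdet x))]

theorem map_densityLaw_eq_withDensity_densityLaw [μ.IsAddHaarMeasure] (hf : Differentiable ℝ f)
    (hinj : Function.Injective f) (hdet : ∀ x, (fderiv ℝ f x).det ≠ 0) (hu : Measurable u)
    (hv : Measurable v) (hv0 : ∀ x, 0 < v x) :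
    (densityLaw μ u).map f = (densityLaw μ v).withDensity
      fun x => pushforwardDensity f u x / ENNReal.ofReal (v x) := by
  rw [map_densityLaw μ hf hinj hdet, withDensity_eq_withDensity_densityLaw μ
    (measurable_pushforwardDensity hf hinj hu) hv hv0]

theorem map_densityLaw_absolutelyContinuous [μ.IsAddHaarMeasure] (hf : Differentiable ℝ f)
    (hinj : Function.Injective f) (hdet : ∀ x, (fderiv ℝ f x).det ≠ 0) (hu : Measurable u)
    (hv : Measurable v) (hv0 : ∀ x, 0 < v x) : (densityLaw μ u).map f ≪ densityLaw μ v := by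
  rw [map_densityLaw_eq_withDensity_densityLaw μ hf hinj hdet hu hv hv0]
  exact withDensity_absolutelyContinuous _ _

theorem llr_map_densityLaw_comp [μ.IsAddHaarMeasure] (hf : Differentiable ℝ f)
    (hinj : Function.Injective f) (hdet : ∀ x, (fderiv ℝ f x).det ≠ 0) (hu : Measurable u)
    (hv : Measurable v) (hu0 : ∀ x, 0 < u x) (hv0 : ∀ x, 0 < v x)
    [SigmaFinite (densityLaw μ v)] :
    (fun x => llr ((densityLaw μ u).map f) (densityLaw μ v) (f x)) =ᵐ[densityLaw μ u]
      fun x => Real.log (u x) - Real.log (fderiv ℝ f x).det - Real.log (v (f x)) := by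
  have hrnDeriv : ((densityLaw μ u).map f).rnDeriv (densityLaw μ v) =ᵐ[densityLaw μ v]
      fun x => pushforwardDensity f u x / ENNReal.ofReal (v x) := by
    rw [map_densityLaw_eq_withDensity_densityLaw μ hf hinj hdet hu hv hv0]
    exact Measure.rnDeriv_withDensity _
      ((measurable_pushforwardDensity hf hinj hu).div (ENNReal.measurable_ofReal.comp hv))
  filter_upwards [ae_of_ae_map hf.continuous.measurable.aemeasurable
    ((map_densityLaw_absolutelyContinuous μ hf hinj hdet hu hv hv0).ae_le hrnDeriv)] with x hx
  have hu0x := hu0 x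
  have hdetx := abs_ne_zero.2 (hdet x)
  rw [llr, hx, pushforwardDensity_apply hinj, ENNReal.toReal_div,
    ENNReal.toReal_ofReal (by positivity), ENNReal.toReal_ofReal (hv0 _).le,
    Real.log_div (div_ne_zero hu0x.ne' hdetx) (hv0 _).ne', Real.log_div hu0x.ne' hdetx,
    Real.log_abs]

theorem klDiv_map_densityLaw [μ.IsAddHaarMeasure] (hf : Differentiable ℝ f)
    (hinj : Function.Injective f) (hdet : ∀ x, (fderiv ℝ f x).det ≠ 0) (hu : Measurable u)
    (hv : Measurable v) (hu0 : ∀ x, 0 < u x) (hv0 : ∀ x, 0 < v x)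
    [IsProbabilityMeasure (densityLaw μ u)] [IsProbabilityMeasure (densityLaw μ v)] :
    (klDiv ((densityLaw μ u).map f) (densityLaw μ v) ≠ ∞ ↔
      Integrable (fun x => Real.log (u x) - Real.log (fderiv ℝ f x).det - Real.log (v (f x)))
        (densityLaw μ u)) ∧
    (klDiv ((densityLaw μ u).map f) (densityLaw μ v)).toReal =
      ∫ x, (Real.log (u x) - Real.log (fderiv ℝ f x).det - Real.log (v (f x)))
        ∂(densityLaw μ u) := by
  have hemb := measurableEmbedding_of_differentiable hf hinj
  have hac := map_densityLaw_absolutelyContinuous μ hf hinj hdet hu hv hv0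
  have hllr := llr_map_densityLaw_comp μ hf hinj hdet hu hv hu0 hv0
  have hprob : IsProbabilityMeasure ((densityLaw μ u).map f) :=
    Measure.isProbabilityMeasure_map hf.continuous.measurable.aemeasurable
  constructor
  · rw [klDiv_ne_top_iff, hemb.integrable_map_iff]
    simp only [hac, true_and]
    exact integrable_congr hllr
  · rw [toReal_klDiv_of_measure_eq hac (by simp), hemb.integral_map]
    exact integral_congr_ae hllr

end Pushforward

/-! ### The standard Gaussian density -/

section Gaussian

variable {n : ℕ}

/-- The density of the standard Gaussian law. -/
def stdDensity (w : E n) : ℝ := (2 * Real.pi) ^ (-(n : ℝ) / 2) * Real.exp (-‖w‖ ^ 2 / 2)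

theorem stdDensity_pos (w : E n) : 0 < stdDensity w := by
  unfold stdDensity
  positivity

theorem contDiff_stdDensity : ContDiff ℝ (⊤ : ℕ∞) (stdDensity (n := n)) := by
  unfold stdDensity
  exact contDiff_const.mul (((contDiff_norm_sq ℝ).neg.div_const _).exp)

theorem continuous_stdDensity : Continuous (stdDensity (n := n)) := contDiff_stdDensity.continuous

theorem stdDensity_neg (w : E n) : stdDensity (-w) = stdDensity w := by simp [stdDensity]

theorem hasFDerivAt_neg_norm_sq_div_two (w : E n) :
    HasFDerivAt (fun w : E n => -‖w‖ ^ 2 / 2) (-innerSL ℝ w) w := by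
  refine (((hasStrictFDerivAt_norm_sq w).hasFDerivAt.neg.mul_const (2⁻¹ : ℝ)).congr_fderiv
    ?_).congr_of_eventuallyEq (Eventually.of_forall fun x => ?_)
  · ext v
    simp
  · simp [div_eq_mul_inv]

theorem hasFDerivAt_stdDensity (w : E n) :
    HasFDerivAt stdDensity (-(stdDensity w) • innerSL ℝ w) w := by
  refine ((hasFDerivAt_neg_norm_sq_div_two w).exp.const_mul
    ((2 * Real.pi) ^ (-(n : ℝ) / 2))).congr_fderiv ?_
  rw [smul_smul, smul_neg, neg_smul, stdDensity]

theorem fderiv_stdDensity_apply (w v : E n) :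
    fderiv ℝ stdDensity w v = -(stdDensity w * inner ℝ w v) := by
  rw [(hasFDerivAt_stdDensity w).fderiv]
  simp

theorem integrable_exp_neg_mul_norm_sq {b : ℝ} (hb : 0 < b) :
    Integrable fun w : E n => Real.exp (-b * ‖w‖ ^ 2) := by
  refine Integrable.of_integral_ne_zero ?_
  rw [GaussianFourier.integral_rexp_neg_mul_sq_norm hb]
  positivity

theorem integrable_stdDensity : Integrable (stdDensity (n := n)) := by
  refine ((integrable_exp_neg_mul_norm_sq (n := n) (b := 1 / 2) (by norm_num)).const_mul
    ((2 * Real.pi) ^ (-(n : ℝ) / 2))).congr (Eventually.of_forall fun w => ?_)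
  simp only [stdDensity]
  congr 2
  ring

theorem integral_stdDensity : ∫ w : E n, stdDensity w = 1 := by
  have hexponent : ∀ w : E n, -‖w‖ ^ 2 / 2 = -(1 / 2) * ‖w‖ ^ 2 := fun w => by ring
  simp only [stdDensity, hexponent]
  rw [integral_const_mul, GaussianFourier.integral_rexp_neg_mul_sq_norm (by norm_num),
    finrank_euclideanSpace, Fintype.card_fin, show Real.pi / (1 / 2) = 2 * Real.pi by ring,
    ← Real.rpow_add (by positivity), show -(n : ℝ) / 2 + (n : ℝ) / 2 = 0 by ring, Real.rpow_zero]

theorem integrable_norm_sq_mul_stdDensity :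
    Integrable fun w : E n => ‖w‖ ^ 2 * stdDensity w := by
  refine ((integrable_exp_neg_mul_norm_sq (n := n) (b := 1 / 4) (by norm_num)).const_mul
    (4 * (2 * Real.pi) ^ (-(n : ℝ) / 2))).mono'
    ((continuous_norm.pow 2).mul continuous_stdDensity).aestronglyMeasurable
    (Eventually.of_forall fun w => ?_)
  have hnonneg := (stdDensity_pos w).le
  have hsq : ‖w‖ ^ 2 ≤ 4 * Real.exp (1 / 4 * ‖w‖ ^ 2) := by
    linarith [Real.add_one_le_exp (1 / 4 * ‖w‖ ^ 2)]
  calc ‖‖w‖ ^ 2 * stdDensity w‖ = ‖w‖ ^ 2 * stdDensity w := Real.norm_of_nonneg (by positivity)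
    _ ≤ 4 * Real.exp (1 / 4 * ‖w‖ ^ 2) * stdDensity w := by gcongr
    _ = 4 * (2 * Real.pi) ^ (-(n : ℝ) / 2) * Real.exp (1 / 4 * ‖w‖ ^ 2 + -‖w‖ ^ 2 / 2) := by
      rw [stdDensity, Real.exp_add]
      ring
    _ = 4 * (2 * Real.pi) ^ (-(n : ℝ) / 2) * Real.exp (-(1 / 4) * ‖w‖ ^ 2) := by
      congr 2
      ring

theorem integrable_norm_mul_stdDensity : Integrable fun w : E n => ‖w‖ * stdDensity w := by
  refine (integrable_stdDensity.add integrable_norm_sq_mul_stdDensity).mono'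
    (continuous_norm.mul continuous_stdDensity).aestronglyMeasurable
    (Eventually.of_forall fun w => ?_)
  have hnonneg := (stdDensity_pos w).le
  have hle : ‖w‖ ≤ 1 + ‖w‖ ^ 2 := by nlinarith [sq_nonneg (‖w‖ - 1), norm_nonneg w]
  calc ‖‖w‖ * stdDensity w‖ = ‖w‖ * stdDensity w := Real.norm_of_nonneg (by positivity)
    _ ≤ (1 + ‖w‖ ^ 2) * stdDensity w := by gcongr
    _ = stdDensity w + ‖w‖ ^ 2 * stdDensity w := by ring

theorem integrable_inner_mul_stdDensity (y : E n) :
    Integrable fun w : E n => inner ℝ w y * stdDensity w := by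
  refine (integrable_norm_mul_stdDensity.const_mul ‖y‖).mono'
    ((continuous_id.inner continuous_const).mul continuous_stdDensity).aestronglyMeasurable
    (Eventually.of_forall fun w => ?_)
  rw [norm_mul, Real.norm_of_nonneg (stdDensity_pos w).le, ← mul_assoc, mul_comm ‖y‖]
  exact mul_le_mul_of_nonneg_right (norm_inner_le_norm w y) (stdDensity_pos w).le

theorem integral_inner_mul_stdDensity (y : E n) :
    ∫ w : E n, inner ℝ w y * stdDensity w = 0 := by
  have hodd := integral_neg_eq_self (fun w : E n => inner ℝ w y * stdDensity w) volume
  simp only [stdDensity_neg, inner_neg_left, neg_mul, integral_neg] at hodd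
  linarith

theorem integrable_inner_mul_inner_mul_stdDensity (a b : E n) :
    Integrable fun w : E n => inner ℝ w a * (inner ℝ w b * stdDensity w) := by
  refine (integrable_norm_sq_mul_stdDensity.const_mul (‖a‖ * ‖b‖)).mono'
    ((continuous_id.inner continuous_const).mul
      ((continuous_id.inner continuous_const).mul continuous_stdDensity)).aestronglyMeasurable
    (Eventually.of_forall fun w => ?_)
  have hnonneg := (stdDensity_pos w).le
  calc ‖inner ℝ w a * (inner ℝ w b * stdDensity w)‖
      = ‖inner ℝ w a‖ * (‖inner ℝ w b‖ * stdDensity w) := by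
        rw [norm_mul, norm_mul, Real.norm_of_nonneg hnonneg]
    _ ≤ (‖w‖ * ‖a‖) * ((‖w‖ * ‖b‖) * stdDensity w) := by
        gcongr <;> exact norm_inner_le_norm _ _
    _ = ‖a‖ * ‖b‖ * (‖w‖ ^ 2 * stdDensity w) := by ring

theorem integral_inner_mul_inner_mul_stdDensity (a b : E n) :
    ∫ w : E n, inner ℝ w a * (inner ℝ w b * stdDensity w) = inner ℝ a b := by
  have hinner : ∀ w : E n, HasFDerivAt (fun w : E n => inner ℝ w a) (innerSL ℝ a) w := fun w =>
    (innerSL ℝ a).hasFDerivAt.congr_of_eventuallyEq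
      (Eventually.of_forall fun w => real_inner_comm a w)
  have hfderiv : ∀ w : E n, fderiv ℝ (fun w : E n => inner ℝ w a) w b = inner ℝ a b := fun w => by
    rw [(hinner w).fderiv, innerSL_apply_apply]
  have hparts := integral_mul_fderiv_eq_neg_fderiv_mul_of_integrable
    (μ := (volume : Measure (E n))) (f := fun w : E n => inner ℝ w a) (g := stdDensity) (v := b)
    (by simpa only [hfderiv] using integrable_stdDensity.const_mul (inner ℝ a b))
    (by simpa only [fderiv_stdDensity_apply, mul_neg, mul_comm (stdDensity _)] using
      (integrable_inner_mul_inner_mul_stdDensity a b).fun_neg)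
    (integrable_inner_mul_stdDensity a) (fun w _ => (hinner w).differentiableAt)
    (fun w _ => (hasFDerivAt_stdDensity w).differentiableAt)
  simpa only [hfderiv, fderiv_stdDensity_apply, mul_neg, integral_neg, integral_const_mul,
    integral_stdDensity, mul_one, neg_inj, mul_comm (stdDensity _)] using hparts

theorem integral_norm_sq_mul_stdDensity : ∫ w : E n, ‖w‖ ^ 2 * stdDensity w = n := by
  set b := EuclideanSpace.basisFun (Fin n) ℝ
  have hsum : ∀ w : E n, ‖w‖ ^ 2 * stdDensity w =
      ∑ i, inner ℝ w (b i) * (inner ℝ w (b i) * stdDensity w) := fun w => by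
    rw [← b.sum_sq_inner_left w, Finset.sum_mul]
    exact Finset.sum_congr rfl fun i _ => by ring
  simp_rw [hsum]
  rw [integral_finsetSum _ fun i _ => integrable_inner_mul_inner_mul_stdDensity (b i) (b i)]
  simp [integral_inner_mul_inner_mul_stdDensity]

theorem integrable_quadratic_mul_stdDensity (a b c : ℝ) (y : E n) :
    Integrable fun w : E n => (a * ‖w‖ ^ 2 + b * inner ℝ w y + c) * stdDensity w := by
  simp only [add_mul, mul_assoc]
  exact ((integrable_norm_sq_mul_stdDensity.const_mul a).add
    ((integrable_inner_mul_stdDensity y).const_mul b)).add (integrable_stdDensity.const_mul c)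

theorem integral_quadratic_mul_stdDensity (a b c : ℝ) (y : E n) :
    ∫ w : E n, (a * ‖w‖ ^ 2 + b * inner ℝ w y + c) * stdDensity w = a * n + c := by
  have hsq := (integrable_norm_sq_mul_stdDensity (n := n)).const_mul a
  have hinner := (integrable_inner_mul_stdDensity y).const_mul b
  simp only [add_mul, mul_assoc]
  rw [integral_add (hsq.fun_add hinner) (integrable_stdDensity.const_mul c),
    integral_add hsq hinner, integral_const_mul, integral_const_mul, integral_const_mul,
    integral_norm_sq_mul_stdDensity, integral_inner_mul_stdDensity, integral_stdDensity, mul_zero,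
    add_zero, mul_one]

theorem exists_integral_norm_quadratic_mul_stdDensity_le (a b c : ℝ) : ∃ C, ∀ y : E n,
    ∫ w : E n, ‖(a * ‖w‖ ^ 2 + b * inner ℝ w y + c) * stdDensity w‖ ≤ C * (1 + ‖y‖) := by
  have hmajorant : Integrable fun w : E n => (|a| * ‖w‖ ^ 2 + |b| * ‖w‖ + |c|) * stdDensity w := by
    simp only [add_mul, mul_assoc]
    exact ((integrable_norm_sq_mul_stdDensity.const_mul _).add
      (integrable_norm_mul_stdDensity.const_mul _)).add (integrable_stdDensity.const_mul _)
  refine ⟨∫ w : E n, (|a| * ‖w‖ ^ 2 + |b| * ‖w‖ + |c|) * stdDensity w, fun y => ?_⟩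
  rw [← integral_mul_const]
  refine integral_mono (integrable_quadratic_mul_stdDensity a b c y).norm
    (hmajorant.mul_const _) fun w => ?_
  have hinner : |b * inner ℝ w y| ≤ |b| * ‖w‖ * ‖y‖ := by
    rw [abs_mul, mul_assoc]
    exact mul_le_mul_of_nonneg_left (abs_real_inner_le_norm w y) (abs_nonneg b)
  have hpoly : |a * ‖w‖ ^ 2 + b * inner ℝ w y + c| ≤
      (|a| * ‖w‖ ^ 2 + |b| * ‖w‖ + |c|) * (1 + ‖y‖) := by
    have hrest : 0 ≤ |a| * ‖w‖ ^ 2 * ‖y‖ + |b| * ‖w‖ + |c| * ‖y‖ := by positivity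
    have hsq : |a * ‖w‖ ^ 2| = |a| * ‖w‖ ^ 2 := by rw [abs_mul, abs_of_nonneg (sq_nonneg ‖w‖)]
    linarith [abs_add_three (a * ‖w‖ ^ 2) (b * inner ℝ w y) c]
  calc ‖(a * ‖w‖ ^ 2 + b * inner ℝ w y + c) * stdDensity w‖
      = |a * ‖w‖ ^ 2 + b * inner ℝ w y + c| * stdDensity w := by
        rw [norm_mul, Real.norm_eq_abs, Real.norm_of_nonneg (stdDensity_pos w).le]
    _ ≤ (|a| * ‖w‖ ^ 2 + |b| * ‖w‖ + |c|) * (1 + ‖y‖) * stdDensity w :=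
        mul_le_mul_of_nonneg_right hpoly (stdDensity_pos w).le
    _ = (|a| * ‖w‖ ^ 2 + |b| * ‖w‖ + |c|) * stdDensity w * (1 + ‖y‖) := by ring

theorem norm_iteratedFDeriv_neg_norm_sq_div_two_le {i : ℕ} (hi : 1 ≤ i) (w : E n) :
    ‖iteratedFDeriv ℝ i (fun w : E n => -‖w‖ ^ 2 / 2) w‖ ≤ (1 + ‖w‖) ^ i := by
  have hf : fderiv ℝ (fun w : E n => -‖w‖ ^ 2 / 2) = ⇑(-innerSL ℝ : E n →L[ℝ] E n →L[ℝ] ℝ) := by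
    ext1 w
    exact (hasFDerivAt_neg_norm_sq_div_two w).fderiv
  have hw : 1 ≤ 1 + ‖w‖ := by linarith [norm_nonneg w]
  obtain ⟨j, rfl⟩ := Nat.exists_eq_add_of_le' hi
  rw [← norm_iteratedFDeriv_fderiv, hf]
  rcases j with _ | j
  · rw [norm_iteratedFDeriv_zero, neg_apply, norm_neg, innerSL_apply_norm]
    simp
  · have hc : fderiv ℝ ⇑(-innerSL ℝ : E n →L[ℝ] E n →L[ℝ] ℝ) = fun _ => -innerSL ℝ := by
      ext1 w
      exact ContinuousLinearMap.fderiv _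
    rw [← norm_iteratedFDeriv_fderiv, hc]
    rcases j with _ | j
    · rw [norm_iteratedFDeriv_zero, norm_neg]
      exact (norm_innerSL_le ℝ).trans (one_le_pow₀ hw)
    · rw [iteratedFDeriv_const_of_ne (by omega)]
      simp only [Pi.zero_apply, norm_zero]
      positivity

theorem norm_iteratedFDeriv_exp_neg_norm_sq_div_two_le (k : ℕ) (w : E n) :
    ‖iteratedFDeriv ℝ k (fun w : E n => Real.exp (-‖w‖ ^ 2 / 2)) w‖ ≤
      k.factorial * k.factorial * Real.exp (3 / 2) := by
  have hcomp : ‖iteratedFDeriv ℝ k (Real.exp ∘ fun w : E n => -‖w‖ ^ 2 / 2) w‖ ≤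
      k.factorial * Real.exp (-‖w‖ ^ 2 / 2) * (1 + ‖w‖) ^ k := by
    refine norm_iteratedFDeriv_comp_le (N := (⊤ : ℕ∞)) Real.contDiff_exp
      ((contDiff_norm_sq ℝ).neg.div_const _) (by exact_mod_cast le_top) w (fun i _ => ?_)
      fun i hi _ => norm_iteratedFDeriv_neg_norm_sq_div_two_le hi w
    rw [norm_iteratedFDeriv_eq_norm_iteratedDeriv, iteratedDeriv_eq_iterate,
      Real.iter_deriv_exp, Real.norm_of_nonneg (Real.exp_pos _).le]
  have hpow : (1 + ‖w‖) ^ k ≤ k.factorial * Real.exp (1 + ‖w‖) :=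
    (div_le_iff₀' (by positivity)).1 (Real.pow_div_factorial_le_exp (1 + ‖w‖) (by positivity) k)
  have hexponent : -‖w‖ ^ 2 / 2 + (1 + ‖w‖) ≤ 3 / 2 := by nlinarith [sq_nonneg (‖w‖ - 1)]
  calc ‖iteratedFDeriv ℝ k (fun w : E n => Real.exp (-‖w‖ ^ 2 / 2)) w‖
      ≤ k.factorial * Real.exp (-‖w‖ ^ 2 / 2) * (1 + ‖w‖) ^ k := hcomp
    _ ≤ k.factorial * Real.exp (-‖w‖ ^ 2 / 2) * (k.factorial * Real.exp (1 + ‖w‖)) := by gcongr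
    _ = k.factorial * k.factorial * Real.exp (-‖w‖ ^ 2 / 2 + (1 + ‖w‖)) := by
      rw [Real.exp_add (-‖w‖ ^ 2 / 2)]
      ring
    _ ≤ k.factorial * k.factorial * Real.exp (3 / 2) := by gcongr

theorem exists_norm_iteratedFDeriv_stdDensity_le (k : ℕ) :
    ∃ C, ∀ w : E n, ‖iteratedFDeriv ℝ k stdDensity w‖ ≤ C := by
  refine ⟨‖(2 * Real.pi) ^ (-(n : ℝ) / 2)‖ * (k.factorial * k.factorial * Real.exp (3 / 2)),
    fun w => ?_⟩
  change ‖iteratedFDeriv ℝ k ((2 * Real.pi) ^ (-(n : ℝ) / 2) •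
    fun w : E n => Real.exp (-‖w‖ ^ 2 / 2)) w‖ ≤ _
  have hsmooth : ContDiff ℝ k fun w : E n => Real.exp (-‖w‖ ^ 2 / 2) :=
    ((contDiff_norm_sq ℝ).neg.div_const _).exp
  rw [iteratedFDeriv_const_smul_apply hsmooth.contDiffAt, norm_smul]
  exact mul_le_mul_of_nonneg_left (norm_iteratedFDeriv_exp_neg_norm_sq_div_two_le k w)
    (norm_nonneg _)

theorem integral_comp_smul_sub {u : ℝ} (hu : 0 < u) (F : E n → ℝ) (c : E n) :
    ∫ x, F (u • x - c) = (u ^ n)⁻¹ * ∫ w, F w := by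
  rw [Measure.integral_comp_smul volume (fun w => F (w - c)) u,
    integral_sub_right_eq_self (fun w => F w) c, finrank_euclideanSpace, Fintype.card_fin,
    abs_of_pos (by positivity), smul_eq_mul]

theorem integrable_comp_smul_sub {u : ℝ} (hu : 0 < u) {F : E n → ℝ} (hF : Integrable F)
    (c : E n) : Integrable fun x => F (u • x - c) :=
  (hF.comp_sub_right c).comp_smul hu.ne'

end Gaussian

/-! ### Gaussian smoothing of a measure -/

section Smoothing

variable {n : ℕ}

/-- The average of the standard Gaussian density over the points `z.1 - z.2 • y`. -/
def smoothed (p : Measure (E n)) (z : E n × ℝ) : ℝ := ∫ y, stdDensity (z.1 - z.2 • y) ∂p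

/-- The linear map `(x, s) ↦ x - s • y`, through which `smoothed` depends on its argument. -/
def shear (y : E n) : E n × ℝ →L[ℝ] E n :=
  ContinuousLinearMap.fst ℝ (E n) ℝ - (ContinuousLinearMap.snd ℝ (E n) ℝ).smulRight y

theorem shear_apply (y : E n) (z : E n × ℝ) : shear y z = z.1 - z.2 • y := rfl

theorem norm_shear_le (y : E n) : ‖shear y‖ ≤ 1 + ‖y‖ := by
  refine ContinuousLinearMap.opNorm_le_bound _ (by positivity) fun z => ?_
  rw [shear_apply, add_mul, one_mul]
  refine (norm_sub_le _ _).trans (add_le_add (norm_fst_le z) ?_)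
  rw [norm_smul, mul_comm]
  exact mul_le_mul_of_nonneg_left (norm_snd_le z) (norm_nonneg _)

theorem norm_iteratedFDeriv_comp_clm_le {V W G : Type*} [NormedAddCommGroup V] [NormedSpace ℝ V]
    [NormedAddCommGroup W] [NormedSpace ℝ W] [NormedAddCommGroup G] [NormedSpace ℝ G]
    (g : V →L[ℝ] W) {f : W → G} (hf : ContDiff ℝ (⊤ : ℕ∞) f) (i : ℕ) (z : V) :
    ‖iteratedFDeriv ℝ i (f ∘ g) z‖ ≤ ‖iteratedFDeriv ℝ i f (g z)‖ * ‖g‖ ^ i := by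
  rw [g.iteratedFDeriv_comp_right hf z (by exact_mod_cast le_top)]
  refine (ContinuousMultilinearMap.norm_compContinuousLinearMap_le _ _).trans ?_
  simp

theorem contDiff_uncurry_stdDensity_shear :
    ContDiff ℝ (⊤ : ℕ∞) (Function.uncurry fun (y : E n) (z : E n × ℝ) =>
      stdDensity (z.1 - z.2 • y)) := by
  refine contDiff_stdDensity.comp ?_
  exact (contDiff_fst.comp contDiff_snd).sub ((contDiff_snd.comp contDiff_snd).smul contDiff_fst)

theorem exists_norm_iteratedFDeriv_stdDensity_shear_le (i : ℕ) :
    ∃ C, ∀ (y : E n) (z : E n × ℝ),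
    ‖iteratedFDeriv ℝ i (fun z : E n × ℝ => stdDensity (z.1 - z.2 • y)) z‖ ≤
      C * (1 + ‖y‖) ^ i := by
  obtain ⟨C, hC⟩ := exists_norm_iteratedFDeriv_stdDensity_le (n := n) i
  refine ⟨C, fun y z => ?_⟩
  refine (norm_iteratedFDeriv_comp_clm_le (shear y) contDiff_stdDensity i z).trans ?_
  exact mul_le_mul (hC _) (pow_le_pow_left₀ (norm_nonneg _) (norm_shear_le y) i)
    (by positivity) ((norm_nonneg _).trans (hC 0))

variable {p : Measure (E n)} [IsFiniteMeasure p]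

theorem integrable_one_add_norm_pow (hp : Integrable (fun y => ‖y‖ ^ 2) p) {i : ℕ} (hi : i ≤ 2) :
    Integrable (fun y : E n => (1 + ‖y‖) ^ i) p := by
  refine (((integrable_const (1 : ℝ)).add hp).const_mul 2).mono' (by fun_prop)
    (Eventually.of_forall fun y => ?_)
  rw [Real.norm_of_nonneg (by positivity)]
  calc (1 + ‖y‖) ^ i ≤ (1 + ‖y‖) ^ 2 := pow_le_pow_right₀ (by linarith [norm_nonneg y]) hi
    _ ≤ 2 * (1 + ‖y‖ ^ 2) := by nlinarith [sq_nonneg (‖y‖ - 1)]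

theorem contDiff_smoothed (hp : Integrable (fun y => ‖y‖ ^ 2) p) : ContDiff ℝ 2 (smoothed p) := by
  choose C hC using exists_norm_iteratedFDeriv_stdDensity_shear_le (n := n)
  exact contDiff_integral_of_dominated 2 (B := fun i y => C i * (1 + ‖y‖) ^ i)
    (contDiff_infty.1 contDiff_uncurry_stdDensity_shear 2)
    (fun i hi => (integrable_one_add_norm_pow hp hi).const_mul _) fun i _ y z => hC i y z

theorem fderiv_stdDensity_shear (y : E n) (z : E n × ℝ) :
    fderiv ℝ (fun z : E n × ℝ => stdDensity (z.1 - z.2 • y)) z =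
      (fderiv ℝ stdDensity (z.1 - z.2 • y)).comp (shear y) :=
  ((contDiff_stdDensity.differentiable (by simp) _).hasFDerivAt.comp z
    (shear y).hasFDerivAt).fderiv

theorem exists_norm_fderiv_stdDensity_shear_le : ∃ C, ∀ (y : E n) (z : E n × ℝ),
    ‖fderiv ℝ (fun z : E n × ℝ => stdDensity (z.1 - z.2 • y)) z‖ ≤ C * (1 + ‖y‖) := by
  obtain ⟨C, hC⟩ := exists_norm_iteratedFDeriv_stdDensity_shear_le (n := n) 1
  exact ⟨C, fun y z => by simpa only [norm_iteratedFDeriv_one, pow_one] using hC y z⟩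

theorem integrable_stdDensity_shear (z : E n × ℝ) :
    Integrable (fun y => stdDensity (z.1 - z.2 • y)) p := by
  obtain ⟨C, hC⟩ := exists_norm_iteratedFDeriv_stdDensity_shear_le (n := n) 0
  refine (integrable_const C).mono' ?_ (Eventually.of_forall fun y => by simpa using hC y z)
  exact (continuous_stdDensity.comp (by fun_prop)).aestronglyMeasurable

theorem integrable_fderiv_stdDensity_shear (hp : Integrable (fun y => ‖y‖ ^ 2) p)
    (z : E n × ℝ) : Integrable
      (fun y => fderiv ℝ (fun z : E n × ℝ => stdDensity (z.1 - z.2 • y)) z) p := by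
  obtain ⟨C, hC⟩ := exists_norm_fderiv_stdDensity_shear_le (n := n)
  refine ((integrable_one_add_norm_pow hp one_le_two).const_mul C).mono' ?_
    (Eventually.of_forall fun y => by simpa using hC y z)
  have hcont : ContDiff ℝ 0 fun y : E n =>
      fderiv ℝ (fun z : E n × ℝ => stdDensity (z.1 - z.2 • y)) z :=
    ContDiff.fderiv (m := (⊤ : ℕ∞)) contDiff_uncurry_stdDensity_shear contDiff_const (by simp)
  exact hcont.continuous.aestronglyMeasurable

theorem fderiv_smoothed_apply (hp : Integrable (fun y => ‖y‖ ^ 2) p) (z z' : E n × ℝ) :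
    fderiv ℝ (smoothed p) z z' =
      ∫ y, -(stdDensity (z.1 - z.2 • y) * inner ℝ (z.1 - z.2 • y) (z'.1 - z'.2 • y)) ∂p := by
  obtain ⟨C, hC⟩ := exists_norm_fderiv_stdDensity_shear_le (n := n)
  obtain ⟨C₀, hC₀⟩ := exists_norm_iteratedFDeriv_stdDensity_shear_le (n := n) 0
  have hderiv := hasFDerivAt_integral_of_contDiff (μ := p)
    (h := fun (y : E n) (z : E n × ℝ) => stdDensity (z.1 - z.2 • y))
    (contDiff_uncurry_stdDensity_shear.of_le (by exact_mod_cast le_top))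
    (integrable_const C₀)
    ((integrable_one_add_norm_pow hp one_le_two).const_mul C)
    (fun y z => by simpa using hC₀ y z) (fun y z => by simpa using hC y z) z
  change fderiv ℝ (fun z => ∫ y, stdDensity (z.1 - z.2 • y) ∂p) z z' = _
  rw [hderiv.fderiv, ContinuousLinearMap.integral_apply (integrable_fderiv_stdDensity_shear hp z)]
  refine integral_congr_ae (Eventually.of_forall fun y => ?_)
  simp only [fderiv_stdDensity_shear, ContinuousLinearMap.comp_apply, fderiv_stdDensity_apply,
    shear_apply]

theorem integrable_stdDensity_mul_inner_shear (hp : Integrable (fun y => ‖y‖ ^ 2) p)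
    (z z' : E n × ℝ) : Integrable (fun y =>
      -(stdDensity (z.1 - z.2 • y) * inner ℝ (z.1 - z.2 • y) (z'.1 - z'.2 • y))) p := by
  simpa only [fderiv_stdDensity_shear, ContinuousLinearMap.comp_apply, fderiv_stdDensity_apply,
    shear_apply] using (integrable_fderiv_stdDensity_shear hp z).apply_continuousLinearMap z'

theorem smoothed_pos [NeZero p] (z : E n × ℝ) : 0 < smoothed p z := by
  refine (integral_pos_iff_support_of_nonneg (fun y => (stdDensity_pos _).le)
    (integrable_stdDensity_shear z)).2 ?_
  rw [show Function.support (fun y => stdDensity (z.1 - z.2 • y)) = univ from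
    eq_univ_of_forall fun y => (stdDensity_pos _).ne', Measure.measure_univ_pos]
  exact NeZero.ne p

theorem integrable_prod_of_integral_norm_le {V W : Type*} [MeasurableSpace V] [MeasurableSpace W]
    {μ : Measure V} {ν : Measure W} [SFinite μ] [SFinite ν] {f : V × W → ℝ}
    (hf : AEStronglyMeasurable f (μ.prod ν)) (hi : ∀ y, Integrable (fun x => f (x, y)) μ)
    {B : W → ℝ} (hB : Integrable B ν) (hb : ∀ y, ∫ x, ‖f (x, y)‖ ∂μ ≤ B y) :
    Integrable f (μ.prod ν) := by
  refine (integrable_prod_iff' hf).2 ⟨Eventually.of_forall hi, hB.mono'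
    hf.norm.prod_swap.integral_prod_right' (Eventually.of_forall fun y => ?_)⟩
  rw [Real.norm_of_nonneg (integral_nonneg fun _ => norm_nonneg _)]
  exact hb y

theorem integrable_prod_comp_smul_sub (hp : Integrable (fun y => ‖y‖ ^ 2) p) {u : ℝ} (hu : 0 < u)
    (v : ℝ) {F : E n → E n → ℝ} (hF : Continuous (Function.uncurry F))
    (hi : ∀ y, Integrable fun w => F w y) {C : ℝ} (hC : ∀ y, ∫ w, ‖F w y‖ ≤ C * (1 + ‖y‖)) :
    Integrable (fun z : E n × E n => F (u • z.1 - v • z.2) z.2) (volume.prod p) := by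
  have hcont : Continuous fun z : E n × E n => F (u • z.1 - v • z.2) z.2 :=
    hF.comp (by fun_prop : Continuous fun z : E n × E n => (u • z.1 - v • z.2, z.2))
  refine integrable_prod_of_integral_norm_le hcont.aestronglyMeasurable
    (fun y => integrable_comp_smul_sub hu (hi y) (v • y))
    ((integrable_one_add_norm_pow hp one_le_two).const_mul ((u ^ n)⁻¹ * C)) fun y => ?_
  calc ∫ x, ‖F (u • x - v • y) y‖ = (u ^ n)⁻¹ * ∫ w, ‖F w y‖ :=
        integral_comp_smul_sub hu (fun w => ‖F w y‖) (v • y)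
    _ ≤ (u ^ n)⁻¹ * (C * (1 + ‖y‖)) := mul_le_mul_of_nonneg_left (hC y) (by positivity)
    _ = (u ^ n)⁻¹ * C * (1 + ‖y‖) ^ 1 := by ring

theorem contDiff_smoothed_left (u v : ℝ) :
    ContDiff ℝ (⊤ : ℕ∞) fun x : E n => smoothed p (u • x, v) := by
  choose C hC using exists_norm_iteratedFDeriv_stdDensity_le (n := n)
  refine contDiff_infty.2 fun k => ?_
  refine contDiff_integral_of_dominated k (h := fun (y x : E n) => stdDensity (u • x - v • y))
    (B := fun i _ => C i * ‖u • ContinuousLinearMap.id ℝ (E n)‖ ^ i) ?_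
    (fun i _ => integrable_const _) fun i _ y x => ?_
  · refine (contDiff_stdDensity.of_le (by exact_mod_cast le_top)).comp ?_
    exact (contDiff_snd.const_smul u).sub (contDiff_fst.const_smul v)
  · have hsmooth : ContDiff ℝ (⊤ : ℕ∞) fun w : E n => stdDensity (w - v • y) :=
      contDiff_stdDensity.comp (contDiff_id.sub contDiff_const)
    refine (norm_iteratedFDeriv_comp_clm_le (u • ContinuousLinearMap.id ℝ (E n)) hsmooth i x).trans
      ?_
    rw [iteratedFDeriv_comp_sub]
    gcongr
    exact hC i _

/-- The logarithm of `smoothed`. -/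
def logSmoothed (p : Measure (E n)) (z : E n × ℝ) : ℝ := Real.log (smoothed p z)

theorem contDiff_logSmoothed [NeZero p] (hp : Integrable (fun y => ‖y‖ ^ 2) p) :
    ContDiff ℝ 2 (logSmoothed p) :=
  (contDiff_smoothed hp).log fun z => (smoothed_pos z).ne'

theorem fderiv_logSmoothed [NeZero p] (hp : Integrable (fun y => ‖y‖ ^ 2) p) (z : E n × ℝ) :
    fderiv ℝ (logSmoothed p) z = (smoothed p z)⁻¹ • fderiv ℝ (smoothed p) z :=
  (((contDiff_smoothed hp).differentiable two_ne_zero z).hasFDerivAt.log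
    (smoothed_pos z).ne').fderiv

end Smoothing

/-! ### The marginal homotopy as a rescaled Gaussian smoothing -/

theorem norm_smul_sub_smul_sq {V : Type*} [NormedAddCommGroup V] [InnerProductSpace ℝ V] (a b : ℝ)
    (x y : V) : ‖a • x - b • y‖ ^ 2 =
      a ^ 2 * ‖x‖ ^ 2 - 2 * (a * b) * inner ℝ x y + b ^ 2 * ‖y‖ ^ 2 := by
  rw [norm_sub_sq_real, norm_smul, norm_smul, real_inner_smul_left, real_inner_smul_right, mul_pow,
    mul_pow, Real.norm_eq_abs, Real.norm_eq_abs, sq_abs, sq_abs]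
  ring

theorem log_gaussianDensity {n : ℕ} {s : ℝ} (hs : s ≠ 0) (m x : E n) :
    Real.log (gaussianDensity m s x) =
      Real.log ((2 * Real.pi * s ^ 2) ^ (-(n : ℝ) / 2)) - ‖x - m‖ ^ 2 / (2 * s ^ 2) := by
  rw [gaussianDensity, Real.log_mul (by positivity) (Real.exp_pos _).ne', Real.log_exp]
  ring

namespace Params

variable {n : ℕ} (P : Params n)

/-- The precision of the conditional homotopy. -/
def precision (t : ℝ) : ℝ := P.α t / P.ω ^ 2 + P.β t / P.ν ^ 2

/-- The inverse standard deviation of the conditional homotopy; `ρ̄(x, t)` is a multiple of the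
smoothed density at `(scale t • x, shift t)`. -/
def scale (t : ℝ) : ℝ := √(P.precision t)

/-- The coefficient of the data point in the standardized variable. -/
def shift (t : ℝ) : ℝ := P.β t / P.ν ^ 2 / P.scale t

/-- The derivative of `scale`. -/
def scaleDeriv (t : ℝ) : ℝ :=
  (derivWithin P.α (Icc 0 1) t / P.ω ^ 2 + derivWithin P.β (Icc 0 1) t / P.ν ^ 2) /
    (2 * P.scale t)

/-- The derivative of `shift`. -/
def shiftDeriv (t : ℝ) : ℝ :=
  derivWithin P.β (Icc 0 1) t / P.ν ^ 2 / P.scale t - P.shift t * P.scaleDeriv t / P.scale t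

/-- The derivative in time of `log ρ̄(x, t)`, in terms of `logSmoothed`. -/
def logDensityRate (x : E n) (t : ℝ) : ℝ :=
  n * P.scaleDeriv t / P.scale t +
    fderiv ℝ (logSmoothed P.pdata) (P.scale t • x, P.shift t)
      (P.scaleDeriv t • x, P.shiftDeriv t)

/-- The score `∇ₓ log ρ̄(x, t)`, as a linear functional and in terms of `logSmoothed`. -/
def score (x : E n) (t : ℝ) : E n →L[ℝ] ℝ :=
  (fderiv ℝ (logSmoothed P.pdata) (P.scale t • x, P.shift t)).comp
    (P.scale t • ContinuousLinearMap.inl ℝ (E n) ℝ)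

theorem score_apply (x η : E n) (t : ℝ) : P.score x t η =
    fderiv ℝ (logSmoothed P.pdata) (P.scale t • x, P.shift t) (P.scale t • η, 0) := by
  rw [score, ContinuousLinearMap.comp_apply]
  simp only [smul_apply, ContinuousLinearMap.inl_apply, Prod.smul_mk, smul_zero]

namespace Valid

variable {P} (hP : P.Valid)
include hP

theorem precision_pos {t : ℝ} (ht : t ∈ Icc (0 : ℝ) 1) : 0 < P.precision t := by
  have hβ := hP.β_nonneg t ht
  have hω := hP.ω_pos
  have hν := hP.ν_pos
  unfold precision
  rcases (hP.α_nonneg t ht).eq_or_lt with hα | hα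
  · have hβ_pos : 0 < P.β t := by linarith [hP.sum_pos t ht]
    positivity
  · positivity

theorem scale_pos {t : ℝ} (ht : t ∈ Icc (0 : ℝ) 1) : 0 < P.scale t :=
  Real.sqrt_pos.2 (hP.precision_pos ht)

theorem scale_sq {t : ℝ} (ht : t ∈ Icc (0 : ℝ) 1) :
    P.scale t ^ 2 = P.α t / P.ω ^ 2 + P.β t / P.ν ^ 2 :=
  Real.sq_sqrt (hP.precision_pos ht).le

theorem scale_mul_shift {t : ℝ} (ht : t ∈ Icc (0 : ℝ) 1) :
    P.scale t * P.shift t = P.β t / P.ν ^ 2 :=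
  mul_div_cancel₀ _ (hP.scale_pos ht).ne'

theorem scale_mul_scaleDeriv {t : ℝ} (ht : t ∈ Icc (0 : ℝ) 1) :
    2 * P.scale t * P.scaleDeriv t =
      derivWithin P.α (Icc 0 1) t / P.ω ^ 2 + derivWithin P.β (Icc 0 1) t / P.ν ^ 2 := by
  have := hP.scale_pos ht
  exact mul_div_cancel₀ _ (by positivity)

theorem scale_mul_shiftDeriv {t : ℝ} (ht : t ∈ Icc (0 : ℝ) 1) :
    P.scale t * P.shiftDeriv t + P.shift t * P.scaleDeriv t =
      derivWithin P.β (Icc 0 1) t / P.ν ^ 2 := by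
  have := hP.scale_pos ht
  unfold shiftDeriv
  field_simp
  ring

theorem hasDerivWithinAt_scale {t : ℝ} (ht : t ∈ Icc (0 : ℝ) 1) :
    HasDerivWithinAt P.scale (P.scaleDeriv t) (Icc 0 1) t := by
  have hα := (hP.α_smooth.differentiableOn one_ne_zero t ht).hasDerivWithinAt
  have hβ := (hP.β_smooth.differentiableOn one_ne_zero t ht).hasDerivWithinAt
  exact ((hα.div_const _).add (hβ.div_const _)).sqrt (hP.precision_pos ht).ne'

theorem hasDerivWithinAt_shift {t : ℝ} (ht : t ∈ Icc (0 : ℝ) 1) :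
    HasDerivWithinAt P.shift (P.shiftDeriv t) (Icc 0 1) t := by
  have hβ := (hP.β_smooth.differentiableOn one_ne_zero t ht).hasDerivWithinAt
  have hs := hP.scale_pos ht
  refine ((hβ.div_const _).div (hP.hasDerivWithinAt_scale ht) hs.ne').congr_deriv ?_
  rw [shiftDeriv, shift]
  field_simp

theorem continuousOn_scale : ContinuousOn P.scale (Icc 0 1) :=
  fun _ ht => (hP.hasDerivWithinAt_scale ht).continuousWithinAt

theorem continuousOn_shift : ContinuousOn P.shift (Icc 0 1) :=
  fun _ ht => (hP.hasDerivWithinAt_shift ht).continuousWithinAt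

theorem continuousOn_scaleDeriv : ContinuousOn P.scaleDeriv (Icc 0 1) := by
  have hα := hP.α_smooth.continuousOn_derivWithin (uniqueDiffOn_Icc zero_lt_one) le_rfl
  have hβ := hP.β_smooth.continuousOn_derivWithin (uniqueDiffOn_Icc zero_lt_one) le_rfl
  refine ((hα.div_const _).add (hβ.div_const _)).div
    (continuousOn_const.mul hP.continuousOn_scale) fun t ht => ?_
  have := hP.scale_pos ht
  positivity

theorem continuousOn_shiftDeriv : ContinuousOn P.shiftDeriv (Icc 0 1) := by
  have hβ := hP.β_smooth.continuousOn_derivWithin (uniqueDiffOn_Icc zero_lt_one) le_rfl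
  have hscale : ∀ t ∈ Icc (0 : ℝ) 1, P.scale t ≠ 0 := fun t ht => (hP.scale_pos ht).ne'
  exact ((hβ.div_const _).div hP.continuousOn_scale hscale).sub
    ((hP.continuousOn_shift.mul hP.continuousOn_scaleDeriv).div hP.continuousOn_scale hscale)

theorem exists_exp_logHomotopy_eq {t : ℝ} (ht : t ∈ Icc (0 : ℝ) 1) (y : E n) : ∃ K > 0, ∀ x,
    Real.exp (P.logHomotopy x y t) = K * stdDensity (P.scale t • x - P.shift t • y) := by
  have hω := hP.ω_pos
  have hν := hP.ν_pos
  have hc : (0 : ℝ) < (2 * Real.pi) ^ (-(n : ℝ) / 2) := by positivity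
  refine ⟨((2 * Real.pi) ^ (-(n : ℝ) / 2))⁻¹ *
    Real.exp (P.α t * Real.log ((2 * Real.pi * P.ω ^ 2) ^ (-(n : ℝ) / 2)) +
      P.β t * Real.log ((2 * Real.pi * P.ν ^ 2) ^ (-(n : ℝ) / 2)) -
      P.β t / P.ν ^ 2 * ‖y‖ ^ 2 / 2 + P.shift t ^ 2 * ‖y‖ ^ 2 / 2), by positivity, fun x => ?_⟩
  rw [stdDensity, mul_assoc, mul_left_comm (Real.exp _), inv_mul_cancel_left₀ hc.ne',
    ← Real.exp_add]
  congr 1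
  rw [logHomotopy, log_gaussianDensity hω.ne', log_gaussianDensity hν.ne', sub_zero,
    norm_smul_sub_smul_sq, hP.scale_sq ht, hP.scale_mul_shift ht, norm_sub_rev, norm_sub_sq_real]
  field_simp
  ring

theorem condDensity_eq {t : ℝ} (ht : t ∈ Icc (0 : ℝ) 1) (x y : E n) :
    P.condDensity x y t = P.scale t ^ n * stdDensity (P.scale t • x - P.shift t • y) := by
  obtain ⟨K, hK, hexp⟩ := hP.exists_exp_logHomotopy_eq ht y
  have hs := hP.scale_pos ht
  have hnormalization : ∫ x', Real.exp (P.logHomotopy x' y t) = K * (P.scale t ^ n)⁻¹ := by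
    simp_rw [hexp]
    rw [integral_const_mul, integral_comp_smul_sub hs stdDensity, integral_stdDensity, mul_one]
  rw [condDensity, hexp, hnormalization]
  field_simp

theorem marginalDensity_eq {t : ℝ} (ht : t ∈ Icc (0 : ℝ) 1) (x : E n) :
    P.marginalDensity x t = P.scale t ^ n * smoothed P.pdata (P.scale t • x, P.shift t) := by
  simp_rw [marginalDensity, hP.condDensity_eq ht]
  rw [integral_const_mul, smoothed]

theorem marginalDensity_pos {t : ℝ} (ht : t ∈ Icc (0 : ℝ) 1) (x : E n) :
    0 < P.marginalDensity x t := by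
  have := hP.prob
  rw [hP.marginalDensity_eq ht]
  exact mul_pos (pow_pos (hP.scale_pos ht) n) (smoothed_pos _)

theorem contDiff_marginalDensity {t : ℝ} (ht : t ∈ Icc (0 : ℝ) 1) :
    ContDiff ℝ (⊤ : ℕ∞) fun x => P.marginalDensity x t := by
  have := hP.prob
  simp_rw [hP.marginalDensity_eq ht]
  exact contDiff_const.mul (contDiff_smoothed_left _ _)

theorem integral_condDensity_mul_quadratic {t : ℝ} (ht : t ∈ Icc (0 : ℝ) 1) (a b c : ℝ)
    (y : E n) :
    ∫ x, P.condDensity x y t * (a * ‖P.scale t • x - P.shift t • y‖ ^ 2 +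
      b * inner ℝ (P.scale t • x - P.shift t • y) y + c) = a * n + c := by
  have hs := (pow_pos (hP.scale_pos ht) n).ne'
  simp_rw [hP.condDensity_eq ht, mul_assoc, mul_comm (stdDensity _)]
  rw [integral_const_mul, integral_comp_smul_sub (hP.scale_pos ht)
    (fun w : E n => (a * ‖w‖ ^ 2 + b * inner ℝ w y + c) * stdDensity w),
    integral_quadratic_mul_stdDensity, mul_inv_cancel_left₀ hs]

theorem integrable_prod_condDensity_mul_quadratic {t : ℝ} (ht : t ∈ Icc (0 : ℝ) 1) (a b c : ℝ) :
    Integrable (fun z : E n × E n => P.condDensity z.1 z.2 t *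
      (a * ‖P.scale t • z.1 - P.shift t • z.2‖ ^ 2 +
        b * inner ℝ (P.scale t • z.1 - P.shift t • z.2) z.2 + c)) (volume.prod P.pdata) := by
  have := hP.prob
  simp_rw [hP.condDensity_eq ht, mul_assoc, mul_comm (stdDensity _)]
  obtain ⟨C, hC⟩ := exists_integral_norm_quadratic_mul_stdDensity_le (n := n) a b c
  have hdensity : Continuous fun z : E n × E n => stdDensity z.1 :=
    continuous_stdDensity.comp continuous_fst
  exact (integrable_prod_comp_smul_sub hP.moment (hP.scale_pos ht) (P.shift t)
    (F := fun w y => (a * ‖w‖ ^ 2 + b * inner ℝ w y + c) * stdDensity w)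
    (by unfold Function.uncurry; fun_prop)
    (integrable_quadratic_mul_stdDensity a b c) hC).const_mul _

theorem integrable_marginalDensity {t : ℝ} (ht : t ∈ Icc (0 : ℝ) 1) :
    Integrable fun x => P.marginalDensity x t := by
  have := hP.prob
  simpa [marginalDensity] using
    (hP.integrable_prod_condDensity_mul_quadratic ht 0 0 1).integral_prod_left

theorem integral_marginalDensity {t : ℝ} (ht : t ∈ Icc (0 : ℝ) 1) :
    ∫ x, P.marginalDensity x t = 1 := by
  have := hP.prob
  have hcond : ∀ y, ∫ x, P.condDensity x y t = 1 := fun y => by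
    simpa using hP.integral_condDensity_mul_quadratic ht 0 0 1 y
  have hswap := integral_integral_swap (f := fun x y => P.condDensity x y t) (by
    simpa [Function.uncurry_def] using hP.integrable_prod_condDensity_mul_quadratic ht 0 0 1)
  simpa [marginalDensity, hcond] using hswap

theorem isProbabilityMeasure_marginalLaw {t : ℝ} (ht : t ∈ Icc (0 : ℝ) 1) :
    IsProbabilityMeasure (P.marginalLaw t) := by
  constructor
  rw [marginalLaw, withDensity_apply _ MeasurableSet.univ, Measure.restrict_univ,
    ← ofReal_integral_eq_lintegral_ofReal (hP.integrable_marginalDensity ht)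
      (Eventually.of_forall fun x => (hP.marginalDensity_pos ht x).le),
    hP.integral_marginalDensity ht, ENNReal.ofReal_one]

/-! ### The source term is minus the time derivative -/

/- The innovation is the time derivative of `α / ω² * ‖x‖² + β / ν² * ‖x - y‖²`, which equals
`‖scale • x - shift • y‖²` plus a multiple of `‖y‖²` by completing the square. -/
theorem innovation_eq {t : ℝ} (ht : t ∈ Icc (0 : ℝ) 1) (x y : E n) :
    P.innovation x y t =
      2 * inner ℝ (P.scale t • x - P.shift t • y) (P.scaleDeriv t • x - P.shiftDeriv t • y) +
        (derivWithin P.β (Icc 0 1) t / P.ν ^ 2 - 2 * P.shift t * P.shiftDeriv t) * ‖y‖ ^ 2 := by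
  have hx : derivWithin P.α (Icc 0 1) t / P.ω ^ 2 = 2 * P.scale t * P.scaleDeriv t -
      derivWithin P.β (Icc 0 1) t / P.ν ^ 2 := by
    rw [hP.scale_mul_scaleDeriv ht]
    ring
  rw [innovation, hx, ← hP.scale_mul_shiftDeriv ht, norm_sub_sq_real]
  simp only [inner_sub_left, inner_sub_right, real_inner_smul_left, real_inner_smul_right,
    real_inner_self_eq_norm_sq, real_inner_comm x y]
  ring

theorem inner_standardized_deriv_eq {t : ℝ} (ht : t ∈ Icc (0 : ℝ) 1) (x y : E n) :
    inner ℝ (P.scale t • x - P.shift t • y) (P.scaleDeriv t • x - P.shiftDeriv t • y) =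
      P.scaleDeriv t / P.scale t * ‖P.scale t • x - P.shift t • y‖ ^ 2 +
        (P.scaleDeriv t * P.shift t / P.scale t - P.shiftDeriv t) *
          inner ℝ (P.scale t • x - P.shift t • y) y := by
  have hs := (hP.scale_pos ht).ne'
  have hvelocity : P.scaleDeriv t • x - P.shiftDeriv t • y =
      (P.scaleDeriv t / P.scale t) • (P.scale t • x - P.shift t • y) +
        (P.scaleDeriv t * P.shift t / P.scale t - P.shiftDeriv t) • y := by
    match_scalars <;> field_simp
    ring
  rw [hvelocity, inner_add_right, real_inner_smul_right, real_inner_smul_right,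
    real_inner_self_eq_norm_sq]

theorem meanInnovation_eq {t : ℝ} (ht : t ∈ Icc (0 : ℝ) 1) (y : E n) :
    P.meanInnovation y t = 2 * (n * P.scaleDeriv t / P.scale t) +
      (derivWithin P.β (Icc 0 1) t / P.ν ^ 2 - 2 * P.shift t * P.shiftDeriv t) * ‖y‖ ^ 2 := by
  simp_rw [meanInnovation, hP.innovation_eq ht, hP.inner_standardized_deriv_eq ht, mul_add,
    ← mul_assoc (2 : ℝ)]
  simp_rw [← mul_add]
  rw [hP.integral_condDensity_mul_quadratic ht]
  ring

theorem innovation_sub_meanInnovation {t : ℝ} (ht : t ∈ Icc (0 : ℝ) 1) (x y : E n) :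
    P.innovation x y t - P.meanInnovation y t = -2 * (n * P.scaleDeriv t / P.scale t -
      inner ℝ (P.scale t • x - P.shift t • y) (P.scaleDeriv t • x - P.shiftDeriv t • y)) := by
  rw [hP.innovation_eq ht, hP.meanInnovation_eq ht]
  ring

theorem innovation_sub_meanInnovation_eq_quadratic {t : ℝ} (ht : t ∈ Icc (0 : ℝ) 1) (x y : E n) :
    P.innovation x y t - P.meanInnovation y t =
      2 * (P.scaleDeriv t / P.scale t) * ‖P.scale t • x - P.shift t • y‖ ^ 2 +
        2 * (P.scaleDeriv t * P.shift t / P.scale t - P.shiftDeriv t) *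
          inner ℝ (P.scale t • x - P.shift t • y) y +
        -(2 * (P.scaleDeriv t / P.scale t) * n) := by
  rw [hP.innovation_sub_meanInnovation ht, hP.inner_standardized_deriv_eq ht]
  ring

theorem integrable_source {t : ℝ} (ht : t ∈ Icc (0 : ℝ) 1) :
    Integrable fun x => P.source x t := by
  have := hP.prob
  simp_rw [source, hP.innovation_sub_meanInnovation_eq_quadratic ht]
  exact (hP.integrable_prod_condDensity_mul_quadratic ht _ _ _).integral_prod_left.const_mul _

theorem integral_source {t : ℝ} (ht : t ∈ Icc (0 : ℝ) 1) : ∫ x, P.source x t = 0 := by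
  have := hP.prob
  simp_rw [source, hP.innovation_sub_meanInnovation_eq_quadratic ht]
  rw [integral_const_mul, integral_integral_swap
    (hP.integrable_prod_condDensity_mul_quadratic ht _ _ _)]
  simp_rw [hP.integral_condDensity_mul_quadratic ht]
  simp

theorem source_eq {t : ℝ} (ht : t ∈ Icc (0 : ℝ) 1) (x : E n) :
    P.source x t = -(P.marginalDensity x t * P.logDensityRate x t) := by
  have := hP.prob
  have hsmoothed := (smoothed_pos (p := P.pdata) (P.scale t • x, P.shift t)).ne'
  have hintegrand : ∀ y, P.condDensity x y t * (P.innovation x y t - P.meanInnovation y t) =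
      -2 * P.scale t ^ n * (n * P.scaleDeriv t / P.scale t *
        stdDensity (P.scale t • x - P.shift t • y) +
        -(stdDensity (P.scale t • x - P.shift t • y) * inner ℝ (P.scale t • x - P.shift t • y)
          (P.scaleDeriv t • x - P.shiftDeriv t • y))) := fun y => by
    rw [hP.condDensity_eq ht, hP.innovation_sub_meanInnovation ht]
    ring
  have hintegral : ∫ y, (n * P.scaleDeriv t / P.scale t *
        stdDensity (P.scale t • x - P.shift t • y) +
        -(stdDensity (P.scale t • x - P.shift t • y) * inner ℝ (P.scale t • x - P.shift t • y)
          (P.scaleDeriv t • x - P.shiftDeriv t • y))) ∂P.pdata =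
      n * P.scaleDeriv t / P.scale t * smoothed P.pdata (P.scale t • x, P.shift t) +
        fderiv ℝ (smoothed P.pdata) (P.scale t • x, P.shift t)
          (P.scaleDeriv t • x, P.shiftDeriv t) := by
    rw [integral_add ((integrable_stdDensity_shear (P.scale t • x, P.shift t)).const_mul _)
      (integrable_stdDensity_mul_inner_shear hP.moment (P.scale t • x, P.shift t)
        (P.scaleDeriv t • x, P.shiftDeriv t)), integral_const_mul,
      fderiv_smoothed_apply hP.moment, smoothed]
  simp_rw [source, hintegrand]
  rw [integral_const_mul, hintegral, logDensityRate, hP.marginalDensity_eq ht,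
    fderiv_logSmoothed hP.moment, smul_apply, smul_eq_mul]
  field_simp

end Valid

end Params

/-! ### Derivatives of the logarithm of the marginal density -/

theorem hasFDerivAt_smul_prodMk_const {V W : Type*} [NormedAddCommGroup V] [NormedSpace ℝ V]
    [NormedAddCommGroup W] [NormedSpace ℝ W] (a : ℝ) (c : W) (x : V) :
    HasFDerivAt (fun x : V => (a • x, c)) (a • ContinuousLinearMap.inl ℝ V W) x := by
  refine (((hasFDerivAt_id x).const_smul a).prodMk (hasFDerivAt_const c x)).congr_fderiv ?_
  ext v <;> simp

namespace Params

variable {n : ℕ} {P : Params n}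

/-- The rate of change of the score in the direction `η` along a trajectory passing through `x` at
time `t` with velocity `w`. -/
def scoreDeriv (P : Params n) (x w η : E n) (t : ℝ) : ℝ :=
  fderiv ℝ (fderiv ℝ (logSmoothed P.pdata)) (P.scale t • x, P.shift t)
      (P.scaleDeriv t • x + P.scale t • w, P.shiftDeriv t) (P.scale t • η, 0) +
    fderiv ℝ (logSmoothed P.pdata) (P.scale t • x, P.shift t) (P.scaleDeriv t • η, 0)

namespace Valid

variable (hP : P.Valid)
include hP

theorem log_marginalDensity {t : ℝ} (ht : t ∈ Icc (0 : ℝ) 1) (x : E n) :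
    Real.log (P.marginalDensity x t) =
      n * Real.log (P.scale t) + logSmoothed P.pdata (P.scale t • x, P.shift t) := by
  have := hP.prob
  rw [hP.marginalDensity_eq ht, Real.log_mul (pow_pos (hP.scale_pos ht) n).ne'
    (smoothed_pos _).ne', Real.log_pow, logSmoothed]

theorem hasDerivWithinAt_scale_smul_prodMk_shift {γ : ℝ → E n} {γ' : E n} {t : ℝ}
    (ht : t ∈ Icc (0 : ℝ) 1) (hγ : HasDerivWithinAt γ γ' (Icc 0 1) t) :
    HasDerivWithinAt (fun s => (P.scale s • γ s, P.shift s))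
      (P.scaleDeriv t • γ t + P.scale t • γ', P.shiftDeriv t) (Icc 0 1) t :=
  (((hP.hasDerivWithinAt_scale ht).smul hγ).congr_deriv (add_comm _ _)).prodMk
    (hP.hasDerivWithinAt_shift ht)

theorem hasDerivWithinAt_log_marginalDensity {γ : ℝ → E n} {γ' : E n} {t : ℝ}
    (ht : t ∈ Icc (0 : ℝ) 1) (hγ : HasDerivWithinAt γ γ' (Icc 0 1) t) :
    HasDerivWithinAt (fun s => Real.log (P.marginalDensity (γ s) s))
      (P.score (γ t) t γ' + P.logDensityRate (γ t) t) (Icc 0 1) t := by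
  have := hP.prob
  have hsmoothed := ((contDiff_logSmoothed hP.moment).differentiable two_ne_zero
    (P.scale t • γ t, P.shift t)).hasFDerivAt.comp_hasDerivWithinAt t
    (hP.hasDerivWithinAt_scale_smul_prodMk_shift ht hγ)
  have hscale := ((hP.hasDerivWithinAt_scale ht).log (hP.scale_pos ht).ne').const_mul (n : ℝ)
  refine ((hscale.add hsmoothed).congr_of_mem (fun s hs => ?_) ht).congr_deriv ?_
  · exact hP.log_marginalDensity hs _
  · have hsplit : (P.scaleDeriv t • γ t + P.scale t • γ', P.shiftDeriv t) =
        (P.scale t • γ', (0 : ℝ)) + (P.scaleDeriv t • γ t, P.shiftDeriv t) := by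
      simp [add_comm]
    rw [score_apply, logDensityRate, hsplit, map_add]
    ring

theorem hasDerivWithinAt_marginalDensity {t : ℝ} (ht : t ∈ Icc (0 : ℝ) 1) (x : E n) :
    HasDerivWithinAt (fun s => P.marginalDensity x s) (-P.source x t) (Icc 0 1) t := by
  have hexp := (hP.hasDerivWithinAt_log_marginalDensity ht
    (hasDerivWithinAt_const t (Icc 0 1) x)).exp
  refine (hexp.congr_of_mem (fun s hs => ?_) ht).congr_deriv ?_
  · exact (Real.exp_log (hP.marginalDensity_pos hs x)).symm
  · rw [Real.exp_log (hP.marginalDensity_pos ht x), hP.source_eq ht]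
    simp

theorem hasFDerivAt_log_marginalDensity {t : ℝ} (ht : t ∈ Icc (0 : ℝ) 1) (x : E n) :
    HasFDerivAt (fun x => Real.log (P.marginalDensity x t)) (P.score x t) x := by
  have := hP.prob
  simp_rw [hP.log_marginalDensity ht]
  exact (((contDiff_logSmoothed hP.moment).differentiable two_ne_zero
    (P.scale t • x, P.shift t)).hasFDerivAt.comp x
      (hasFDerivAt_smul_prodMk_const (P.scale t) (P.shift t) x)).const_add _

theorem fderiv_marginalDensity {t : ℝ} (ht : t ∈ Icc (0 : ℝ) 1) (x : E n) :
    fderiv ℝ (fun x => P.marginalDensity x t) x = P.marginalDensity x t • P.score x t := by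
  have hexp := (hP.hasFDerivAt_log_marginalDensity ht x).exp
  simp_rw [Real.exp_log (hP.marginalDensity_pos ht _)] at hexp
  exact hexp.fderiv

theorem contDiff_fderiv_logSmoothed : ContDiff ℝ 1 (fderiv ℝ (logSmoothed P.pdata)) := by
  have := hP.prob
  exact (contDiff_logSmoothed hP.moment).fderiv_right (by norm_num)

theorem contDiff_score (t : ℝ) : ContDiff ℝ 1 fun x => P.score x t := by
  refine ContDiff.clm_comp ?_ contDiff_const
  exact hP.contDiff_fderiv_logSmoothed.comp
    ((contDiff_id.const_smul (P.scale t)).prodMk contDiff_const)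

theorem contDiff_logDensityRate (t : ℝ) : ContDiff ℝ 1 fun x => P.logDensityRate x t := by
  refine contDiff_const.add (ContDiff.clm_apply ?_ ?_)
  · exact hP.contDiff_fderiv_logSmoothed.comp
      ((contDiff_id.const_smul (P.scale t)).prodMk contDiff_const)
  · exact (contDiff_id.const_smul (P.scaleDeriv t)).prodMk contDiff_const

theorem hasDerivWithinAt_score {γ : ℝ → E n} {γ' : E n} {t : ℝ}
    (ht : t ∈ Icc (0 : ℝ) 1) (hγ : HasDerivWithinAt γ γ' (Icc 0 1) t) (η : E n) :
    HasDerivWithinAt (fun s => P.score (γ s) s η) (P.scoreDeriv (γ t) γ' η t) (Icc 0 1) t := by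
  simp_rw [score_apply]
  have hfderiv := (hP.contDiff_fderiv_logSmoothed.differentiable one_ne_zero
    (P.scale t • γ t, P.shift t)).hasFDerivAt.comp_hasDerivWithinAt t
    (hP.hasDerivWithinAt_scale_smul_prodMk_shift ht hγ)
  have hdir : HasDerivWithinAt (fun s => (P.scale s • η, (0 : ℝ))) (P.scaleDeriv t • η, 0)
      (Icc 0 1) t :=
    ((hP.hasDerivWithinAt_scale ht).smul_const η).prodMk (hasDerivWithinAt_const _ _ _)
  exact hfderiv.clm_apply hdir

theorem scoreDeriv_eq (x w η : E n) (t : ℝ) : P.scoreDeriv x w η t =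
    fderiv ℝ (fun x => P.score x t) x w η + fderiv ℝ (fun x => P.logDensityRate x t) x η := by
  have := hP.prob
  have hlog := (hP.contDiff_fderiv_logSmoothed.differentiable one_ne_zero
    (P.scale t • x, P.shift t)).hasFDerivAt.comp x
      (hasFDerivAt_smul_prodMk_const (P.scale t) (P.shift t) x)
  have hscore : HasFDerivAt (fun x => P.score x t) _ x := hlog.clm_comp
    (hasFDerivAt_const (P.scale t • ContinuousLinearMap.inl ℝ (E n) ℝ) x)
  have hrate : HasFDerivAt (fun x => P.logDensityRate x t) _ x :=
    (hlog.clm_apply (hasFDerivAt_smul_prodMk_const (P.scaleDeriv t) (P.shiftDeriv t) x)).const_add _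
  have hsymm := ((contDiff_logSmoothed hP.moment).contDiffAt
    (x := (P.scale t • x, P.shift t))).isSymmSndFDerivAt (by simp)
  have hvelocity : (P.scaleDeriv t • x + P.scale t • w, P.shiftDeriv t) =
      (P.scaleDeriv t • x, P.shiftDeriv t) + P.scale t • (w, (0 : ℝ)) := by simp
  have hdir (c : ℝ) : (c • η, (0 : ℝ)) = c • (η, (0 : ℝ)) := by simp
  rw [hscore.fderiv, hrate.fderiv, scoreDeriv, hvelocity, hdir, hdir, map_add]
  simp only [map_smul, add_apply, smul_apply, ContinuousLinearMap.comp_apply,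
    ContinuousLinearMap.flip_apply, ContinuousLinearMap.compL_apply,
    ContinuousLinearMap.inl_apply, Function.comp_apply, smul_eq_mul,
    ContinuousLinearMap.comp_zero, zero_add]
  rw [hsymm.eq (P.scaleDeriv t • x, P.shiftDeriv t)]
  ring

theorem continuousOn_logDensityRate :
    ContinuousOn (fun z : E n × ℝ => P.logDensityRate z.1 z.2) (univ ×ˢ Icc 0 1) := by
  have hsnd : MapsTo (Prod.snd : E n × ℝ → ℝ) (univ ×ˢ Icc 0 1) (Icc 0 1) := fun z hz => hz.2
  have hscale := hP.continuousOn_scale.comp continuousOn_snd hsnd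
  have hshift := hP.continuousOn_shift.comp continuousOn_snd hsnd
  have hscale' := hP.continuousOn_scaleDeriv.comp continuousOn_snd hsnd
  have hshift' := hP.continuousOn_shiftDeriv.comp continuousOn_snd hsnd
  refine ContinuousOn.add ((continuousOn_const.mul hscale').div hscale fun z hz =>
    (hP.scale_pos hz.2).ne') (ContinuousOn.clm_apply ?_ ?_)
  · exact hP.contDiff_fderiv_logSmoothed.continuous.comp_continuousOn
      ((hscale.smul continuousOn_fst).prodMk hshift)
  · exact (hscale'.smul continuousOn_fst).prodMk hshift'

theorem continuousOn_marginalDensity :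
    ContinuousOn (fun z : E n × ℝ => P.marginalDensity z.1 z.2) (univ ×ˢ Icc 0 1) := by
  have := hP.prob
  have hsnd : MapsTo (Prod.snd : E n × ℝ → ℝ) (univ ×ˢ Icc 0 1) (Icc 0 1) := fun z hz => hz.2
  have hscale := hP.continuousOn_scale.comp continuousOn_snd hsnd
  have hshift := hP.continuousOn_shift.comp continuousOn_snd hsnd
  refine ContinuousOn.congr ((hscale.pow n).mul
    ((contDiff_smoothed hP.moment).continuous.comp_continuousOn
      ((hscale.smul continuousOn_fst).prodMk hshift))) fun z hz => ?_
  exact hP.marginalDensity_eq hz.2 z.1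

theorem continuousOn_source :
    ContinuousOn (fun z : E n × ℝ => P.source z.1 z.2) (univ ×ˢ Icc 0 1) :=
  (hP.continuousOn_marginalDensity.mul hP.continuousOn_logDensityRate).neg.congr
    fun z hz => hP.source_eq hz.2 z.1

theorem continuous_source {t : ℝ} (ht : t ∈ Icc (0 : ℝ) 1) : Continuous fun x => P.source x t :=
  hP.continuousOn_source.comp_continuous (Continuous.prodMk_left t) fun _ => ⟨trivial, ht⟩

theorem continuousOn_scoreDeriv {Y : Type*} [TopologicalSpace Y] {x w η : Y → E n} {τ : Y → ℝ}
    {s : Set Y} (hx : ContinuousOn x s) (hw : ContinuousOn w s) (hη : ContinuousOn η s)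
    (hτ : ContinuousOn τ s) (hs : MapsTo τ s (Icc 0 1)) :
    ContinuousOn (fun y => P.scoreDeriv (x y) (w y) (η y) (τ y)) s := by
  have hscale := hP.continuousOn_scale.comp hτ hs
  have hshift := hP.continuousOn_shift.comp hτ hs
  have hscale' := hP.continuousOn_scaleDeriv.comp hτ hs
  have hshift' := hP.continuousOn_shiftDeriv.comp hτ hs
  have hz := (hscale.smul hx).prodMk hshift
  refine ContinuousOn.add (ContinuousOn.clm_apply (ContinuousOn.clm_apply ?_ ?_) ?_)
    (ContinuousOn.clm_apply ?_ ?_)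
  · exact (hP.contDiff_fderiv_logSmoothed.continuous_fderiv
      one_ne_zero).comp_continuousOn hz
  · exact ((hscale'.smul hx).add (hscale.smul hw)).prodMk hshift'
  · exact (hscale.smul hη).prodMk continuousOn_const
  · exact hP.contDiff_fderiv_logSmoothed.continuous.comp_continuousOn hz
  · exact (hscale'.smul hη).prodMk continuousOn_const

end Valid

end Params

/-! ### The residual of the Poisson equation -/

section Residual

variable {n : ℕ} {P : Params n}

theorem contDiff_gradient {φ : E n → ℝ} (hφ : ContDiff ℝ 2 φ) : ContDiff ℝ 1 (gradient φ) :=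
  (InnerProductSpace.toDual ℝ (E n)).symm.contDiff.comp (hφ.fderiv_right (by norm_num))

/-- The residual of the density-weighted Poisson equation for the velocity field `w`, divided by
the marginal density. -/
def residual (P : Params n) (t : ℝ) (w : E n → E n) (x : E n) : ℝ :=
  divergence w x + P.score x t (w x) + P.logDensityRate x t

theorem continuous_residual (hP : P.Valid) (t : ℝ) {w : E n → E n} (hw : ContDiff ℝ 1 w) :
    Continuous (residual P t w) :=
  ((continuous_divergence hw).add ((hP.contDiff_score t).continuous.clm_apply hw.continuous)).add
    (hP.contDiff_logDensityRate t).continuous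

theorem divergence_marginalDensity_smul (hP : P.Valid) {t : ℝ} (ht : t ∈ Icc (0 : ℝ) 1)
    {w : E n → E n} (hw : Differentiable ℝ w) (x : E n) :
    divergence (fun y => P.marginalDensity y t • w y) x =
      P.marginalDensity x t * (divergence w x + P.score x t (w x)) := by
  rw [divergence_smul ((hP.contDiff_marginalDensity ht).differentiable (by simp) x) (hw x),
    hP.fderiv_marginalDensity ht]
  simp only [smul_apply, smul_eq_mul]
  ring

theorem divergence_marginalDensity_smul_sub_source (hP : P.Valid) {t : ℝ}
    (ht : t ∈ Icc (0 : ℝ) 1) {w : E n → E n} (hw : Differentiable ℝ w) (x : E n) :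
    divergence (fun y => P.marginalDensity y t • w y) x - P.source x t =
      P.marginalDensity x t * residual P t w x := by
  rw [divergence_marginalDensity_smul hP ht hw, hP.source_eq ht, residual]
  ring

theorem solvesPoisson_iff_residual_eq_zero (hP : P.Valid) {t : ℝ} (ht : t ∈ Icc (0 : ℝ) 1)
    {φ : E n → ℝ} (hφ : ContDiff ℝ 2 φ) :
    SolvesPoisson P t φ ↔ ∀ x, residual P t (gradient φ) x = 0 := by
  refine forall_congr' fun x => ?_
  rw [← sub_eq_zero, divergence_marginalDensity_smul_sub_source hP ht
    ((contDiff_gradient hφ).differentiable one_ne_zero), mul_eq_zero]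
  simp [(hP.marginalDensity_pos ht x).ne']

theorem integral_marginalLaw (hP : P.Valid) {t : ℝ} (ht : t ∈ Icc (0 : ℝ) 1) (f : E n → ℝ) :
    ∫ x, f x ∂(P.marginalLaw t) = ∫ x, P.marginalDensity x t * f x :=
  integral_densityLaw volume (hP.contDiff_marginalDensity ht).continuous.measurable
    (fun x => (hP.marginalDensity_pos ht x).le) f

theorem integrable_marginalLaw_iff (hP : P.Valid) {t : ℝ} (ht : t ∈ Icc (0 : ℝ) 1)
    (f : E n → ℝ) :
    Integrable f (P.marginalLaw t) ↔ Integrable fun x => P.marginalDensity x t * f x :=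
  integrable_densityLaw_iff volume (hP.contDiff_marginalDensity ht).continuous.measurable
    (fun x => (hP.marginalDensity_pos ht x).le) f

theorem hasDerivWithinAt_integral_marginalLaw (hP : P.Valid)
    {ψ : E n → ℝ} (hψ : Continuous ψ) (hc : HasCompactSupport ψ) {t : ℝ}
    (ht : t ∈ Icc (0 : ℝ) 1) :
    HasDerivWithinAt (fun s => ∫ z, ψ z ∂(P.marginalLaw s)) (-∫ z, ψ z * P.source z t)
      (Icc 0 1) t := by
  obtain ⟨C, hC⟩ := (hc.isCompact.prod (isCompact_Icc (a := (0 : ℝ)) (b := 1))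
    ).exists_bound_of_continuousOn
    (hP.continuousOn_source.mono (prod_mono_left (subset_univ _)))
  have hbound : ∀ x, ∀ s ∈ Icc (0 : ℝ) 1, ‖-P.source x s * ψ x‖ ≤ C * ‖ψ x‖ := by
    intro x s hs
    by_cases hx : x ∈ tsupport ψ
    · rw [norm_mul, norm_neg]
      exact mul_le_mul_of_nonneg_right (hC (x, s) ⟨hx, hs⟩) (norm_nonneg _)
    · simp [image_eq_zero_of_notMem_tsupport hx]
  have hderiv := hasDerivWithinAt_integral_of_dominated (μ := (volume : Measure (E n)))
    (F := fun s x => P.marginalDensity x s * ψ x) (convex_Icc (0 : ℝ) 1) ht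
    (fun s hs => ((hP.contDiff_marginalDensity hs).continuous.mul
      hψ).integrable_of_hasCompactSupport hc.mul_left)
    (.of_forall fun x s hs => (hP.hasDerivWithinAt_marginalDensity hs x).mul_const _)
    (.of_forall hbound) ((hψ.integrable_of_hasCompactSupport hc).norm.const_mul _)
  refine (hderiv.congr_of_mem (fun s hs => integral_marginalLaw hP hs ψ) ht).congr_deriv ?_
  rw [← integral_neg]
  exact integral_congr_ae (.of_forall fun z => by simp only; ring)

end Residual

/-! ### Potential flows -/

theorem exists_norm_fderiv_apply_le {V T G : Type*} [NormedAddCommGroup V] [NormedSpace ℝ V]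
    [TopologicalSpace T] [NormedAddCommGroup G] [NormedSpace ℝ G] {ψ : V → G}
    (hψ : ContDiff ℝ 1 ψ) (hc : HasCompactSupport ψ) {K : Set T} (hK : IsCompact K)
    {w : V → T → V} (hw : ContinuousOn (fun z : V × T => w z.1 z.2) (univ ×ˢ K)) :
    ∃ C, ∀ x, ∀ s ∈ K, ‖fderiv ℝ ψ x (w x s)‖ ≤ C := by
  obtain ⟨C, hC⟩ := (hc.isCompact.prod hK).exists_bound_of_continuousOn
    (f := fun z : V × T => fderiv ℝ ψ z.1 (w z.1 z.2))
    (((hψ.continuous_fderiv one_ne_zero).comp continuous_fst).continuousOn.clm_apply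
      (hw.mono (prod_mono_left (subset_univ _))))
  refine ⟨max C 0, fun x s hs => ?_⟩
  by_cases hx : x ∈ tsupport ψ
  · exact (hC (x, s) ⟨hx, hs⟩).trans (le_max_left _ _)
  · simp [fderiv_of_notMem_tsupport ℝ hx]

namespace IsPotentialFlow

variable {n : ℕ} {P : Params n} {Φ : E n → ℝ → ℝ} {X : E n → ℝ → E n}

theorem isC1Flow (h : IsPotentialFlow P Φ X) :
    IsC1Flow (fun x t => gradient (fun y => Φ y t) x)
      (fun x t => fderiv ℝ (gradient fun y => Φ y t) x) X where
  hasFDerivAt t ht x :=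
    ((contDiff_gradient (h.smooth t ht)).differentiable one_ne_zero x).hasFDerivAt
  continuousOn_deriv := h.continuous_hessian
  start := h.start
  ode := h.ode

theorem differentiable (h : IsPotentialFlow P Φ X) {t : ℝ} (ht : t ∈ Icc (0 : ℝ) 1) :
    Differentiable ℝ fun x => X x t := fun x => by
  obtain ⟨J, -, hJ⟩ := h.isC1Flow.exists_jacobian_hasDerivWithinAt_log_det x
  exact (hJ t ht).1.differentiableAt

theorem marginalDensity_mul_det (hP : P.Valid) (h : IsPotentialFlow P Φ X)
    (hsol : ∀ t ∈ Icc (0 : ℝ) 1, SolvesPoisson P t fun x => Φ x t) {t : ℝ}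
    (ht : t ∈ Icc (0 : ℝ) 1) (x : E n) : (fderiv ℝ (fun y => X y t) x).det ≠ 0 ∧
      P.marginalDensity (X x t) t * |(fderiv ℝ (fun y => X y t) x).det| =
        P.marginalDensity x 0 := by
  obtain ⟨J, hJ0, hJ⟩ := h.isC1Flow.exists_jacobian_hasDerivWithinAt_log_det x
  have h0 : (0 : ℝ) ∈ Icc (0 : ℝ) 1 := left_mem_Icc.2 zero_le_one
  have hderiv : ∀ s ∈ Icc (0 : ℝ) 1, HasDerivWithinAt
      (fun s => Real.log (P.marginalDensity (X x s) s) + Real.log (J s).det) 0 (Icc 0 1) s := by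
    intro s hs
    have hresidual : residual P s (gradient fun y => Φ y s) (X x s) = 0 :=
      (solvesPoisson_iff_residual_eq_zero hP hs (h.smooth s hs)).1 (hsol s hs) (X x s)
    refine ((hP.hasDerivWithinAt_log_marginalDensity hs (h.ode x s hs)).add
      (hJ s hs).2.2).congr_deriv ?_
    change _ + divergence (gradient fun y => Φ y s) (X x s) = 0
    rw [← hresidual, residual]
    ring
  have hconst := (convex_Icc (0 : ℝ) 1).norm_image_sub_le_of_norm_hasDerivWithin_le
    (C := 0) hderiv (by simp) h0 ht
  obtain ⟨hfderiv, hdet, -⟩ := hJ t ht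
  have hρ := hP.marginalDensity_pos ht (X x t)
  have hdet_pos := abs_pos.2 hdet
  rw [zero_mul, norm_le_zero_iff, sub_eq_zero, h.start, hJ0,
    show (1 : E n →L[ℝ] E n).det = 1 from map_one LinearMap.det, Real.log_one, add_zero,
    ← Real.log_abs (J t).det, ← Real.log_mul hρ.ne' hdet_pos.ne'] at hconst
  rw [hfderiv.fderiv]
  exact ⟨hdet, Real.log_injOn_pos (mul_pos hρ hdet_pos) (hP.marginalDensity_pos h0 x) hconst⟩

theorem isProbabilityMeasure_flowLaw (hP : P.Valid) (h : IsPotentialFlow P Φ X) {t : ℝ}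
    (ht : t ∈ Icc (0 : ℝ) 1) : IsProbabilityMeasure (flowLaw P X t) :=
  have := hP.isProbabilityMeasure_marginalLaw (left_mem_Icc.2 zero_le_one)
  Measure.isProbabilityMeasure_map (h.differentiable ht).continuous.measurable.aemeasurable

theorem flowLaw_eq_of_solvesPoisson (hP : P.Valid) (h : IsPotentialFlow P Φ X)
    (hsol : ∀ t ∈ Icc (0 : ℝ) 1, SolvesPoisson P t fun x => Φ x t) {t : ℝ}
    (ht : t ∈ Icc (0 : ℝ) 1) : flowLaw P X t = P.marginalLaw t := by
  have := hP.isProbabilityMeasure_marginalLaw ht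
  have := h.isProbabilityMeasure_flowLaw hP ht
  have hinj := h.isC1Flow.injective ht
  have hmass := h.marginalDensity_mul_det hP hsol ht
  have hmap : flowLaw P X t = volume.withDensity
      (pushforwardDensity (fun x => X x t) fun x => P.marginalDensity x 0) :=
    map_densityLaw volume (h.differentiable ht) hinj fun x => (hmass x).1
  -- Both laws are probability measures, so domination of the densities suffices; this avoids
  -- showing that the flow is onto.
  refine Measure.eq_of_le_of_measure_univ_eq ?_ (by simp)
  rw [hmap]
  refine withDensity_mono (.of_forall fun y => ?_)
  by_cases hy : y ∈ range fun x => X x t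
  · obtain ⟨x, rfl⟩ := hy
    have hdensity := eq_div_of_mul_eq (abs_ne_zero.2 (hmass x).1) (hmass x).2
    exact ((pushforwardDensity_apply hinj x).trans (congrArg ENNReal.ofReal hdensity.symm)).le
  · rw [pushforwardDensity, Function.extend_apply' _ _ _ hy]
    exact zero_le

theorem hasDerivWithinAt_integral_flowLaw (hP : P.Valid) (h : IsPotentialFlow P Φ X)
    {ψ : E n → ℝ} (hψ : ContDiff ℝ 1 ψ) (hc : HasCompactSupport ψ) {t : ℝ}
    (ht : t ∈ Icc (0 : ℝ) 1) :
    HasDerivWithinAt (fun s => ∫ z, ψ z ∂(flowLaw P X s))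
      (∫ z, fderiv ℝ ψ z (gradient (fun y => Φ y t) z) ∂(flowLaw P X t)) (Icc 0 1) t := by
  have := hP.isProbabilityMeasure_marginalLaw (left_mem_Icc.2 zero_le_one)
  obtain ⟨C, hC⟩ := exists_norm_fderiv_apply_le
    (w := fun z s => gradient (fun y => Φ y s) z) hψ hc isCompact_Icc h.continuous_gradient
  obtain ⟨B, hB⟩ := hψ.continuous.bounded_above_of_compact_support hc
  have hlagrangian := hasDerivWithinAt_integral_of_dominated (μ := P.marginalLaw 0)
    (F := fun s x => ψ (X x s))
    (F' := fun s x => fderiv ℝ ψ (X x s) (gradient (fun y => Φ y s) (X x s)))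
    (bound := fun _ => C) (convex_Icc 0 1) ht
    (fun s hs => (integrable_const B).mono'
      (hψ.continuous.comp (h.differentiable hs).continuous).aestronglyMeasurable
      (.of_forall fun x => hB _))
    (.of_forall fun x s hs =>
      (hψ.differentiable one_ne_zero _).hasFDerivAt.comp_hasDerivWithinAt s (h.ode x s hs))
    (.of_forall fun x s hs => hC _ s hs) (integrable_const _)
  refine (hlagrangian.congr_of_mem (fun s hs => ?_) ht).congr_deriv ?_
  · rw [flowLaw, integral_map (h.differentiable hs).continuous.measurable.aemeasurable
      hψ.continuous.aestronglyMeasurable]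
  · rw [flowLaw, integral_map (h.differentiable ht).continuous.measurable.aemeasurable]
    exact ((hψ.continuous_fderiv one_ne_zero).clm_apply
      (contDiff_gradient (h.smooth t ht)).continuous).aestronglyMeasurable

theorem contDiff_marginalDensity_smul_gradient (hP : P.Valid) (h : IsPotentialFlow P Φ X) {t : ℝ}
    (ht : t ∈ Icc (0 : ℝ) 1) :
    ContDiff ℝ 1 fun y => P.marginalDensity y t • gradient (fun x => Φ x t) y :=
  ((hP.contDiff_marginalDensity ht).of_le (by exact_mod_cast le_top)).smul
    (contDiff_gradient (h.smooth t ht))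

theorem integral_mul_divergence_eq_integral_mul_source (hP : P.Valid) (h : IsPotentialFlow P Φ X)
    (hlaw : ∀ t ∈ Icc (0 : ℝ) 1, flowLaw P X t = P.marginalLaw t) {t : ℝ}
    (ht : t ∈ Icc (0 : ℝ) 1) {ψ : E n → ℝ} (hψ : ContDiff ℝ 1 ψ) (hc : HasCompactSupport ψ) :
    ∫ x, ψ x * divergence (fun y => P.marginalDensity y t • gradient (fun x => Φ x t) y) x =
      ∫ x, ψ x * P.source x t := by
  have hflow := h.hasDerivWithinAt_integral_flowLaw hP hψ hc ht
  have hmarginal : HasDerivWithinAt (fun s => ∫ z, ψ z ∂(flowLaw P X s))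
      (-∫ z, ψ z * P.source z t) (Icc 0 1) t :=
    (hasDerivWithinAt_integral_marginalLaw hP hψ.continuous hc ht).congr_of_mem
      (fun s hs => by rw [hlaw s hs]) ht
  have heq := (uniqueDiffOn_Icc zero_lt_one t ht).eq_deriv _ hflow hmarginal
  rw [hlaw t ht, integral_marginalLaw hP ht] at heq
  rw [integral_mul_divergence_eq_neg hψ hc (h.contDiff_marginalDensity_smul_gradient hP ht)]
  simp_rw [map_smul, smul_eq_mul]
  rw [heq, neg_neg]

theorem solvesPoisson_of_flowLaw_eq (hP : P.Valid) (h : IsPotentialFlow P Φ X)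
    (hlaw : ∀ t ∈ Icc (0 : ℝ) 1, flowLaw P X t = P.marginalLaw t) {t : ℝ}
    (ht : t ∈ Icc (0 : ℝ) 1) : SolvesPoisson P t fun x => Φ x t := by
  have hdiv := continuous_divergence (h.contDiff_marginalDensity_smul_gradient hP ht)
  have hsource := hP.continuous_source ht
  intro x
  refine sub_eq_zero.1 (congrFun (eq_zero_of_integral_mul_eq_zero volume (hdiv.sub hsource)
    fun ψ hψ hc => ?_) x)
  simp_rw [Pi.sub_apply, mul_sub]
  rw [integral_sub
    ((hψ.continuous.fun_mul hdiv).integrable_of_hasCompactSupport hc.mul_right)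
    ((hψ.continuous.fun_mul hsource).integrable_of_hasCompactSupport hc.mul_right), sub_eq_zero]
  exact h.integral_mul_divergence_eq_integral_mul_source hP hlaw ht
    (hψ.of_le (by exact_mod_cast le_top)) hc

theorem solvesPoisson_iff_flowLaw_eq (hP : P.Valid) (h : IsPotentialFlow P Φ X) :
    (∀ t ∈ Icc (0 : ℝ) 1, SolvesPoisson P t fun x => Φ x t) ↔
      ∀ t ∈ Icc (0 : ℝ) 1, flowLaw P X t = P.marginalLaw t :=
  ⟨fun hsol _ ht => h.flowLaw_eq_of_solvesPoisson hP hsol ht,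
    fun hlaw _ ht => h.solvesPoisson_of_flowLaw_eq hP hlaw ht⟩

theorem klDiv_eq_zero (hP : P.Valid) (h : IsPotentialFlow P Φ X)
    (hsol : ∀ t ∈ Icc (0 : ℝ) 1, SolvesPoisson P t fun x => Φ x t) {t : ℝ}
    (ht : t ∈ Icc (0 : ℝ) 1) : klDiv (flowLaw P X t) (P.marginalLaw t) = 0 := by
  have := hP.isProbabilityMeasure_marginalLaw ht
  rw [h.flowLaw_eq_of_solvesPoisson hP hsol ht, klDiv_self]

theorem minimizesKL_of_solvesPoisson (hP : P.Valid) (h : IsPotentialFlow P Φ X)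
    (hsol : ∀ t ∈ Icc (0 : ℝ) 1, SolvesPoisson P t fun x => Φ x t) {t : ℝ}
    (ht : t ∈ Icc (0 : ℝ) 1) : MinimizesKL P X t := by
  intro Ψ Y _
  rw [h.klDiv_eq_zero hP hsol ht]
  exact zero_le

theorem solvesPoisson_of_minimizesKL (hP : P.Valid) (h : IsPotentialFlow P Φ X)
    {Ψ : E n → ℝ → ℝ} {Y : E n → ℝ → E n} (hY : IsPotentialFlow P Ψ Y)
    (hsol : ∀ t ∈ Icc (0 : ℝ) 1, SolvesPoisson P t fun x => Ψ x t)
    (hmin : ∀ t ∈ Icc (0 : ℝ) 1, MinimizesKL P X t) :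
    ∀ t ∈ Icc (0 : ℝ) 1, SolvesPoisson P t fun x => Φ x t := by
  refine (h.solvesPoisson_iff_flowLaw_eq hP).2 fun t ht => ?_
  have hle := hmin t ht Ψ Y hY
  rw [hY.klDiv_eq_zero hP hsol ht] at hle
  have := hP.isProbabilityMeasure_marginalLaw ht
  have := h.isProbabilityMeasure_flowLaw hP ht
  exact klDiv_eq_zero_iff.1 (le_antisymm hle zero_le)

end IsPotentialFlow

/-! ### Compactly supported perturbations of a diffeomorphism -/

section Perturbation

theorem isUnit_add_of_norm_mul_inverse_lt_one {R : Type*} [NormedRing R]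
    [HasSummableGeomSeries R] {a b : R} (ha : IsUnit a) (hb : ‖b * Ring.inverse a‖ < 1) :
    IsUnit (a + b) := by
  have hfactor : a + b = (1 - -(b * Ring.inverse a)) * a := by
    rw [sub_neg_eq_add, add_mul, one_mul, Ring.inverse_mul_cancel_right _ _ ha]
  rw [hfactor]
  exact (isUnit_one_sub_of_norm_lt_one (by rwa [norm_neg])).mul ha

theorem continuousOn_ringInverse {Y R : Type*} [TopologicalSpace Y] [NormedRing R]
    [HasSummableGeomSeries R] {A : Y → R} {s : Set Y} (hA : ContinuousOn A s)
    (hunit : ∀ y ∈ s, IsUnit (A y)) : ContinuousOn (fun y => Ring.inverse (A y)) s := fun y hy =>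
  have hinv : ContinuousAt Ring.inverse (A y) :=
    (hunit y hy).unit_spec ▸ NormedRing.inverse_continuousAt (hunit y hy).unit
  hinv.comp_continuousWithinAt (hA y hy)

variable {V : Type*} [NormedAddCommGroup V] [NormedSpace ℝ V]

theorem injective_add_smul_of_norm_fderiv_le {T g η : V → V} (hgl : Function.LeftInverse g T)
    (hηg : Differentiable ℝ (η ∘ g)) {L : ℝ} (hL : ∀ y, ‖fderiv ℝ (η ∘ g) y‖ ≤ L) {ε : ℝ}
    (hε : |ε| * L < 1) : Function.Injective fun x => T x + ε • η x := by
  intro x y hxy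
  have hlip := convex_univ.norm_image_sub_le_of_norm_fderiv_le
    (fun z _ => hηg z) (fun z _ => hL z) (mem_univ (T y)) (mem_univ (T x))
  simp only [Function.comp_apply, hgl x, hgl y] at hlip
  have hdiff : T x - T y = -(ε • (η x - η y)) := by
    simp only at hxy
    rw [smul_sub, neg_sub, sub_eq_sub_iff_add_eq_add, hxy]
    abel
  have hcontract : ‖T x - T y‖ ≤ |ε| * L * ‖T x - T y‖ := by
    calc ‖T x - T y‖ = |ε| * ‖η x - η y‖ := by rw [hdiff, norm_neg, norm_smul, Real.norm_eq_abs]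
      _ ≤ |ε| * (L * ‖T x - T y‖) := mul_le_mul_of_nonneg_left hlip (abs_nonneg _)
      _ = |ε| * L * ‖T x - T y‖ := by ring
  have hzero : ‖T x - T y‖ = 0 := by nlinarith [norm_nonneg (T x - T y)]
  exact hgl.injective (sub_eq_zero.1 (norm_eq_zero.1 hzero))

theorem isUnit_fderiv_of_inverse {T g : V → V} (hT : Differentiable ℝ T)
    (hg : Differentiable ℝ g) (hgl : Function.LeftInverse g T) (hgr : Function.RightInverse g T)
    (x : V) : IsUnit (fderiv ℝ T x) ∧ fderiv ℝ g (T x) = Ring.inverse (fderiv ℝ T x) := by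
  have hleft : fderiv ℝ g (T x) * fderiv ℝ T x = 1 := by
    have hcomp := fderiv_comp x (hg (T x)) (hT x)
    rw [hgl.comp_eq_id, fderiv_id] at hcomp
    exact hcomp.symm
  have hright : fderiv ℝ T x * fderiv ℝ g (T x) = 1 := by
    have hcomp := fderiv_comp (T x) (hT (g (T x))) (hg (T x))
    rw [hgr.comp_eq_id, fderiv_id, hgl x] at hcomp
    exact hcomp.symm
  exact ⟨⟨⟨_, _, hright, hleft⟩, rfl⟩, (Ring.inverse_unit ⟨_, _, hright, hleft⟩).symm⟩

theorem exists_norm_fderiv_mul_inverse_le [CompleteSpace V] {T η : V → V} (hT : ContDiff ℝ 1 T)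
    (hunit : ∀ x, IsUnit (fderiv ℝ T x)) (hη : ContDiff ℝ 1 η) (hc : HasCompactSupport η) :
    ∃ L > 0, ∀ x, ‖fderiv ℝ η x * Ring.inverse (fderiv ℝ T x)‖ ≤ L := by
  have hsupp : HasCompactSupport fun x => fderiv ℝ η x * Ring.inverse (fderiv ℝ T x) :=
    (hc.fderiv ℝ).mul_right
  obtain ⟨C, hC⟩ := ((hη.continuous_fderiv one_ne_zero).mul (continuousOn_univ.1
    (continuousOn_ringInverse (hT.continuous_fderiv one_ne_zero).continuousOn
      fun x _ => hunit x))).bounded_above_of_compact_support hsupp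
  exact ⟨max C 1, by positivity, fun x => (hC x).trans (le_max_left _ _)⟩

theorem exists_injective_isUnit_fderiv_add_smul [CompleteSpace V] {T g η : V → V}
    (hT : ContDiff ℝ 1 T) (hg : Differentiable ℝ g) (hgl : Function.LeftInverse g T)
    (hgr : Function.RightInverse g T) (hη : ContDiff ℝ 1 η) (hc : HasCompactSupport η) :
    ∃ ε₀ > (0 : ℝ), ∀ ε ∈ Icc (-ε₀) ε₀, Function.Injective (fun x => T x + ε • η x) ∧
      ∀ x, IsUnit (fderiv ℝ T x + ε • fderiv ℝ η x) := by
  have hηd := hη.differentiable one_ne_zero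
  have hinv := isUnit_fderiv_of_inverse (hT.differentiable one_ne_zero) hg hgl hgr
  obtain ⟨L, hL, hbound⟩ := exists_norm_fderiv_mul_inverse_le hT (fun x => (hinv x).1) hη hc
  have hηg : ∀ y, ‖fderiv ℝ (η ∘ g) y‖ ≤ L := by
    intro y
    rw [← hgr y, fderiv_comp _ (hηd _) (hg _), (hinv _).2, hgl]
    exact hbound (g y)
  refine ⟨1 / (2 * L), by positivity, fun ε hε => ?_⟩
  have hεL : |ε| * L < 1 := by
    calc |ε| * L ≤ 1 / (2 * L) * L := mul_le_mul_of_nonneg_right (abs_le.2 hε) hL.le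
      _ = 1 / 2 := by field_simp
      _ < 1 := by norm_num
  refine ⟨injective_add_smul_of_norm_fderiv_le hgl (hηd.comp hg) hηg hεL,
    fun x => isUnit_add_of_norm_mul_inverse_lt_one (hinv x).1 ?_⟩
  rw [smul_mul_assoc, norm_smul, Real.norm_eq_abs]
  exact (mul_le_mul_of_nonneg_left (hbound x) (abs_nonneg _)).trans_lt hεL

theorem hasFDerivAt_add_smul {T η : V → V} (hT : Differentiable ℝ T) (hη : Differentiable ℝ η)
    (ε : ℝ) (x : V) :
    HasFDerivAt (fun x => T x + ε • η x) (fderiv ℝ T x + ε • fderiv ℝ η x) x :=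
  (hT x).hasFDerivAt.add ((hη x).hasFDerivAt.const_smul ε)

/-- The logarithm of the ratio, at the point `x`, of the density `u` to the pull-back of the
density `v` under the perturbed map `T + ε • η`; its mean is a Kullback–Leibler divergence. -/
def perturbedLogRatio (T η : V → V) (u v : V → ℝ) (ε : ℝ) (x : V) : ℝ :=
  Real.log (u x) - Real.log (fderiv ℝ T x + ε • fderiv ℝ η x).det - Real.log (v (T x + ε • η x))

variable [FiniteDimensional ℝ V]

/-- The derivative of `perturbedLogRatio` with respect to the size `ε` of the perturbation. -/
def perturbedLogRatioDeriv (T η : V → V) (v : V → ℝ) (ε : ℝ) (x : V) : ℝ :=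
  -(traceCLM V (fderiv ℝ η x * Ring.inverse (fderiv ℝ T x + ε • fderiv ℝ η x)) +
    fderiv ℝ (fun y => Real.log (v y)) (T x + ε • η x) (η x))

variable {T g η : V → V} {u v : V → ℝ}

theorem hasDerivAt_perturbedLogRatio (hv : Differentiable ℝ v) (hv0 : ∀ x, 0 < v x) {ε : ℝ}
    {x : V} (hunit : IsUnit (fderiv ℝ T x + ε • fderiv ℝ η x)) :
    HasDerivAt (fun ε => perturbedLogRatio T η u v ε x) (perturbedLogRatioDeriv T η v ε x) ε := by
  have hjacobian : HasDerivAt (fun ε : ℝ => fderiv ℝ T x + ε • fderiv ℝ η x) (fderiv ℝ η x) ε := by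
    simpa using ((hasDerivAt_id ε).smul_const (fderiv ℝ η x)).const_add (fderiv ℝ T x)
  have hpoint : HasDerivAt (fun ε : ℝ => T x + ε • η x) (η x) ε := by
    simpa using ((hasDerivAt_id ε).smul_const (η x)).const_add (T x)
  have hlogdet := hasDerivWithinAt_log_det (s := univ) hjacobian.hasDerivWithinAt
    (Ring.mul_inverse_cancel _ hunit)
  have hlogv := ((hv (T x + ε • η x)).log (hv0 _).ne').hasFDerivAt.comp_hasDerivAt ε hpoint
  refine (((hlogdet.hasDerivAt univ_mem).const_sub (Real.log (u x))).sub hlogv).congr_deriv ?_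
  rw [perturbedLogRatioDeriv]
  ring

theorem continuousOn_perturbedLogRatioDeriv (hT : ContDiff ℝ 1 T) (hη : ContDiff ℝ 1 η)
    (hv : ContDiff ℝ 1 v) (hv0 : ∀ x, 0 < v x) {s : Set (V × ℝ)}
    (hunit : ∀ z ∈ s, IsUnit (fderiv ℝ T z.1 + z.2 • fderiv ℝ η z.1)) :
    ContinuousOn (fun z : V × ℝ => perturbedLogRatioDeriv T η v z.2 z.1) s := by
  have : CompleteSpace V := FiniteDimensional.complete ℝ V
  have hDT := (hT.continuous_fderiv one_ne_zero).comp (continuous_fst (X := V) (Y := ℝ))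
  have hDη := (hη.continuous_fderiv one_ne_zero).comp (continuous_fst (X := V) (Y := ℝ))
  have hηfst := hη.continuous.comp (continuous_fst (X := V) (Y := ℝ))
  have hlogv : ContDiff ℝ 1 fun y => Real.log (v y) := hv.log fun y => (hv0 y).ne'
  refine ContinuousOn.neg (ContinuousOn.add ?_ (Continuous.continuousOn ?_))
  · exact (traceCLM V).continuous.comp_continuousOn (hDη.continuousOn.mul
      (continuousOn_ringInverse (hDT.add (continuous_snd.smul hDη)).continuousOn hunit))
  · exact ((hlogv.continuous_fderiv one_ne_zero).comp
      ((hT.continuous.comp continuous_fst).add (continuous_snd.smul hηfst))).clm_apply hηfst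

theorem continuous_perturbedLogRatio_sub (hT : ContDiff ℝ 1 T) (hη : ContDiff ℝ 1 η)
    (hv : Continuous v) (hv0 : ∀ x, 0 < v x) {ε : ℝ}
    (hunit₀ : ∀ x, IsUnit (fderiv ℝ T x))
    (hunit : ∀ x, IsUnit (fderiv ℝ T x + ε • fderiv ℝ η x)) :
    Continuous fun x => perturbedLogRatio T η u v ε x - perturbedLogRatio T η u v 0 x := by
  have hcont : ∀ δ : ℝ, (∀ x, IsUnit (fderiv ℝ T x + δ • fderiv ℝ η x)) → Continuous fun x =>
      Real.log (fderiv ℝ T x + δ • fderiv ℝ η x).det + Real.log (v (T x + δ • η x)) := by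
    intro δ hδ
    refine Continuous.add (Continuous.log ?_ fun x => det_ne_zero_of_isUnit (hδ x))
      (Continuous.log ?_ fun x => (hv0 _).ne')
    · exact (differentiable_det (V := V)).continuous.comp
        ((hT.continuous_fderiv one_ne_zero).add ((hη.continuous_fderiv one_ne_zero).const_smul δ))
    · exact hv.comp (hT.continuous.add (hη.continuous.const_smul δ))
  refine ((hcont 0 (by simpa using hunit₀)).sub (hcont ε hunit)).congr fun x => ?_
  simp only [perturbedLogRatio, Pi.sub_apply]
  ring

theorem integrable_perturbedLogRatio [MeasurableSpace V] [BorelSpace V] {μ : Measure V}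
    [IsFiniteMeasureOnCompacts μ] (hT : ContDiff ℝ 1 T)
    (hη : ContDiff ℝ 1 η) (hc : HasCompactSupport η) (hv : Continuous v) (hv0 : ∀ x, 0 < v x)
    {ε : ℝ} (hunit₀ : ∀ x, IsUnit (fderiv ℝ T x))
    (hunit : ∀ x, IsUnit (fderiv ℝ T x + ε • fderiv ℝ η x))
    (hint : Integrable (perturbedLogRatio T η u v 0) μ) :
    Integrable (perturbedLogRatio T η u v ε) μ := by
  have hdiff : Integrable
      (fun x => perturbedLogRatio T η u v ε x - perturbedLogRatio T η u v 0 x) μ :=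
    (continuous_perturbedLogRatio_sub hT hη hv hv0 hunit₀ hunit).integrable_of_hasCompactSupport
      (HasCompactSupport.intro hc fun x hx => by
        simp [perturbedLogRatio, fderiv_of_notMem_tsupport ℝ hx,
          image_eq_zero_of_notMem_tsupport hx])
  exact (hdiff.add hint).congr (.of_forall fun x => by simp)

variable [MeasurableSpace V] [BorelSpace V] (μ : Measure V) [μ.IsAddHaarMeasure]

theorem klDiv_map_add_smul (hT : Differentiable ℝ T) (hη : Differentiable ℝ η) {ε : ℝ}
    (hinj : Function.Injective fun x => T x + ε • η x)
    (hunit : ∀ x, IsUnit (fderiv ℝ T x + ε • fderiv ℝ η x)) (hu : Measurable u)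
    (hv : Measurable v) (hu0 : ∀ x, 0 < u x) (hv0 : ∀ x, 0 < v x)
    [IsProbabilityMeasure (densityLaw μ u)] [IsProbabilityMeasure (densityLaw μ v)] :
    (klDiv ((densityLaw μ u).map fun x => T x + ε • η x) (densityLaw μ v) ≠ ∞ ↔
      Integrable (perturbedLogRatio T η u v ε) (densityLaw μ u)) ∧
    (klDiv ((densityLaw μ u).map fun x => T x + ε • η x) (densityLaw μ v)).toReal =
      ∫ x, perturbedLogRatio T η u v ε x ∂(densityLaw μ u) := by
  have hfderiv := fun x => (hasFDerivAt_add_smul hT hη ε x).fderiv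
  have hkl := klDiv_map_densityLaw μ
    (fun x => (hasFDerivAt_add_smul hT hη ε x).differentiableAt) hinj
    (fun x => by rw [hfderiv]; exact det_ne_zero_of_isUnit (hunit x)) hu hv hu0 hv0
  simp only [hfderiv] at hkl
  exact hkl

theorem hasDerivAt_klDiv_map_add_smul (hT : ContDiff ℝ 1 T) (hg : Differentiable ℝ g)
    (hgl : Function.LeftInverse g T) (hgr : Function.RightInverse g T) (hη : ContDiff ℝ 1 η)
    (hc : HasCompactSupport η) (hu : Measurable u) (hu0 : ∀ x, 0 < u x) (hv : ContDiff ℝ 1 v)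
    (hv0 : ∀ x, 0 < v x) [IsProbabilityMeasure (densityLaw μ u)]
    [IsProbabilityMeasure (densityLaw μ v)]
    (hfin : klDiv ((densityLaw μ u).map T) (densityLaw μ v) ≠ ∞) :
    (∀ᶠ ε in 𝓝 (0 : ℝ),
      klDiv ((densityLaw μ u).map fun x => T x + ε • η x) (densityLaw μ v) ≠ ∞) ∧
    HasDerivAt
      (fun ε : ℝ => (klDiv ((densityLaw μ u).map fun x => T x + ε • η x) (densityLaw μ v)).toReal)
      (∫ x, perturbedLogRatioDeriv T η v 0 x ∂(densityLaw μ u)) 0 := by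
  have : CompleteSpace V := FiniteDimensional.complete ℝ V
  obtain ⟨ε₀, hε₀, hpert⟩ := exists_injective_isUnit_fderiv_add_smul hT hg hgl hgr hη hc
  have hmem0 : (0 : ℝ) ∈ Icc (-ε₀) ε₀ := ⟨by linarith, hε₀.le⟩
  have hnhds : Icc (-ε₀) ε₀ ∈ 𝓝 (0 : ℝ) := Icc_mem_nhds (by linarith) hε₀
  have hkl := fun ε (hε : ε ∈ Icc (-ε₀) ε₀) =>
    klDiv_map_add_smul μ (hT.differentiable one_ne_zero) (hη.differentiable one_ne_zero)
      (hpert ε hε).1 (hpert ε hε).2 hu hv.continuous.measurable hu0 hv0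
  have hint₀ : Integrable (perturbedLogRatio T η u v 0) (densityLaw μ u) :=
    (hkl 0 hmem0).1.1 (by simpa using hfin)
  have hint : ∀ ε ∈ Icc (-ε₀) ε₀, Integrable (perturbedLogRatio T η u v ε) (densityLaw μ u) :=
    fun ε hε => integrable_perturbedLogRatio hT hη hc hv.continuous hv0
      (by simpa using (hpert 0 hmem0).2) (hpert ε hε).2 hint₀
  refine ⟨mem_of_superset hnhds fun ε hε => (hkl ε hε).1.2 (hint ε hε), ?_⟩
  have hderiv := hasDerivWithinAt_integral_of_isCompact (μ := densityLaw μ u) hc.isCompact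
    (convex_Icc (-ε₀) ε₀) isCompact_Icc hmem0 hint
    (fun x ε hε => (hasDerivAt_perturbedLogRatio (hv.differentiable one_ne_zero) hv0
      ((hpert ε hε).2 x)).hasDerivWithinAt)
    (continuousOn_perturbedLogRatioDeriv hT hη hv hv0 fun z hz => (hpert z.2 hz.2).2 z.1)
    (fun x hx ε _ => by simp [perturbedLogRatioDeriv, fderiv_of_notMem_tsupport ℝ hx,
      image_eq_zero_of_notMem_tsupport hx])
  exact (hderiv.hasDerivAt hnhds).congr_of_eventuallyEq
    (mem_of_superset hnhds fun ε hε => (hkl ε hε).2)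

end Perturbation

/-! ### The first variation to first order in the step length -/

section FirstVariation

theorem hasDerivWithinAt_ringInverse {R : Type*} [NormedRing R] [NormedAlgebra ℝ R]
    [HasSummableGeomSeries R] {A : ℝ → R} {A' : R} {s : Set ℝ} {t : ℝ}
    (hA : HasDerivWithinAt A A' s t) (hunit : IsUnit (A t)) :
    HasDerivWithinAt (fun r => Ring.inverse (A r))
      (-(Ring.inverse (A t) * A' * Ring.inverse (A t))) s t := by
  obtain ⟨a, ha⟩ := hunit
  have hinv := hasFDerivAt_ringInverse (𝕜 := ℝ) a
  rw [ha] at hinv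
  refine (hinv.comp_hasDerivWithinAt t hA).congr_deriv ?_
  rw [← ha, Ring.inverse_unit]
  simp

variable {n : ℕ} {P : Params n} {t : ℝ} {w η : E n → E n}

theorem one_add_sub_self_smul (t : ℝ) (A : E n →L[ℝ] E n) : 1 + (t - t) • A = 1 := by
  ext x
  simp

/-- The integrand of `stepVariation`. -/
def stepIntegrand (P : Params n) (t : ℝ) (w η : E n → E n) (s : ℝ) (x : E n) : ℝ :=
  -(traceCLM (E n) (fderiv ℝ η x * Ring.inverse (1 + (s - t) • fderiv ℝ w x)) +
    P.score (x + (s - t) • w x) s (η x))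

/-- The derivative of `stepIntegrand` with respect to the arrival time `s`. -/
def stepIntegrandDeriv (P : Params n) (t : ℝ) (w η : E n → E n) (s : ℝ) (x : E n) : ℝ :=
  -(traceCLM (E n) (fderiv ℝ η x * -(Ring.inverse (1 + (s - t) • fderiv ℝ w x) * fderiv ℝ w x *
      Ring.inverse (1 + (s - t) • fderiv ℝ w x))) +
    P.scoreDeriv (x + (s - t) • w x) (w x) (η x) s)

/-- The first variation in the direction `η` of the Kullback–Leibler divergence reached by one
Euler step along `w` from time `t` to time `s`. -/
def stepVariation (P : Params n) (t : ℝ) (w η : E n → E n) (s : ℝ) : ℝ :=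
  ∫ x, stepIntegrand P t w η s x ∂(P.marginalLaw t)

theorem integrable_stepIntegrand (hP : P.Valid) {s : ℝ} {μ : Measure (E n)}
    [IsFiniteMeasureOnCompacts μ] (hw : ContDiff ℝ 1 w) (hη : ContDiff ℝ 1 η)
    (hc : HasCompactSupport η) (hunit : ∀ x, IsUnit (1 + (s - t) • fderiv ℝ w x)) :
    Integrable (stepIntegrand P t w η s) μ := by
  have hinv : Continuous fun x => Ring.inverse (1 + (s - t) • fderiv ℝ w x) :=
    continuousOn_univ.1 (continuousOn_ringInverse (continuous_const.add
      ((hw.continuous_fderiv one_ne_zero).const_smul (s - t))).continuousOn fun x _ => hunit x)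
  refine Continuous.integrable_of_hasCompactSupport (Continuous.neg (Continuous.add ?_ ?_))
    (HasCompactSupport.intro hc fun x hx => ?_)
  · exact (traceCLM (E n)).continuous.comp ((hη.continuous_fderiv one_ne_zero).mul hinv)
  · exact ((hP.contDiff_score s).continuous.comp
      (continuous_id.add (hw.continuous.const_smul (s - t)))).clm_apply hη.continuous
  · simp [stepIntegrand, fderiv_of_notMem_tsupport ℝ hx, image_eq_zero_of_notMem_tsupport hx]

theorem hasDerivWithinAt_stepIntegrand (hP : P.Valid) {I : Set ℝ} (hI : I ⊆ Icc 0 1) {s : ℝ}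
    (hs : s ∈ I) {x : E n} (hunit : IsUnit (1 + (s - t) • fderiv ℝ w x)) :
    HasDerivWithinAt (fun s => stepIntegrand P t w η s x) (stepIntegrandDeriv P t w η s x) I s := by
  have hjacobian : HasDerivWithinAt (fun s : ℝ => 1 + (s - t) • fderiv ℝ w x) (fderiv ℝ w x)
      I s := by
    simpa using (((hasDerivWithinAt_id s _).sub_const t).smul_const (fderiv ℝ w x)).const_add
      (1 : E n →L[ℝ] E n)
  have hpoint : HasDerivWithinAt (fun s : ℝ => x + (s - t) • w x) (w x) (Icc 0 1) s := by
    simpa using (((hasDerivWithinAt_id s _).sub_const t).smul_const (w x)).const_add x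
  have htrace := (traceCLM (E n)).hasFDerivAt.comp_hasDerivWithinAt s
    ((hasDerivWithinAt_ringInverse hjacobian hunit).const_mul (fderiv ℝ η x))
  exact (htrace.add ((hP.hasDerivWithinAt_score (hI hs) hpoint (η x)).mono hI)).neg

theorem continuousOn_stepIntegrandDeriv (hP : P.Valid) (hw : ContDiff ℝ 1 w)
    (hη : ContDiff ℝ 1 η) {S : Set (E n × ℝ)} (hS : MapsTo Prod.snd S (Icc 0 1))
    (hunit : ∀ z ∈ S, IsUnit (1 + (z.2 - t) • fderiv ℝ w z.1)) :
    ContinuousOn (fun z : E n × ℝ => stepIntegrandDeriv P t w η z.2 z.1) S := by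
  have hwfst := hw.continuous.comp (continuous_fst (X := E n) (Y := ℝ))
  have hDw := (hw.continuous_fderiv one_ne_zero).comp (continuous_fst (X := E n) (Y := ℝ))
  have hDη := (hη.continuous_fderiv one_ne_zero).comp (continuous_fst (X := E n) (Y := ℝ))
  have hlength : Continuous fun z : E n × ℝ => z.2 - t := continuous_snd.sub continuous_const
  have hinv : ContinuousOn
      (fun z : E n × ℝ => Ring.inverse (1 + (z.2 - t) • fderiv ℝ w z.1)) S :=
    continuousOn_ringInverse (continuous_const.add (hlength.smul hDw)).continuousOn hunit
  refine ContinuousOn.neg (ContinuousOn.add ?_ (hP.continuousOn_scoreDeriv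
    (continuous_fst.add (hlength.smul hwfst)).continuousOn hwfst.continuousOn
    (hη.continuous.comp continuous_fst).continuousOn continuousOn_snd hS))
  exact (traceCLM (E n)).continuous.comp_continuousOn (hDη.continuousOn.mul
    ((hinv.mul hDw.continuousOn).mul hinv).neg)

theorem stepIntegrandDeriv_eq_zero_of_notMem_tsupport {x : E n} (hx : x ∉ tsupport η) (s : ℝ) :
    stepIntegrandDeriv P t w η s x = 0 := by
  simp [stepIntegrandDeriv, fderiv_of_notMem_tsupport ℝ hx, image_eq_zero_of_notMem_tsupport hx,
    Params.scoreDeriv, ← Prod.zero_eq_mk]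

theorem hasDerivWithinAt_stepVariation (hP : P.Valid) {b : ℝ} (ht : 0 ≤ t) (htb : t ≤ b)
    (hb : b ≤ 1) (hw : ContDiff ℝ 1 w) (hη : ContDiff ℝ 1 η) (hc : HasCompactSupport η)
    (hunit : ∀ s ∈ Icc t b, ∀ x, IsUnit (1 + (s - t) • fderiv ℝ w x)) :
    HasDerivWithinAt (stepVariation P t w η)
      (∫ x, stepIntegrandDeriv P t w η t x ∂(P.marginalLaw t)) (Icc t b) t := by
  have hsub : Icc t b ⊆ Icc (0 : ℝ) 1 := Icc_subset_Icc ht hb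
  have htmem : t ∈ Icc t b := left_mem_Icc.2 htb
  have := hP.isProbabilityMeasure_marginalLaw (hsub htmem)
  exact hasDerivWithinAt_integral_of_isCompact hc.isCompact (convex_Icc t b) isCompact_Icc htmem
    (fun s hs => integrable_stepIntegrand hP hw hη hc (hunit s hs))
    (fun x s hs => hasDerivWithinAt_stepIntegrand hP hsub hs (hunit s hs x))
    (continuousOn_stepIntegrandDeriv hP hw hη (fun z hz => hsub hz.2)
      fun z hz => hunit z.2 hz.2 z.1)
    (fun x hx s _ => stepIntegrandDeriv_eq_zero_of_notMem_tsupport hx s)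

theorem stepVariation_self (hP : P.Valid) (ht : t ∈ Icc (0 : ℝ) 1) (w : E n → E n)
    (hη : ContDiff ℝ 1 η) (hc : HasCompactSupport η) : stepVariation P t w η t = 0 := by
  have hρ : ContDiff ℝ 1 fun x => P.marginalDensity x t :=
    contDiff_infty.1 (hP.contDiff_marginalDensity ht) 1
  have hρη : ContDiff ℝ 1 fun x => P.marginalDensity x t • η x := hρ.smul hη
  have hρηc : HasCompactSupport fun x => P.marginalDensity x t • η x :=
    HasCompactSupport.smul_left (f := fun x => P.marginalDensity x t) hc
  have hpoint : ∀ x, P.marginalDensity x t * stepIntegrand P t w η t x =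
      -divergence (fun y => P.marginalDensity y t • η y) x := by
    intro x
    rw [divergence_marginalDensity_smul hP ht (hη.differentiable one_ne_zero), stepIntegrand,
      one_add_sub_self_smul, Ring.inverse_one, mul_one, sub_self, zero_smul, add_zero, mul_neg]
    rfl
  rw [stepVariation, integral_marginalLaw hP ht, integral_congr_ae (.of_forall hpoint),
    integral_neg, integral_divergence_eq_zero hρη hρηc, neg_zero]

theorem fderiv_score_symm (hP : P.Valid) (ht : t ∈ Icc (0 : ℝ) 1) (x u v : E n) :
    fderiv ℝ (fun x => P.score x t) x u v = fderiv ℝ (fun x => P.score x t) x v u :=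
  second_derivative_symmetric (f := fun x => Real.log (P.marginalDensity x t))
    (fun y => hP.hasFDerivAt_log_marginalDensity ht y)
    ((hP.contDiff_score t).differentiable one_ne_zero x).hasFDerivAt u v

theorem fderiv_score_add_logDensityRate (hP : P.Valid) (t : ℝ) (hw : Differentiable ℝ w)
    (x v : E n) :
    fderiv ℝ (fun x => P.score x t (w x) + P.logDensityRate x t) x v =
      fderiv ℝ (fun x => P.score x t) x v (w x) + P.score x t (fderiv ℝ w x v) +
        fderiv ℝ (fun x => P.logDensityRate x t) x v := by
  have hsum : HasFDerivAt (fun x => P.score x t (w x) + P.logDensityRate x t) _ x :=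
    (((hP.contDiff_score t).differentiable one_ne_zero x).hasFDerivAt.clm_apply
      (hw x).hasFDerivAt).add
      ((hP.contDiff_logDensityRate t).differentiable one_ne_zero x).hasFDerivAt
  rw [hsum.fderiv]
  simp only [add_apply, ContinuousLinearMap.comp_apply, ContinuousLinearMap.flip_apply]
  ring

theorem traceCLM_mul_fderiv_marginalDensity_smul (hP : P.Valid) (ht : t ∈ Icc (0 : ℝ) 1)
    {x : E n} (hη : DifferentiableAt ℝ η x) (A : E n →L[ℝ] E n) :
    traceCLM (E n) (A * fderiv ℝ (fun y => P.marginalDensity y t • η y) x) =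
      P.marginalDensity x t * (traceCLM (E n) (fderiv ℝ η x * A) + P.score x t (A (η x))) := by
  have hrank : (P.marginalDensity x t • P.score x t).smulRight (η x) * A =
      ((P.marginalDensity x t • P.score x t).comp A).smulRight (η x) := rfl
  rw [fderiv_fun_smul ((hP.contDiff_marginalDensity ht).differentiable (by simp) x) hη,
    hP.fderiv_marginalDensity ht, traceCLM_mul_comm, add_mul, hrank, map_add, traceCLM_smulRight,
    show (P.marginalDensity x t • fderiv ℝ η x) * A =
      P.marginalDensity x t • (fderiv ℝ η x * A) from rfl, map_smul, smul_eq_mul, mul_add]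
  rfl

theorem stepIntegrandDeriv_self (P : Params n) (t : ℝ) (w η : E n → E n) (x : E n) :
    stepIntegrandDeriv P t w η t x =
      traceCLM (E n) (fderiv ℝ η x * fderiv ℝ w x) - P.scoreDeriv x (w x) (η x) t := by
  have htrace_neg : traceCLM (E n) (fderiv ℝ η x * -fderiv ℝ w x) =
      -traceCLM (E n) (fderiv ℝ η x * fderiv ℝ w x) :=
    (congrArg (traceCLM (E n)) (mul_neg (fderiv ℝ η x) (fderiv ℝ w x))).trans (map_neg _ _)
  rw [stepIntegrandDeriv, one_add_sub_self_smul, Ring.inverse_one, one_mul, mul_one, htrace_neg,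
    sub_self, zero_smul, add_zero]
  ring

theorem integral_stepIntegrandDeriv_self (hP : P.Valid) (ht : t ∈ Icc (0 : ℝ) 1)
    (hw : ContDiff ℝ 1 w) (hη : ContDiff ℝ 2 η) (hc : HasCompactSupport η) :
    ∫ x, stepIntegrandDeriv P t w η t x ∂(P.marginalLaw t) =
      ∫ x, residual P t w x * divergence (fun y => P.marginalDensity y t • η y) x := by
  have hρ : ContDiff ℝ 2 fun x => P.marginalDensity x t :=
    contDiff_infty.1 (hP.contDiff_marginalDensity ht) 2
  have hρη : ContDiff ℝ 2 fun x => P.marginalDensity x t • η x := hρ.smul hη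
  have hρηc : HasCompactSupport fun x => P.marginalDensity x t • η x :=
    HasCompactSupport.smul_left (f := fun x => P.marginalDensity x t) hc
  have hpoint : ∀ x, P.marginalDensity x t * stepIntegrandDeriv P t w η t x =
      -(fderiv ℝ (fun x => P.score x t (w x) + P.logDensityRate x t) x
          (P.marginalDensity x t • η x) -
        traceCLM (E n)
          (fderiv ℝ w x * fderiv ℝ (fun y => P.marginalDensity y t • η y) x)) := by
    intro x
    rw [stepIntegrandDeriv_self,
      traceCLM_mul_fderiv_marginalDensity_smul hP ht (hη.differentiable two_ne_zero x), map_smul,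
      smul_eq_mul, fderiv_score_add_logDensityRate hP t (hw.differentiable one_ne_zero),
      hP.scoreDeriv_eq, fderiv_score_symm hP ht x (w x) (η x)]
    ring
  have hresidual : ∀ x, residual P t w x =
      (P.score x t (w x) + P.logDensityRate x t) + divergence w x := fun x => by
    rw [residual]
    ring
  simp_rw [hresidual]
  rw [integral_marginalLaw hP ht, integral_congr_ae (.of_forall hpoint), integral_neg,
    integral_fderiv_apply_sub_trace
      (((hP.contDiff_score t).clm_apply hw).add (hP.contDiff_logDensityRate t)) hw hρη hρηc,
    neg_neg]

end FirstVariation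

/-! ### First-order optimality of one step -/

section Optimality

theorem tendsto_slope_zero_right_of_hasDerivWithinAt_Ici {G : Type*} [NormedAddCommGroup G]
    [NormedSpace ℝ G] {f : ℝ → G} {f' : G} {t : ℝ} (hf : HasDerivWithinAt f f' (Ici t) t) :
    Tendsto (fun h => h⁻¹ • (f (t + h) - f t)) (𝓝[>] 0) (𝓝 f') := by
  have hshift : Tendsto (fun h : ℝ => t + h) (𝓝[>] 0) (𝓝[Ici t \ {t}] t) := by
    rw [Ici_sdiff_left]
    exact tendsto_nhdsWithin_iff.2
      ⟨((continuous_const_add t).tendsto' 0 t (add_zero t)).mono_left nhdsWithin_le_nhds,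
        mem_of_superset self_mem_nhdsWithin fun h => lt_add_of_pos_right t⟩
  refine ((hasDerivWithinAt_iff_tendsto_slope.1 hf).comp hshift).congr fun h => ?_
  rw [Function.comp_apply, slope_def_module, add_sub_cancel_left]

variable {n : ℕ} {P : Params n} {t : ℝ} {φ : E n → ℝ} {w η : E n → E n}

theorem contDiff_eulerStep (hφ : ContDiff ℝ 2 φ) (Δ : ℝ) : ContDiff ℝ 1 (eulerStep φ Δ) :=
  contDiff_id.add ((contDiff_gradient hφ).const_smul Δ)

theorem fderiv_eulerStep (hφ : ContDiff ℝ 2 φ) (Δ : ℝ) (x : E n) :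
    fderiv ℝ (eulerStep φ Δ) x = 1 + Δ • fderiv ℝ (gradient φ) x :=
  ((hasFDerivAt_id x).add
    (((contDiff_gradient hφ).differentiable one_ne_zero x).hasFDerivAt.const_smul Δ)).fderiv

theorem perturbedLogRatioDeriv_eulerStep (hP : P.Valid) (hφ : ContDiff ℝ 2 φ) {Δ : ℝ}
    (htΔ : t + Δ ∈ Icc (0 : ℝ) 1) (x : E n) :
    perturbedLogRatioDeriv (eulerStep φ Δ) η (fun y => P.marginalDensity y (t + Δ)) 0 x =
      stepIntegrand P t (gradient φ) η (t + Δ) x := by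
  have hjacobian : fderiv ℝ (eulerStep φ Δ) x + (0 : ℝ) • fderiv ℝ η x =
      1 + Δ • fderiv ℝ (gradient φ) x := by
    rw [← fderiv_eulerStep hφ]
    ext v
    simp
  rw [perturbedLogRatioDeriv, stepIntegrand, hjacobian, add_sub_cancel_left, zero_smul, add_zero,
    (hP.hasFDerivAt_log_marginalDensity htΔ _).fderiv]
  rfl

namespace StepAdmissible

theorem hasDerivAt_stepKL (hP : P.Valid) (ht : t ∈ Ico (0 : ℝ) 1) (h : StepAdmissible P t φ)
    (hη : ContDiff ℝ 1 η) (hc : HasCompactSupport η) :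
    ∀ᶠ Δ in 𝓝[>] (0 : ℝ), (∀ᶠ ε in 𝓝 (0 : ℝ), stepKL P t φ η Δ ε ≠ ∞) ∧
      HasDerivAt (fun ε => (stepKL P t φ η Δ ε).toReal)
        (stepVariation P t (gradient φ) η (t + Δ)) 0 := by
  filter_upwards [h.diffeo, h.finite, Ioo_mem_nhdsGT (sub_pos.2 ht.2)]
    with Δ ⟨g, hg, hgl, hgr⟩ hfin hΔ
  have htIcc : t ∈ Icc (0 : ℝ) 1 := ⟨ht.1, ht.2.le⟩
  have htΔ : t + Δ ∈ Icc (0 : ℝ) 1 := ⟨by linarith [ht.1, hΔ.1], by linarith [hΔ.2]⟩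
  have : IsProbabilityMeasure (densityLaw volume fun x => P.marginalDensity x t) :=
    hP.isProbabilityMeasure_marginalLaw htIcc
  have : IsProbabilityMeasure (densityLaw volume fun x => P.marginalDensity x (t + Δ)) :=
    hP.isProbabilityMeasure_marginalLaw htΔ
  obtain ⟨hfinite, hderiv⟩ := hasDerivAt_klDiv_map_add_smul volume
    (u := fun x => P.marginalDensity x t) (v := fun x => P.marginalDensity x (t + Δ))
    (contDiff_eulerStep h.smooth Δ) hg hgl hgr hη hc
    (hP.contDiff_marginalDensity htIcc).continuous.measurable (hP.marginalDensity_pos htIcc)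
    (contDiff_infty.1 (hP.contDiff_marginalDensity htΔ) 1) (hP.marginalDensity_pos htΔ)
    (by simpa [stepKL, Params.marginalLaw] using hfin)
  exact ⟨hfinite, hderiv.congr_deriv (integral_congr_ae
    (.of_forall (perturbedLogRatioDeriv_eulerStep hP h.smooth htΔ)))⟩

theorem eventually_isUnit_one_add_smul_fderiv (h : StepAdmissible P t φ) :
    ∀ᶠ Δ in 𝓝[>] (0 : ℝ), ∀ x, IsUnit (1 + Δ • fderiv ℝ (gradient φ) x) := by
  filter_upwards [h.diffeo] with Δ ⟨g, hg, hgl, hgr⟩ x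
  rw [← fderiv_eulerStep h.smooth]
  exact (isUnit_fderiv_of_inverse ((contDiff_eulerStep h.smooth Δ).differentiable one_ne_zero)
    hg hgl hgr x).1

theorem hasDerivWithinAt_stepVariation_Ici (hP : P.Valid) (ht : t ∈ Ico (0 : ℝ) 1)
    (h : StepAdmissible P t φ) (hη : ContDiff ℝ 2 η) (hc : HasCompactSupport η) :
    HasDerivWithinAt (stepVariation P t (gradient φ) η)
      (∫ x, residual P t (gradient φ) x * divergence (fun y => P.marginalDensity y t • η y) x)
      (Ici t) t := by
  obtain ⟨d, hd, hsub⟩ := mem_nhdsGT_iff_exists_Ioc_subset.1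
    (inter_mem h.eventually_isUnit_one_add_smul_fderiv (Ioo_mem_nhdsGT (sub_pos.2 ht.2)))
  rw [mem_Ioi] at hd
  have hd1 : d < 1 - t := (hsub ⟨hd, le_rfl⟩).2.2
  have hunit : ∀ s ∈ Icc t (t + d), ∀ x, IsUnit (1 + (s - t) • fderiv ℝ (gradient φ) x) := by
    intro s hs x
    rcases hs.1.eq_or_lt with rfl | hlt
    · rw [one_add_sub_self_smul]
      exact isUnit_one
    · exact (hsub ⟨sub_pos.2 hlt, by linarith [hs.2]⟩).1 x
  rw [← integral_stepIntegrandDeriv_self hP ⟨ht.1, ht.2.le⟩ (contDiff_gradient h.smooth) hη hc]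
  exact (hasDerivWithinAt_stepVariation hP ht.1 (by linarith) (by linarith)
    (contDiff_gradient h.smooth) (hη.of_le one_le_two) hc hunit).mono_of_mem_nhdsWithin
      (Icc_mem_nhdsGE (by linarith))

theorem tendsto_stepVariation_div (hP : P.Valid) (ht : t ∈ Ico (0 : ℝ) 1)
    (h : StepAdmissible P t φ) (hη : ContDiff ℝ 2 η) (hc : HasCompactSupport η) :
    Tendsto (fun Δ => stepVariation P t (gradient φ) η (t + Δ) / Δ) (𝓝[>] 0)
      (𝓝 (∫ x, residual P t (gradient φ) x *
        divergence (fun y => P.marginalDensity y t • η y) x)) := by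
  have hslope := tendsto_slope_zero_right_of_hasDerivWithinAt_Ici
    (h.hasDerivWithinAt_stepVariation_Ici hP ht hη hc)
  simpa only [stepVariation_self hP ⟨ht.1, ht.2.le⟩ _ (hη.of_le one_le_two) hc, sub_zero,
    smul_eq_mul, inv_mul_eq_div] using hslope

theorem firstOrderOptimal_iff (hP : P.Valid) (ht : t ∈ Ico (0 : ℝ) 1)
    (h : StepAdmissible P t φ) :
    FirstOrderOptimal P t φ ↔ ∀ η : E n → E n, ContDiff ℝ (⊤ : ℕ∞) η → HasCompactSupport η →
      ∫ x, residual P t (gradient φ) x *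
        divergence (fun y => P.marginalDensity y t • η y) x = 0 := by
  constructor
  · intro hopt η hη hc
    obtain ⟨δ, hδ, hlim⟩ := hopt η hη hc
    refine tendsto_nhds_unique
      (h.tendsto_stepVariation_div hP ht (contDiff_infty.1 hη 2) hc) (hlim.congr' ?_)
    filter_upwards [hδ, h.hasDerivAt_stepKL hP ht (contDiff_infty.1 hη 1) hc]
      with Δ hδΔ hvariation
    rw [hδΔ.2.unique hvariation.2]
  · intro hall η hη hc
    refine ⟨_, h.hasDerivAt_stepKL hP ht (contDiff_infty.1 hη 1) hc, ?_⟩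
    have hlim := h.tendsto_stepVariation_div hP ht (contDiff_infty.1 hη 2) hc
    rwa [hall η hη hc] at hlim

end StepAdmissible

/- The density being positive, `ρ • η` ranges over all trial fields, in particular over the fields
`ζ • e` of constant direction. -/
theorem residual_eq_of_integral_mul_divergence_eq_zero (hP : P.Valid) (ht : t ∈ Icc (0 : ℝ) 1)
    (hw : ContDiff ℝ 1 w)
    (h : ∀ η : E n → E n, ContDiff ℝ (⊤ : ℕ∞) η → HasCompactSupport η →
      ∫ x, residual P t w x * divergence (fun y => P.marginalDensity y t • η y) x = 0)
    (x y : E n) : residual P t w x = residual P t w y := by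
  refine eq_of_integral_mul_fderiv_eq_zero volume (continuous_residual hP t hw)
    (fun ζ hζ hc e => ?_) x y
  have hη : ContDiff ℝ (⊤ : ℕ∞) fun x => (P.marginalDensity x t)⁻¹ • (ζ x • e) :=
    ((hP.contDiff_marginalDensity ht).inv fun x => (hP.marginalDensity_pos ht x).ne').smul
      (hζ.smul contDiff_const)
  have hηc : HasCompactSupport fun x => (P.marginalDensity x t)⁻¹ • (ζ x • e) :=
    HasCompactSupport.intro hc fun x hx => by
      rw [image_eq_zero_of_notMem_tsupport hx, zero_smul, smul_zero]
  have hcancel : (fun y => P.marginalDensity y t • (P.marginalDensity y t)⁻¹ • (ζ y • e)) =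
      fun y => ζ y • e := by
    funext y
    rw [smul_inv_smul₀ (hP.marginalDensity_pos ht y).ne']
  have hdiv : ∀ x, divergence (fun y => ζ y • e) x = fderiv ℝ ζ x e := by
    intro x
    have hconst : divergence (fun _ : E n => e) x = 0 := by simp [divergence]
    rw [divergence_smul (hζ.differentiable (by simp) x) (differentiableAt_const e), hconst,
      mul_zero, zero_add]
  simpa only [hcancel, hdiv] using h _ hη hηc

theorem eq_zero_of_residual_eq_const (hP : P.Valid) (ht : t ∈ Icc (0 : ℝ) 1)
    (hw : ContDiff ℝ 1 w) (hwi : Integrable w (P.marginalLaw t)) {c : ℝ}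
    (hres : ∀ x, residual P t w x = c) : c = 0 := by
  have hρ : ContDiff ℝ 1 fun x => P.marginalDensity x t :=
    contDiff_infty.1 (hP.contDiff_marginalDensity ht) 1
  have hρw : ContDiff ℝ 1 fun x => P.marginalDensity x t • w x := hρ.smul hw
  have hρwi : Integrable fun x => P.marginalDensity x t • w x := by
    refine ((integrable_marginalLaw_iff hP ht _).1 hwi.norm).mono'
      hρw.continuous.aestronglyMeasurable (.of_forall fun x => ?_)
    rw [norm_smul, Real.norm_of_nonneg (hP.marginalDensity_pos ht x).le]
  have hdiv : divergence (fun y => P.marginalDensity y t • w y) =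
      fun x => P.source x t + P.marginalDensity x t * c := by
    funext x
    rw [← hres x, ← divergence_marginalDensity_smul_sub_source hP ht
      (hw.differentiable one_ne_zero), add_sub_cancel]
  have hsource := hP.integrable_source ht
  have hconst := (hP.integrable_marginalDensity ht).mul_const c
  have hzero := integral_divergence_eq_zero_of_integrable hρw hρwi (hdiv ▸ hsource.add hconst)
  rw [hdiv, integral_add hsource hconst, hP.integral_source ht, integral_mul_const,
    hP.integral_marginalDensity ht] at hzero
  linarith

theorem StepAdmissible.solvesPoisson_iff_firstOrderOptimal (hP : P.Valid)
    (ht : t ∈ Ico (0 : ℝ) 1) (h : StepAdmissible P t φ) :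
    SolvesPoisson P t φ ↔ FirstOrderOptimal P t φ := by
  have htIcc : t ∈ Icc (0 : ℝ) 1 := ⟨ht.1, ht.2.le⟩
  have := hP.isProbabilityMeasure_marginalLaw htIcc
  have hgrad := contDiff_gradient h.smooth
  rw [solvesPoisson_iff_residual_eq_zero hP htIcc h.smooth, h.firstOrderOptimal_iff hP ht]
  refine ⟨fun hres η _ _ => by simp [hres], fun hall x => ?_⟩
  have hconst := residual_eq_of_integral_mul_divergence_eq_zero hP htIcc hgrad hall
  exact eq_zero_of_residual_eq_const hP htIcc hgrad
    (h.memH10.memLp_gradient.integrable one_le_two) fun y => hconst y x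

end Optimality

end VPFB

end

theorem proposition3 {n : ℕ} (P : VPFB.Params n) (hP : P.Valid) :
    (∀ t ∈ Set.Ico (0 : ℝ) 1, ∀ φ : VPFB.E n → ℝ, VPFB.StepAdmissible P t φ →
      (VPFB.SolvesPoisson P t φ ↔ VPFB.FirstOrderOptimal P t φ)) ∧
    (∀ (Φ : VPFB.E n → ℝ → ℝ) (X : VPFB.E n → ℝ → VPFB.E n), VPFB.IsPotentialFlow P Φ X →
      ((∀ t ∈ Set.Icc (0 : ℝ) 1, VPFB.SolvesPoisson P t fun x => Φ x t) ↔
        ∀ t ∈ Set.Icc (0 : ℝ) 1, VPFB.flowLaw P X t = P.marginalLaw t) ∧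
      ((∀ t ∈ Set.Icc (0 : ℝ) 1, VPFB.SolvesPoisson P t fun x => Φ x t) →
        ∀ t ∈ Set.Icc (0 : ℝ) 1, VPFB.MinimizesKL P X t) ∧
      ((∃ (Ψ : VPFB.E n → ℝ → ℝ) (Y : VPFB.E n → ℝ → VPFB.E n), VPFB.IsPotentialFlow P Ψ Y ∧
          ∀ t ∈ Set.Icc (0 : ℝ) 1, VPFB.SolvesPoisson P t fun x => Ψ x t) →
        (∀ t ∈ Set.Icc (0 : ℝ) 1, VPFB.MinimizesKL P X t) →
        ∀ t ∈ Set.Icc (0 : ℝ) 1, VPFB.SolvesPoisson P t fun x => Φ x t)) := by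
  refine ⟨fun t ht φ h => h.solvesPoisson_iff_firstOrderOptimal hP ht,
    fun Φ X h => ⟨h.solvesPoisson_iff_flowLaw_eq hP,
      fun hsol t ht => h.minimizesKL_of_solvesPoisson hP hsol ht, ?_⟩⟩
  rintro ⟨Ψ, Y, hY, hsol⟩ hmin
  exact h.solvesPoisson_of_minimizesKL hP hY hsol hmin
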